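/- Let $\Bbbk$ be an algebraically closed field of characteristic $0$, $\xi\in\Bbbk$ a primitive fourth root of unity and $\sqrt2\in\Bbbk$ a square root of $2$. Let $\mathcal K$ be the ($8$-dimensional) Hopf algebra generated as an algebra by $a,b,c,d$ with relations $$ab=\xi ba,\quad ac=\xi ca,\quad cb=bc=0,\quad cd=\xi dc,\quad bd=\xi db,\quad ad=da=1,\quad b^2=c^2=0,\quad a^2c=b,\quad a^4=1,$$ with $\Delta(a)=a\otimes a+b\otimes c$, $\Delta(b)=a\otimes b+b\otimes d$, $\Delta(c)=c\otimes a+d\otimes c$, $\Delta(d)=c\otimes b+d\otimes d$, $\varepsilon(a)=\varepsilon(d)=1$, $\varepsilon(b)=\varepsilon(c)=0$, and antipode $\mathcal S(a)=d$, $\mathcal S(b)=\xi b$, $\mathcal S(c)=-\xi c$, $\mathcal S(d)=a$. Let $D=D(\mathcal K^{\mathrm{cop}})=\mathcal K^*\otimes\mathcal K$ be the Drinfeld double of $\mathcal K^{\mathrm{cop}}$; writing $f\bowtie h$ for $f\otimes h$, its unit is $\varepsilon\bowtie 1$, its product is $(f\bowtie h)(g\bowtie l)=\sum f\cdot g(\mathcal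 S(h_{(1)})\,?\,h_{(3)})\bowtie h_{(2)}l$ with $(f\cdot g)(m)=\sum f(m_{(2)})g(m_{(1)})$, and its coproduct is $\Delta(f\bowtie h)=\sum (f_{(2)}\bowtie h_{(2)})\otimes(f_{(1)}\bowtie h_{(1)})$, all Sweedler indices referring to $\mathcal K$ and to its dual coalgebra structure $f(xy)=\sum f_{(1)}(x)f_{(2)}(y)$. In terms of the basis of $\mathcal K^*$ dual to the basis $1,a,b,c,d,a^2,ab,ac$ of $\mathcal K$, let $g=1^*+\xi^{-1}a^*+\xi d^*-(a^2)^*$ and $x=\sqrt2\,\xi\,(b^*+c^*+(ab)^*+(ac)^*)$. Identify $h\in\mathcal K$ with $\varepsilon\bowtie h\in D$, and $f\in\mathcal K^*$ with $f\bowtie 1\in D$. Then there are unique $D$-modules with the following actions of $a,b,c,d,x,g$ on a fixed basis. * For $\ell\in\mathbb Z_4$: the one-dimensional module $\Bbbk_{\chi^\ell}$ given by the character $\chi^\ell(a)=\xi^\ell$, $\chi^\ell(d)=\xi^{-\ell}$, $\chi^\ell(g)=(-1)^\ell$, $\chi^\ell(b)=\chi^\ell(c)=\chi^\ell(x)=0$.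 * For $(i,j)\in\Lambda=\{(i,j)\in\mathbb Z_4\times\mathbb Z_4 : 2i\ne j\}$: the two-dimensional module $V_{i,j}$ given by the matrices (acting on column vectors) $$a\mapsto\begin{pmatrix}\xi^i&0\\0&\xi^{i+3}\end{pmatrix},\quad b\mapsto\begin{pmatrix}0&(-1)^i\\0&0\end{pmatrix},\quad c\mapsto\begin{pmatrix}0&1\\0&0\end{pmatrix},\quad d\mapsto\begin{pmatrix}\xi^{-i}&0\\0&\xi^{-i+1}\end{pmatrix},$$ $$g\mapsto\begin{pmatrix}\xi^j&0\\0&\xi^{j+2}\end{pmatrix},\quad x\mapsto\begin{pmatrix}0&\frac{\sqrt2}2\xi(\xi^i+\xi^{3i+j})\\\sqrt2\,\xi(\xi^{3i}-\xi^{i+j})&0\end{pmatrix}.$$ * The four-dimensional module $P$ with basis $p_1,p_2,p_3,p_4$ on which $a$, $d$, $g$ act by the diagonal matrices $\mathrm{diag}(1,-\xi,\xi,1)$, $\mathrm{diag}(1,\xi,-\xi,1)$, $\mathrm{diag}(1,-1,-1,1)$, and $$b:\ p_1\mapsto p_3,\ p_2\mapsto\xi p_4,\ p_3,p_4\mapsto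 0;\qquad c:\ p_1\mapsto -p_3,\ p_2\mapsto \xi p_4,\ p_3,p_4\mapsto0;$$ $$x:\ p_1\mapsto p_2+\sqrt2\,p_3,\ p_2\mapsto-\sqrt2\,p_4,\ p_3\mapsto p_4,\ p_4\mapsto0.$$ Moreover $P_1(\Bbbk_{\chi^\ell}):=P\otimes\Bbbk_{\chi^\ell}$, with $D$ acting through its coproduct, is a $D$-module for every $\ell\in\mathbb Z_4$. The modules $P_1(\Bbbk_{\chi^\ell})$ ($\ell\in\mathbb Z_4$) and $V_{i,j}$ ($(i,j)\in\Lambda$) are the projective covers of the simple $D$-modules. Precisely: each $\Bbbk_{\chi^\ell}$ is simple with projective cover $P_1(\Bbbk_{\chi^\ell})$; each $V_{i,j}$ is simple and is its own projective cover; and every simple $D$-module has exactly one of these sixteen modules as its projective cover. In particular, as left $D$-modules, $${}_DD\;\simeq\;\bigoplus_{\ell\in\mathbb Z_4}P_1(\Bbbk_{\chi^\ell})\;\oplus\bigoplus_{(i,j)\in\Lambda}V_{i,j}^{\,2}.$$ -/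

import Mathlib

universe u v w

open scoped TensorProduct

noncomputable section

/-! ## The Drinfeld double of `H^cop` -/

namespace DoubleCop

open Coalgebra HopfAlgebra

section General

variable {k : Type u} [Field k] {H : Type v} [Ring H] [HopfAlgebra k H]

/-- The iterated comultiplication `h ↦ ∑ h₍₁₎ ⊗ (h₍₂₎ ⊗ h₍₃₎)` of `H`. -/
def comul₃ : H →ₗ[k] H ⊗[k] (H ⊗[k] H) :=
  (comul (R := k) (A := H)).lTensor H ∘ₗ comul

/-- The product of the algebra `(H^cop)^*`: `(f · g)(m) = ∑ f(m₍₂₎) g(m₍₁₎)`, where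
`∑ m₍₁₎ ⊗ m₍₂₎` is the comultiplication of `H`. -/
def dualMul : Module.Dual k H →ₗ[k] Module.Dual k H →ₗ[k] Module.Dual k H :=
  LinearMap.mk₂ k
    (fun f g => LinearMap.mul' k k ∘ₗ TensorProduct.map f g ∘ₗ
      (TensorProduct.comm k H H).toLinearMap ∘ₗ comul)
    (fun f f' g => by ext; simp [TensorProduct.map_add_left])
    (fun c f g => by ext; simp [TensorProduct.map_smul_left])
    (fun f g g' => by ext; simp [TensorProduct.map_add_right])
    (fun c f g => by ext; simp [TensorProduct.map_smul_right])

lemma dualMul_apply (f g : Module.Dual k H) (m : H) :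
    dualMul f g m = LinearMap.mul' k k (TensorProduct.map f g
      (TensorProduct.comm k H H (comul m))) := rfl

/-- `coad x z g` is the functional `m ↦ g (S(x) m z)` on `H`. -/
def coad : H →ₗ[k] H →ₗ[k] Module.Dual k H →ₗ[k] Module.Dual k H :=
  LinearMap.mk₂ k
    (fun x z => Module.Dual.transpose
      (LinearMap.mulLeft k (antipode k x) ∘ₗ LinearMap.mulRight k z))
    (fun x x' z => by ext; simp [add_mul, Module.Dual.transpose_apply])
    (fun c x z => by ext; simp [Module.Dual.transpose_apply])
    (fun x z z' => by ext; simp [mul_add, Module.Dual.transpose_apply])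
    (fun c x z => by ext; simp [Module.Dual.transpose_apply])

@[simp] lemma coad_apply (x z : H) (g : Module.Dual k H) (m : H) :
    coad x z g m = g (antipode k x * (m * z)) := rfl

/-- The linear map `x ⊗ (y ⊗ z) ↦ g(S(x) ? z) ⊗ y`. -/
def twistCore (g : Module.Dual k H) : H ⊗[k] (H ⊗[k] H) →ₗ[k] Module.Dual k H ⊗[k] H :=
  TensorProduct.map ((TensorProduct.lift coad).flip g) LinearMap.id ∘ₗ
    (TensorProduct.assoc k H H H).symm.toLinearMap ∘ₗ
      (TensorProduct.comm k H H).toLinearMap.lTensor H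

@[simp] lemma twistCore_tmul (g : Module.Dual k H) (x y z : H) :
    twistCore g (x ⊗ₜ (y ⊗ₜ z)) = coad x z g ⊗ₜ[k] y := by
  simp [twistCore]

/-- `twist h g = ∑ g(S(h₍₁₎) ? h₍₃₎) ⊗ h₍₂₎`. -/
def twist : H →ₗ[k] Module.Dual k H →ₗ[k] Module.Dual k H ⊗[k] H :=
  LinearMap.mk₂ k (fun h g => twistCore g (comul₃ h))
    (fun h h' g => by simp)
    (fun c h g => by simp)
    (fun h g g' => by simp [twistCore, TensorProduct.map_add_left])
    (fun c h g => by simp [twistCore, TensorProduct.map_smul_left])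

lemma twist_apply (h : H) (g : Module.Dual k H) : twist h g = twistCore g (comul₃ h) := rfl

lemma mulRight_add (l l' : H) : LinearMap.mulRight k (l + l') =
    LinearMap.mulRight k l + LinearMap.mulRight k l' := by ext; simp [mul_add]

lemma mulRight_smul (c : k) (l : H) : LinearMap.mulRight k (c • l) =
    c • LinearMap.mulRight k l := by ext; simp

/-- The product of the Drinfeld double of `H^cop`, as a bilinear map on `H^* ⊗ H`:
`(f ⋈ h) (g ⋈ l) = ∑ f · g(S(h₍₁₎) ? h₍₃₎) ⋈ h₍₂₎ l`. -/
def doubleMul : Module.Dual k H ⊗[k] H →ₗ[k]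
    Module.Dual k H ⊗[k] H →ₗ[k] Module.Dual k H ⊗[k] H :=
  TensorProduct.lift <| LinearMap.mk₂ k
    (fun f h => TensorProduct.lift <| LinearMap.mk₂ k
      (fun g l => TensorProduct.map (dualMul f) (LinearMap.mulRight k l) (twist h g))
      (fun g g' l => by simp)
      (fun c g l => by simp)
      (fun g l l' => by rw [mulRight_add, TensorProduct.map_add_right]; rfl)
      (fun c g l => by rw [mulRight_smul, TensorProduct.map_smul_right]; rfl))
    (fun f f' h => by ext; simp [TensorProduct.map_add_left])
    (fun c f h => by ext; simp [TensorProduct.map_smul_left])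
    (fun f h h' => by ext; simp)
    (fun c f h => by ext; simp)

@[simp] lemma doubleMul_tmul (f g : Module.Dual k H) (h l : H) :
    doubleMul (f ⊗ₜ[k] h) (g ⊗ₜ[k] l) =
      TensorProduct.map (dualMul f) (LinearMap.mulRight k l) (twist h g) := rfl

lemma dualMul_eq_conv (f g : Module.Dual k H) :
    dualMul f g = (WithConv.toConv g * WithConv.toConv f).ofConv := by
  ext m
  rw [dualMul_apply, LinearMap.convMul_def]
  simp only [LinearMap.comp_apply]
  induction comul (R := k) m using TensorProduct.induction_on with
  | zero => simp
  | tmul x y => simp [mul_comm]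
  | add x y hx hy => simp_all

lemma dualMul_assoc (f g e : Module.Dual k H) :
    dualMul (dualMul f g) e = dualMul f (dualMul g e) := by
  simp only [dualMul_eq_conv, WithConv.toConv_ofConv, mul_assoc]

lemma counit_eq_conv : (counit : Module.Dual k H) =
    (1 : WithConv (H →ₗ[k] k)).ofConv := by
  ext; simp [LinearMap.convOne_def]

lemma counit_dualMul (f : Module.Dual k H) : dualMul counit f = f := by
  rw [dualMul_eq_conv, counit_eq_conv]; simp

lemma dualMul_counit (f : Module.Dual k H) : dualMul f counit = f := by
  rw [dualMul_eq_conv, counit_eq_conv]; simp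

section antipode
open WithConv LinearMap

lemma aux_coassoc : TensorProduct.map (comul (R := k) (A := H)) (comul (R := k) (A := H)) ∘ₗ comul =
    (TensorProduct.assoc k H H (H ⊗[k] H)).symm.toLinearMap ∘ₗ
    TensorProduct.map id ((TensorProduct.assoc k H H H).toLinearMap ∘ₗ
      TensorProduct.map comul id) ∘ₗ comul₃ := by
  simp only [comul₃, coassoc_simps]

lemma comul_antipode (x : H) : comul (R := k) (antipode k x) =
    TensorProduct.map (antipode k) (antipode k) (TensorProduct.comm k H H (comul x)) := by
  have key : toConv (TensorProduct.map (antipode k) (antipode k) ∘ₗ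
      (TensorProduct.comm k H H).toLinearMap ∘ₗ comul) = toConv (comul ∘ₗ antipode k) := by
    refine left_inv_eq_right_inv (a := toConv (comul (R := k) (A := H))) ?_ comul_right_inv
    apply WithConv.ext
    let T := LinearMap.mul' k (H ⊗[k] H) ∘ₗ TensorProduct.map (TensorProduct.map (antipode k) (antipode k) ∘ₗ
      (TensorProduct.comm k H H).toLinearMap) LinearMap.id
    have h1 : (toConv (TensorProduct.map (antipode k) (antipode k) ∘ₗ
      (TensorProduct.comm k H H).toLinearMap ∘ₗ comul) * toConv (comul (R := k) (A := H))).ofConv =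
       T ∘ₗ TensorProduct.map (comul (R := k) (A := H)) (comul (R := k) (A := H)) ∘ₗ comul := by
      simp only [LinearMap.convMul_def, ofConv_toConv, T, coassoc_simps]
    rw [h1, aux_coassoc]
    have h2 : T ∘ₗ (TensorProduct.assoc k H H (H ⊗[k] H)).symm.toLinearMap ∘ₗ
        TensorProduct.map id ((TensorProduct.assoc k H H H).toLinearMap ∘ₗ
          TensorProduct.map comul id) =
        (TensorProduct.mk k H H 1) ∘ₗ LinearMap.mul' k H ∘ₗ
          TensorProduct.map (antipode k) ((TensorProduct.lid k H).toLinearMap ∘ₗ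
            TensorProduct.map counit id) := by
      ext x y z
      have : ∀ Y : H ⊗[k] H, T ((TensorProduct.assoc k H H (H ⊗[k] H)).symm
          (x ⊗ₜ (TensorProduct.assoc k H H H (Y ⊗ₜ z)))) =
          LinearMap.mul' k H ((antipode k).rTensor H Y) ⊗ₜ (antipode k x * z) := by
        intro Y
        induction Y using TensorProduct.induction_on with
        | zero => simp
        | tmul a b => simp [T]
        | add a b ha hb => simp_all [TensorProduct.add_tmul, TensorProduct.tmul_add]
      simp [this, Algebra.algebraMap_eq_smul_one, TensorProduct.smul_tmul]
    have h3 : TensorProduct.map (antipode k) ((TensorProduct.lid k H).toLinearMap ∘ₗ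
            TensorProduct.map counit id) ∘ₗ comul₃ (k := k) (H := H) =
        TensorProduct.map (antipode k) id ∘ₗ comul := by
      have := Coalgebra.rTensor_counit_comp_comul (R := k) (A := H)
      rw [comul₃, LinearMap.lTensor_def, ← LinearMap.comp_assoc, ← TensorProduct.map_comp,
        LinearMap.comp_assoc, ← LinearMap.rTensor_def, this]
      congr 2
      ext; simp
    calc _ = (TensorProduct.mk k H H 1) ∘ₗ LinearMap.mul' k H ∘ₗ
          (TensorProduct.map (antipode k) ((TensorProduct.lid k H).toLinearMap ∘ₗ
            TensorProduct.map counit id) ∘ₗ comul₃ (k := k) (H := H)) := by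
            exact LinearMap.ext fun a => LinearMap.congr_fun h2 (comul₃ a)
      _ = _ := by
        rw [h3]
        ext a
        have := mul_antipode_rTensor_comul_apply (R := k) a
        rw [LinearMap.rTensor_def] at this
        simp [this, Algebra.algebraMap_eq_smul_one, Algebra.TensorProduct.one_def]
  exact LinearMap.congr_fun (WithConv.toConv_injective key.symm) x

end antipode

lemma twistCore_mul_tmul (X : H ⊗[k] (H ⊗[k] H)) (x' y' z' : H) (e : Module.Dual k H) :
    twistCore e (X * (x' ⊗ₜ[k] (y' ⊗ₜ[k] z'))) =
      TensorProduct.map LinearMap.id (LinearMap.mulRight k y') (twistCore (coad x' z' e) X) := by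
  induction X using TensorProduct.induction_on with
  | zero => simp
  | add a b ha hb => rw [add_mul, map_add, ha, hb, map_add, map_add]
  | tmul x b =>
    induction b using TensorProduct.induction_on with
    | zero => simp
    | add a b ha hb =>
      rw [TensorProduct.tmul_add, add_mul, map_add, ha, hb, map_add, map_add]
    | tmul y z =>
      simp only [Algebra.TensorProduct.tmul_mul_tmul, twistCore_tmul, TensorProduct.map_tmul,
        LinearMap.id_apply, LinearMap.mulRight_apply]
      congr 1
      ext m
      simp [antipode_mul_antidistrib, mul_assoc]

lemma comul₃_mul (h h' : H) : comul₃ (k := k) (h * h') = comul₃ (k := k) h * comul₃ (k := k) h' := by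
  have : ∀ X, (comul (R := k) (A := H)).lTensor H X =
      (Algebra.TensorProduct.map (AlgHom.id k H) (Bialgebra.comulAlgHom k H)) X := fun X => rfl
  simp only [comul₃, LinearMap.comp_apply, this, Bialgebra.comul_mul, map_mul]

lemma twist_mul (h h' : H) (e : Module.Dual k H) :
    twist (h * h') e = doubleMul (counit ⊗ₜ[k] h) (twist h' e) := by
  rw [twist_apply, comul₃_mul, twist_apply h']
  generalize comul₃ (k := k) h' = Y
  induction Y using TensorProduct.induction_on with
  | zero => simp only [mul_zero, map_zero]
  | add a b ha hb => rw [mul_add, map_add, ha, hb, map_add, map_add]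
  | tmul x' b =>
    induction b using TensorProduct.induction_on with
    | zero => simp only [TensorProduct.tmul_zero, mul_zero, map_zero]
    | add a b ha hb => rw [TensorProduct.tmul_add, mul_add, map_add, ha, hb, map_add, map_add]
    | tmul y' z' =>
      rw [twistCore_mul_tmul, twistCore_tmul, doubleMul_tmul, ← twist_apply]
      congr 2
      ext1 f
      rw [counit_dualMul, LinearMap.id_apply]

/-- The linear map `x₁ ⊗ ((x₂ ⊗ (y ⊗ z₁)) ⊗ z₂) ↦ (coad x₁ z₂ g) · (coad x₂ z₁ e) ⊗ y`. -/
def twistPair (g e : Module.Dual k H) :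
    H ⊗[k] ((H ⊗[k] (H ⊗[k] H)) ⊗[k] H) →ₗ[k] Module.Dual k H ⊗[k] H :=
  TensorProduct.lift <| LinearMap.mk₂ k
    (fun x₁ Y => TensorProduct.lift (LinearMap.mk₂ k
      (fun W z₂ => TensorProduct.map (dualMul (coad x₁ z₂ g)) LinearMap.id (twistCore e W))
      (by simp) (by simp) (by simp [TensorProduct.map_add_left])
      (by simp [TensorProduct.map_smul_left])) Y)
    (fun x x' Y => by
      rw [← LinearMap.add_apply]; congr 1; ext; simp [TensorProduct.add_tmul])
    (fun c x Y => by
      rw [← LinearMap.smul_apply]; congr 1; ext; simp [TensorProduct.smul_tmul'])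
    (by simp) (by simp)

@[simp] lemma twistPair_tmul (g e : Module.Dual k H) (x₁ z₂ : H) (W : H ⊗[k] (H ⊗[k] H)) :
    twistPair g e (x₁ ⊗ₜ (W ⊗ₜ z₂)) =
      TensorProduct.map (dualMul (coad x₁ z₂ g)) LinearMap.id (twistCore e W) := rfl

/-- `x ⊗ (y ⊗ z) ↦ x₁ ⊗ ((x₂ ⊗ (y ⊗ z₁)) ⊗ z₂)`. -/
def spread : H ⊗[k] (H ⊗[k] H) →ₗ[k] H ⊗[k] ((H ⊗[k] (H ⊗[k] H)) ⊗[k] H) :=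
  ((TensorProduct.assoc k H (H ⊗[k] H) H).symm.toLinearMap ∘ₗ
    ((TensorProduct.assoc k H H H).symm.toLinearMap.lTensor H)).lTensor H ∘ₗ
  (TensorProduct.assoc k H H (H ⊗[k] (H ⊗[k] H))).toLinearMap ∘ₗ
  TensorProduct.map (comul (R := k) (A := H)) ((comul (R := k) (A := H)).lTensor H)

lemma spread_comul₃ : spread ∘ₗ comul₃ (k := k) (H := H) =
    (TensorProduct.map LinearMap.id (TensorProduct.map comul₃ LinearMap.id)) ∘ₗ comul₃ := by
  simp only [spread, comul₃, coassoc_simps]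

/-- The functional `m ↦ (g · e)(S(x) m z)`, in terms of `X = ∑ x₍₁₎ ⊗ x₍₂₎` and
`Z = ∑ z₍₁₎ ⊗ z₍₂₎`. -/
def pairing (g e : Module.Dual k H) (X Z : H ⊗[k] H) : Module.Dual k H :=
  LinearMap.mul' k k ∘ₗ TensorProduct.map g e ∘ₗ (TensorProduct.comm k H H).toLinearMap ∘ₗ
    LinearMap.mulLeft k (TensorProduct.map (antipode k) (antipode k)
      (TensorProduct.comm k H H X)) ∘ₗ LinearMap.mulRight k Z ∘ₗ comul

lemma coad_dualMul (x z : H) (g e : Module.Dual k H) :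
    coad x z (dualMul g e) = pairing g e (comul x) (comul z) := by
  ext m
  simp only [coad_apply, dualMul_apply, Bialgebra.comul_mul, comul_antipode]
  rfl

lemma pairing_tmul (g e : Module.Dual k H) (x₁ x₂ z₁ z₂ : H) :
    pairing g e (x₁ ⊗ₜ x₂) (z₁ ⊗ₜ z₂) = dualMul (coad x₁ z₂ g) (coad x₂ z₁ e) := by
  ext m
  simp only [pairing, dualMul_apply, LinearMap.comp_apply]
  induction comul (R := k) m using TensorProduct.induction_on with
  | zero => simp
  | add a b ha hb => simp only [map_add, ha, hb]
  | tmul a b => simp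

lemma twistCore_dualMul (g e : Module.Dual k H) :
    twistCore (dualMul g e) = twistPair g e ∘ₗ spread := by
  ext x y z : 5
  have key : ∀ X Z : H ⊗[k] H, pairing g e X Z ⊗ₜ[k] y = twistPair g e
      (((TensorProduct.assoc k H (H ⊗[k] H) H).symm.toLinearMap ∘ₗ
        ((TensorProduct.assoc k H H H).symm.toLinearMap.lTensor H)).lTensor H
        (TensorProduct.assoc k H H (H ⊗[k] (H ⊗[k] H)) (X ⊗ₜ (y ⊗ₜ Z)))) := by
    intro X Z
    induction X using TensorProduct.induction_on with
    | zero => simp [pairing]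
    | add a b ha hb =>
      simp only [TensorProduct.add_tmul, map_add, ← ha, ← hb]
      rw [← TensorProduct.add_tmul]
      congr 1
      ext m
      simp [pairing, add_mul]
    | tmul x₁ x₂ =>
      induction Z using TensorProduct.induction_on with
      | zero => simp [pairing]
      | add a b ha hb =>
        simp only [TensorProduct.tmul_add, map_add, ← ha, ← hb]
        rw [← TensorProduct.add_tmul]
        congr 1
        ext m
        simp [pairing, mul_add]
      | tmul z₁ z₂ => simp [pairing_tmul]
  simp only [TensorProduct.AlgebraTensorModule.curry_apply, TensorProduct.curry_apply,
    LinearMap.coe_restrictScalars, LinearMap.comp_apply, twistCore_tmul, coad_dualMul]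
  exact key (comul x) (comul z)

lemma mulRight_one : LinearMap.mulRight k (1 : H) = LinearMap.id := by ext; simp

lemma twist_dualMul (h : H) (g e : Module.Dual k H) :
    twist h (dualMul g e) = doubleMul (twist h g) (e ⊗ₜ[k] 1) := by
  rw [twist_apply, twistCore_dualMul, LinearMap.comp_apply, ← LinearMap.comp_apply spread comul₃,
    spread_comul₃, LinearMap.comp_apply, twist_apply]
  generalize comul₃ (k := k) h = X
  induction X using TensorProduct.induction_on with
  | zero => simp only [map_zero, LinearMap.zero_apply]
  | add a b ha hb => simp only [map_add, ha, hb, LinearMap.add_apply]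
  | tmul x b =>
    induction b using TensorProduct.induction_on with
    | zero => simp only [TensorProduct.tmul_zero, map_zero, LinearMap.zero_apply]
    | add a b ha hb =>
      simp only [TensorProduct.tmul_add, map_add, ha, hb, LinearMap.add_apply]
    | tmul y z =>
      simp only [TensorProduct.map_tmul, LinearMap.id_apply, twistPair_tmul, twistCore_tmul,
        doubleMul_tmul, mulRight_one, twist_apply]

lemma doubleMul_left (f : Module.Dual k H) (X Y : Module.Dual k H ⊗[k] H) :
    doubleMul (TensorProduct.map (dualMul f) LinearMap.id X) Y =
      TensorProduct.map (dualMul f) LinearMap.id (doubleMul X Y) := by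
  induction X using TensorProduct.induction_on with
  | zero => simp only [map_zero, LinearMap.zero_apply]
  | add a b ha hb => simp only [map_add, ha, hb, LinearMap.add_apply]
  | tmul g h =>
  induction Y using TensorProduct.induction_on with
  | zero => simp only [map_zero]
  | add a b ha hb => simp only [map_add, ha, hb]
  | tmul e m =>
    simp only [doubleMul_tmul, TensorProduct.map_tmul, LinearMap.id_apply]
    induction twist h e using TensorProduct.induction_on with
    | zero => simp only [map_zero]
    | add a b ha hb => simp only [map_add, ha, hb]
    | tmul a b => simp [dualMul_assoc]

lemma doubleMul_right (X Y : Module.Dual k H ⊗[k] H) (l : H) :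
    doubleMul X (TensorProduct.map LinearMap.id (LinearMap.mulRight k l) Y) =
      TensorProduct.map LinearMap.id (LinearMap.mulRight k l) (doubleMul X Y) := by
  induction X using TensorProduct.induction_on with
  | zero => simp only [map_zero, LinearMap.zero_apply]
  | add a b ha hb => simp only [map_add, ha, hb, LinearMap.add_apply]
  | tmul g h =>
  induction Y using TensorProduct.induction_on with
  | zero => simp only [map_zero]
  | add a b ha hb => simp only [map_add, ha, hb]
  | tmul e m =>
    simp only [doubleMul_tmul, TensorProduct.map_tmul, LinearMap.id_apply]
    induction twist h e using TensorProduct.induction_on with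
    | zero => simp only [map_zero]
    | add a b ha hb => simp only [map_add, ha, hb]
    | tmul a b => simp [mul_assoc]

lemma doubleMul_tmul' (f g : Module.Dual k H) (h l : H) :
    doubleMul (f ⊗ₜ[k] h) (g ⊗ₜ[k] l) =
      TensorProduct.map (dualMul f) LinearMap.id
        (TensorProduct.map LinearMap.id (LinearMap.mulRight k l) (twist h g)) := by
  rw [doubleMul_tmul]
  generalize twist h g = S
  rw [← LinearMap.comp_apply, ← TensorProduct.map_comp, LinearMap.id_comp,
    LinearMap.comp_id]

lemma tmul_eq_left (f : Module.Dual k H) (h : H) :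
    f ⊗ₜ[k] h = TensorProduct.map (dualMul f) LinearMap.id (counit (R := k) ⊗ₜ[k] h) := by
  rw [TensorProduct.map_tmul, dualMul_counit, LinearMap.id_apply]

lemma tmul_eq_right (f : Module.Dual k H) (h : H) :
    f ⊗ₜ[k] h = TensorProduct.map LinearMap.id (LinearMap.mulRight k h) (f ⊗ₜ[k] 1) := by
  simp

lemma aux_left (S : Module.Dual k H ⊗[k] H) (l : H) (e : Module.Dual k H) :
    doubleMul (TensorProduct.map LinearMap.id (LinearMap.mulRight k l) S) (e ⊗ₜ[k] 1) =
      doubleMul S (twist l e) := by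
  induction S using TensorProduct.induction_on with
  | zero => simp only [map_zero, LinearMap.zero_apply]
  | add a b ha hb => simp only [map_add, ha, hb, LinearMap.add_apply]
  | tmul g y =>
    rw [TensorProduct.map_tmul, LinearMap.mulRight_apply, LinearMap.id_apply, tmul_eq_left g y,
      doubleMul_left, ← twist_mul, doubleMul_tmul, mulRight_one]

lemma aux_right (T : Module.Dual k H ⊗[k] H) (h : H) (g : Module.Dual k H) :
    doubleMul (counit ⊗ₜ[k] h) (TensorProduct.map (dualMul g) LinearMap.id T) =
      doubleMul (twist h g) T := by
  induction T using TensorProduct.induction_on with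
  | zero => simp only [map_zero]
  | add a b ha hb => simp only [map_add, ha, hb]
  | tmul e y =>
    rw [TensorProduct.map_tmul, LinearMap.id_apply, tmul_eq_right e y, doubleMul_right,
      ← twist_dualMul, tmul_eq_right (dualMul g e) y, doubleMul_right, doubleMul_tmul,
      mulRight_one]
    congr 1
    have : dualMul (counit (R := k) (A := H)) = LinearMap.id := by
      ext1 f; rw [counit_dualMul, LinearMap.id_apply]
    rw [this, TensorProduct.map_id, LinearMap.id_apply]

lemma comul₃_one : comul₃ (1 : H) = (1 : H) ⊗ₜ[k] ((1 : H) ⊗ₜ[k] (1 : H)) := by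
  simp [comul₃, Algebra.TensorProduct.one_def]

lemma coad_one_one (g : Module.Dual k H) : coad 1 1 g = g := by
  ext; simp

lemma twist_one_left (g : Module.Dual k H) : twist 1 g = g ⊗ₜ[k] (1 : H) := by
  simp [twist_apply, comul₃_one, coad_one_one]

lemma coad_counit (x z : H) : coad x z (counit (R := k)) =
    (counit (R := k) x * counit (R := k) z) • counit := by
  ext m; simp; ring

lemma twist_counit (h : H) : twist h (counit (R := k)) = counit (R := k) ⊗ₜ[k] h := by
  have h1 : twistCore (counit (R := k) (A := H)) =
      TensorProduct.mk k (Module.Dual k H) H counit ∘ₗ (TensorProduct.lid k H).toLinearMap ∘ₗ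
        TensorProduct.map counit
          ((TensorProduct.rid k H).toLinearMap ∘ₗ TensorProduct.map LinearMap.id counit) := by
    ext x y z : 5
    simp [coad_counit, TensorProduct.smul_tmul', mul_smul]
    rw [smul_comm]
  have h2 : (TensorProduct.lid k H).toLinearMap ∘ₗ
        TensorProduct.map counit
          ((TensorProduct.rid k H).toLinearMap ∘ₗ TensorProduct.map LinearMap.id counit) ∘ₗ
          comul₃ (k := k) (H := H) = LinearMap.id := by
    have e1 : (TensorProduct.rid k H).toLinearMap ∘ₗ TensorProduct.map LinearMap.id counit ∘ₗ
        comul (R := k) (A := H) = LinearMap.id := by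
      rw [← LinearMap.lTensor_def, Coalgebra.lTensor_counit_comp_comul]; ext; simp
    have e2 : (TensorProduct.lid k H).toLinearMap ∘ₗ TensorProduct.map counit LinearMap.id ∘ₗ
        comul (R := k) (A := H) = LinearMap.id := by
      rw [← LinearMap.rTensor_def, Coalgebra.rTensor_counit_comp_comul]; ext; simp
    rw [comul₃, LinearMap.lTensor_def, ← LinearMap.comp_assoc _ _ (TensorProduct.map _ _),
      ← TensorProduct.map_comp, LinearMap.comp_assoc, e1, LinearMap.comp_id, e2]
  rw [twist_apply, h1]
  exact congrArg (TensorProduct.mk k (Module.Dual k H) H counit) (LinearMap.congr_fun h2 h)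

lemma doubleMul_assoc (X Y Z : Module.Dual k H ⊗[k] H) :
    doubleMul (doubleMul X Y) Z = doubleMul X (doubleMul Y Z) := by
  induction X using TensorProduct.induction_on with
  | zero => simp only [map_zero, LinearMap.zero_apply]
  | add a b ha hb => simp only [map_add, ha, hb, LinearMap.add_apply]
  | tmul f h =>
  induction Y using TensorProduct.induction_on with
  | zero => simp only [map_zero, LinearMap.zero_apply]
  | add a b ha hb => simp only [map_add, ha, hb, LinearMap.add_apply]
  | tmul g l =>
  induction Z using TensorProduct.induction_on with
  | zero => simp only [map_zero]
  | add a b ha hb => simp only [map_add, ha, hb]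
  | tmul e m =>
    have comm' : ∀ (p : Module.Dual k H) (q : H) (S : Module.Dual k H ⊗[k] H),
        TensorProduct.map (dualMul p) LinearMap.id
          (TensorProduct.map LinearMap.id (LinearMap.mulRight k q) S) =
        TensorProduct.map LinearMap.id (LinearMap.mulRight k q)
          (TensorProduct.map (dualMul p) LinearMap.id S) := by
      intro p q S
      simp only [← LinearMap.comp_apply, ← TensorProduct.map_comp, LinearMap.id_comp,
        LinearMap.comp_id]
    rw [doubleMul_tmul' f g, doubleMul_left, tmul_eq_right e m, doubleMul_right, aux_left,
      doubleMul_right, doubleMul_right, doubleMul_tmul g e, mulRight_one, tmul_eq_left f h,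
      doubleMul_left, aux_right, comm']

lemma one_doubleMul (X : Module.Dual k H ⊗[k] H) :
    doubleMul (counit (R := k) ⊗ₜ[k] (1 : H)) X = X := by
  induction X using TensorProduct.induction_on with
  | zero => simp
  | add a b ha hb => simp_all
  | tmul f h => simp [twist_one_left, counit_dualMul]

lemma doubleMul_one (X : Module.Dual k H ⊗[k] H) :
    doubleMul X (counit (R := k) ⊗ₜ[k] (1 : H)) = X := by
  induction X using TensorProduct.induction_on with
  | zero => simp
  | add a b ha hb => simp_all
  | tmul f h => simp [twist_counit, dualMul_counit]

end General
end DoubleCop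

/-- The Drinfeld double `D(H^cop)` of the co-opposite of a Hopf algebra `H`. Its underlying vector
space is `H^* ⊗ H`; writing `f ⋈ h` for `f ⊗ h`, its product is
`(f ⋈ h) (g ⋈ l) = ∑ f · g(S(h₍₁₎) ? h₍₃₎) ⋈ h₍₂₎ l` and its unit is `ε ⋈ 1`. Here `S` and
`∑ h₍₁₎ ⊗ h₍₂₎ ⊗ h₍₃₎` are the antipode and the iterated comultiplication of `H` (so that `S` is
the inverse of the antipode of `H^cop`), and `f · g` is the product of `(H^cop)^*`. -/
def DoubleCop (k : Type u) [Field k] (H : Type v) [Ring H] [HopfAlgebra k H] : Type (max u v) :=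
  Module.Dual k H ⊗[k] H

namespace DoubleCop

open Coalgebra HopfAlgebra

variable {k : Type u} [Field k] {H : Type v} [Ring H] [HopfAlgebra k H]

instance : AddCommGroup (DoubleCop k H) :=
  inferInstanceAs (AddCommGroup (Module.Dual k H ⊗[k] H))

instance : Module k (DoubleCop k H) :=
  inferInstanceAs (Module k (Module.Dual k H ⊗[k] H))

/-- The identification of `H^* ⊗ H` with the Drinfeld double, as vector spaces. -/
def ofTensor : Module.Dual k H ⊗[k] H ≃ₗ[k] DoubleCop k H := LinearEquiv.refl k _

/-- The element `f ⋈ h` of the Drinfeld double. -/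
def bowtie (f : Module.Dual k H) (h : H) : DoubleCop k H := ofTensor (f ⊗ₜ[k] h)

instance : Ring (DoubleCop k H) :=
  { (inferInstance : AddCommGroup (DoubleCop k H)) with
    mul := fun X Y => ofTensor (doubleMul (ofTensor.symm X) (ofTensor.symm Y))
    one := bowtie counit 1
    mul_assoc := fun X Y Z => congrArg ofTensor
      (doubleMul_assoc (ofTensor.symm X) (ofTensor.symm Y) (ofTensor.symm Z))
    one_mul := fun X => congrArg ofTensor (one_doubleMul (ofTensor.symm X))
    mul_one := fun X => congrArg ofTensor (doubleMul_one (ofTensor.symm X))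
    left_distrib := fun X Y Z => congrArg ofTensor
      (map_add (doubleMul (ofTensor.symm X)) (ofTensor.symm Y) (ofTensor.symm Z))
    right_distrib := fun X Y Z => congrArg ofTensor
      (LinearMap.map_add₂ doubleMul (ofTensor.symm X) (ofTensor.symm Y) (ofTensor.symm Z))
    zero_mul := fun X => congrArg ofTensor (LinearMap.map_zero₂ doubleMul (ofTensor.symm X))
    mul_zero := fun X => congrArg ofTensor (map_zero (doubleMul (ofTensor.symm X))) }

lemma mul_def (X Y : DoubleCop k H) :
    X * Y = ofTensor (doubleMul (ofTensor.symm X) (ofTensor.symm Y)) := rfl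

lemma one_def : (1 : DoubleCop k H) = bowtie counit 1 := rfl

instance : Algebra k (DoubleCop k H) :=
  Algebra.ofModule
    (fun c X Y => congrArg ofTensor
      (LinearMap.map_smul₂ doubleMul c (ofTensor.symm X) (ofTensor.symm Y)))
    (fun c X Y => congrArg ofTensor
      (map_smul (doubleMul (ofTensor.symm X)) c (ofTensor.symm Y)))

/-- The comultiplication `f ↦ ∑ f₍₁₎ ⊗ f₍₂₎` of `H^*` for finite-dimensional `H`, characterized by
`f (x y) = ∑ f₍₁₎(x) f₍₂₎(y)`. -/
def dualComul [Module.Finite k H] :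
    Module.Dual k H →ₗ[k] Module.Dual k H ⊗[k] Module.Dual k H :=
  (TensorProduct.dualDistribEquiv k H H).symm.toLinearMap ∘ₗ
    Module.Dual.transpose (LinearMap.mul' k H)

lemma dualComul_spec [Module.Finite k H] (f : Module.Dual k H) (x y : H) :
    TensorProduct.dualDistrib k H H (dualComul f) (x ⊗ₜ[k] y) = f (x * y) := by
  have : TensorProduct.dualDistrib k H H (dualComul f) =
      TensorProduct.dualDistribEquiv k H H (dualComul f) := rfl
  rw [this, dualComul, LinearMap.comp_apply, LinearEquiv.coe_coe, LinearEquiv.apply_symm_apply]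
  rfl

/-- The comultiplication of the Drinfeld double `D(H^cop)`:
`Δ(f ⋈ h) = ∑ (f₍₂₎ ⋈ h₍₂₎) ⊗ (f₍₁₎ ⋈ h₍₁₎)`. -/
def doubleComul [Module.Finite k H] :
    DoubleCop k H →ₗ[k] DoubleCop k H ⊗[k] DoubleCop k H :=
  TensorProduct.map ofTensor.toLinearMap ofTensor.toLinearMap ∘ₗ
  (TensorProduct.tensorTensorTensorComm k
    (Module.Dual k H) (Module.Dual k H) H H).toLinearMap ∘ₗ
  TensorProduct.map
    ((TensorProduct.comm k (Module.Dual k H) (Module.Dual k H)).toLinearMap ∘ₗ dualComul)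
    ((TensorProduct.comm k H H).toLinearMap ∘ₗ comul) ∘ₗ
  ofTensor.symm.toLinearMap

/-- The diagonal action of the Drinfeld double on the tensor product `M ⊗ N` of two of its
representations: `X` acts by `∑ ρ(X₍₁₎) ⊗ σ(X₍₂₎)`. -/
def tensorAct [Module.Finite k H] {M N : Type*} [AddCommGroup M] [Module k M]
    [AddCommGroup N] [Module k N]
    (ρ : DoubleCop k H →ₐ[k] Module.End k M) (σ : DoubleCop k H →ₐ[k] Module.End k N) :
    DoubleCop k H →ₗ[k] Module.End k (M ⊗[k] N) :=
  TensorProduct.homTensorHomMap (RingHom.id k) M N M N ∘ₗ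
    TensorProduct.map ρ.toLinearMap σ.toLinearMap ∘ₗ doubleComul

end DoubleCop

/-! ## The Hopf algebra `𝒦` -/

namespace HopfK

/-- Names of the four algebra generators of `𝒦`. -/
inductive Gen : Type
  | a | b | c | d

variable {k : Type u} [Field k]

/-- The generators of the free algebra on `a, b, c, d`. -/
abbrev free (i : Gen) : FreeAlgebra k Gen := FreeAlgebra.ι k i

/-- The defining relations of `𝒦`. -/
inductive Rel (ξ : k) : FreeAlgebra k Gen → FreeAlgebra k Gen → Prop
  | ab : Rel ξ (free .a * free .b) (ξ • (free .b * free .a))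
  | ac : Rel ξ (free .a * free .c) (ξ • (free .c * free .a))
  | cb : Rel ξ (free .c * free .b) (0)
  | bc : Rel ξ (free .b * free .c) (0)
  | cd : Rel ξ (free .c * free .d) (ξ • (free .d * free .c))
  | bd : Rel ξ (free .b * free .d) (ξ • (free .d * free .b))
  | ad : Rel ξ (free .a * free .d) (free .d * free .a)
  | ad_one : Rel ξ (free .a * free .d) (1)
  | bb : Rel ξ (free .b * free .b) (0)
  | cc : Rel ξ (free .c * free .c) (0)
  | aac : Rel ξ (free .a ^ 2 * free .c) (free .b)
  | aaaa : Rel ξ (free .a ^ 4) (1)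

/-- The algebra `𝒦`: generated by `a, b, c, d` subject to the defining relations, for a primitive
fourth root of unity `ξ`. -/
def KAlg {ξ : k} (_ : IsPrimitiveRoot ξ 4) : Type u := RingQuot (Rel ξ)

variable {ξ : k} (hξ : IsPrimitiveRoot ξ 4)

instance : Ring (KAlg hξ) := inferInstanceAs (Ring (RingQuot _))
instance : Algebra k (KAlg hξ) := inferInstanceAs (Algebra k (RingQuot _))

/-- The projection from the free algebra onto `𝒦`. -/
def proj : FreeAlgebra k Gen →ₐ[k] KAlg hξ := RingQuot.mkAlgHom k (Rel ξ)

/-- The canonical generators of `𝒦`. -/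
def gen (i : Gen) : KAlg hξ := proj hξ (free i)

/-- The generator `a`. -/
def a : KAlg hξ := gen hξ Gen.a
/-- The generator `b`. -/
def b : KAlg hξ := gen hξ Gen.b
/-- The generator `c`. -/
def c : KAlg hξ := gen hξ Gen.c
/-- The generator `d`. -/
def d : KAlg hξ := gen hξ Gen.d

/-- Elements `a, b, c, d` of a `k`-algebra that satisfy the defining relations of `𝒦`. -/
structure Relations {R : Type w} [Ring R] [Algebra k R] (ξ : k) (A B C D : R) : Prop where
  ab : A * B = ξ • (B * A)
  ac : A * C = ξ • (C * A)
  cb : C * B = 0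
  bc : B * C = 0
  cd : C * D = ξ • (D * C)
  bd : B * D = ξ • (D * B)
  ad : A * D = D * A
  ad_one : A * D = 1
  bb : B * B = 0
  cc : C * C = 0
  aac : A ^ 2 * C = B
  aaaa : A ^ 4 = 1

lemma proj_rel {X Y : FreeAlgebra k Gen} (h : Rel ξ X Y) : proj hξ X = proj hξ Y :=
  RingQuot.mkAlgHom_rel k h

/-- Algebra maps out of `𝒦`. -/
def lift {R : Type w} [Ring R] [Algebra k R] {A B C D : R} (h : Relations ξ A B C D) :
    KAlg hξ →ₐ[k] R :=
  RingQuot.liftAlgHom k ⟨FreeAlgebra.lift k (fun i => Gen.rec A B C D i), by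
    intro X Y hXY
    cases hXY <;> simp only [free, map_mul, map_smul, map_pow, map_one, map_zero, FreeAlgebra.lift_ι_apply]
    exacts [h.ab, h.ac, h.cb, h.bc, h.cd, h.bd, h.ad, h.ad_one, h.bb, h.cc, h.aac, h.aaaa]⟩

section lift
variable {R : Type w} [Ring R] [Algebra k R] {A B C D : R} (h : Relations ξ A B C D)
lemma lift_gen (i : Gen) : lift hξ h (gen hξ i) = Gen.rec A B C D i := by
  refine (RingQuot.liftAlgHom_mkAlgHom_apply k _ _ _).trans ?_
  exact FreeAlgebra.lift_ι_apply _ _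
@[simp] lemma lift_a : lift hξ h (a hξ) = A := by
  simp [lift_gen, a]
@[simp] lemma lift_b : lift hξ h (b hξ) = B := by
  simp [lift_gen, b]
@[simp] lemma lift_c : lift hξ h (c hξ) = C := by
  simp [lift_gen, c]
@[simp] lemma lift_d : lift hξ h (d hξ) = D := by
  simp [lift_gen, d]
end lift

lemma relations : Relations ξ (a hξ) (b hξ) (c hξ) (d hξ) where
  ab := by simpa [a, b, c, d, gen] using proj_rel hξ Rel.ab
  ac := by simpa [a, b, c, d, gen] using proj_rel hξ Rel.ac
  cb := by simpa [a, b, c, d, gen] using proj_rel hξ Rel.cb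
  bc := by simpa [a, b, c, d, gen] using proj_rel hξ Rel.bc
  cd := by simpa [a, b, c, d, gen] using proj_rel hξ Rel.cd
  bd := by simpa [a, b, c, d, gen] using proj_rel hξ Rel.bd
  ad := by simpa [a, b, c, d, gen] using proj_rel hξ Rel.ad
  ad_one := by simpa [a, b, c, d, gen] using proj_rel hξ Rel.ad_one
  bb := by simpa [a, b, c, d, gen] using proj_rel hξ Rel.bb
  cc := by simpa [a, b, c, d, gen] using proj_rel hξ Rel.cc
  aac := by simpa [a, b, c, d, gen] using proj_rel hξ Rel.aac
  aaaa := by simpa [a, b, c, d, gen] using proj_rel hξ Rel.aaaa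

variable {hξ} in
@[ext high] lemma hom_ext {R : Type w} [Ring R] [Algebra k R] {f g : KAlg hξ →ₐ[k] R}
    (ha : f (a hξ) = g (a hξ)) (hb : f (b hξ) = g (b hξ))
    (hc : f (c hξ) = g (c hξ)) (hd : f (d hξ) = g (d hξ)) : f = g := by
  refine RingQuot.ringQuot_ext' _ _ _ (FreeAlgebra.hom_ext ?_)
  funext i
  cases i
  exacts [ha, hb, hc, hd]

variable {hξ} in
lemma induction {P : KAlg hξ → Prop} (h1 : P 1) (hadd : ∀ x y, P x → P y → P (x + y))
    (hsmul : ∀ (r : k) x, P x → P (r • x)) 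
    (ha : ∀ x, P x → P (a hξ * x)) (hb : ∀ x, P x → P (b hξ * x))
    (hc : ∀ x, P x → P (c hξ * x)) (hd : ∀ x, P x → P (d hξ * x)) (x : KAlg hξ) : P x := by
  obtain ⟨X, rfl⟩ : ∃ X, proj hξ X = x := RingQuot.mkAlgHom_surjective k _ x
  suffices ∀ (X : FreeAlgebra k Gen) (y : KAlg hξ), P y →
      P (proj hξ X * y) by
    simpa using this X 1 h1
  intro X
  induction X using FreeAlgebra.induction with
  | grade0 r => intro y hy; simpa [← Algebra.smul_def] using hsmul r y hy
  | grade1 i => intro y hy; cases i; exacts [ha y hy, hb y hy, hc y hy, hd y hy]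
  | mul X Y hX hY => intro y hy; rw [map_mul, mul_assoc]; exact hX _ (hY _ hy)
  | add X Y hX hY => intro y hy; rw [map_add, add_mul]; exact hadd _ _ (hX _ hy) (hY _ hy)

lemma xi_sq {ξ : k} (hξ : IsPrimitiveRoot ξ 4) : ξ ^ 2 = -1 := by
  have h4 : ξ ^ 4 = 1 := hξ.pow_eq_one
  have h2 : ξ ^ 2 ≠ 1 := hξ.pow_ne_one_of_pos_of_lt (by norm_num) (by norm_num)
  have : (ξ ^ 2 - 1) * (ξ ^ 2 + 1) = 0 := by linear_combination h4
  rcases mul_eq_zero.mp this with h | h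
  · exact absurd (by linear_combination h) h2
  · linear_combination h

lemma b_eq : b hξ = a hξ * (a hξ * c hξ) := by
  rw [← (relations hξ).aac, pow_two, mul_assoc]

lemma d_eq : d hξ = a hξ * (a hξ * a hξ) := by
  have h1 := (relations hξ).ad_one
  have h2 := (relations hξ).aaaa
  calc d hξ = a hξ ^ 4 * d hξ := by rw [h2, one_mul]
    _ = a hξ * (a hξ * (a hξ * (a hξ * d hξ))) := by noncomm_ring
    _ = _ := by rw [h1, mul_one]

lemma c_mul_a : c hξ * a hξ = (-ξ) • (a hξ * c hξ) := by
  rw [(relations hξ).ac, smul_smul]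
  have : -ξ * ξ = 1 := by linear_combination -(xi_sq hξ)
  rw [this, one_smul]

lemma c_mul_a_mul (x : KAlg hξ) : c hξ * (a hξ * x) = (-ξ) • (a hξ * (c hξ * x)) := by
  rw [← mul_assoc, c_mul_a, smul_mul_assoc, mul_assoc]

lemma c_mul_c_mul (x : KAlg hξ) : c hξ * (c hξ * x) = 0 := by
  rw [← mul_assoc, (relations hξ).cc, zero_mul]

lemma a_four : a hξ * (a hξ * (a hξ * a hξ)) = 1 := by
  rw [← (relations hξ).aaaa]; noncomm_ring

lemma a_four_mul (x : KAlg hξ) : a hξ * (a hξ * (a hξ * (a hξ * x))) = x := by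
  conv_rhs => rw [← one_mul x, ← a_four hξ]
  simp only [mul_assoc]

lemma comul_relations : Relations ξ
    (a hξ ⊗ₜ[k] a hξ + b hξ ⊗ₜ[k] c hξ) (a hξ ⊗ₜ[k] b hξ + b hξ ⊗ₜ[k] d hξ)
    (c hξ ⊗ₜ[k] a hξ + d hξ ⊗ₜ[k] c hξ) (c hξ ⊗ₜ[k] b hξ + d hξ ⊗ₜ[k] d hξ) := by
  have h2 := xi_sq hξ
  constructor
  all_goals
    simp only [b_eq, d_eq, pow_succ, pow_zero, one_mul, mul_add, add_mul, mul_assoc,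
      Algebra.TensorProduct.tmul_mul_tmul, c_mul_a, c_mul_a_mul, (relations hξ).cc,
      a_four, a_four_mul, mul_smul_comm, smul_mul_assoc, smul_smul, TensorProduct.tmul_smul, smul_add,
      ← TensorProduct.smul_tmul', mul_zero, smul_zero, TensorProduct.zero_tmul,
      TensorProduct.tmul_zero, add_zero, zero_add, Algebra.TensorProduct.one_def, mul_one]
  all_goals try (match_scalars <;> grind)

lemma counit_relations : Relations ξ (1 : k) 0 0 1 := by
  constructor <;> simp

open MulOpposite in
lemma antipode_relations : Relations (R := (KAlg hξ)ᵐᵒᵖ) ξ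
    (op (d hξ)) (op (ξ • b hξ)) (op (-ξ • c hξ)) (op (a hξ)) := by
  have h2 := xi_sq hξ
  constructor
  all_goals
    apply unop_injective
    simp only [b_eq, d_eq, pow_succ, pow_zero, one_mul, unop_mul, unop_op, unop_smul, unop_one,
      unop_zero, mul_assoc, c_mul_a, c_mul_a_mul, (relations hξ).cc,
      a_four, a_four_mul, mul_smul_comm, smul_mul_assoc, smul_smul, mul_zero, smul_zero, mul_one]
  all_goals try (match_scalars; grind)

/-- The comultiplication of `𝒦`. -/
def comulHom : KAlg hξ →ₐ[k] KAlg hξ ⊗[k] KAlg hξ := lift hξ (comul_relations hξ)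

/-- The counit of `𝒦`. -/
def counitHom : KAlg hξ →ₐ[k] k := lift hξ counit_relations

/-- The antipode of `𝒦`, as an algebra map to the opposite algebra. -/
def antipodeHom : KAlg hξ →ₐ[k] (KAlg hξ)ᵐᵒᵖ := lift hξ (antipode_relations hξ)

/-- The bialgebra structure of `𝒦`: `Δ(a) = a ⊗ a + b ⊗ c`, `Δ(b) = a ⊗ b + b ⊗ d`,
`Δ(c) = c ⊗ a + d ⊗ c`, `Δ(d) = c ⊗ b + d ⊗ d`, `ε(a) = ε(d) = 1`, `ε(b) = ε(c) = 0`. -/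
instance : Bialgebra k (KAlg hξ) :=
  Bialgebra.ofAlgHom (comulHom hξ) (counitHom hξ)
    (by
      apply hom_ext <;>
      simp [comulHom, TensorProduct.add_tmul, TensorProduct.tmul_add] <;> abel)
    (by apply hom_ext <;> simp [comulHom, counitHom])
    (by apply hom_ext <;> simp [comulHom, counitHom])

open Coalgebra

lemma comul_a : comul (R := k) (a hξ) = a hξ ⊗ₜ a hξ + b hξ ⊗ₜ c hξ :=
  lift_a hξ (comul_relations hξ)
lemma comul_b : comul (R := k) (b hξ) = a hξ ⊗ₜ b hξ + b hξ ⊗ₜ d hξ :=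
  lift_b hξ (comul_relations hξ)
lemma comul_c : comul (R := k) (c hξ) = c hξ ⊗ₜ a hξ + d hξ ⊗ₜ c hξ :=
  lift_c hξ (comul_relations hξ)
lemma comul_d : comul (R := k) (d hξ) = c hξ ⊗ₜ b hξ + d hξ ⊗ₜ d hξ :=
  lift_d hξ (comul_relations hξ)
lemma counit_a : counit (R := k) (a hξ) = 1 := lift_a hξ counit_relations
lemma counit_b : counit (R := k) (b hξ) = 0 := lift_b hξ counit_relations
lemma counit_c : counit (R := k) (c hξ) = 0 := lift_c hξ counit_relations
lemma counit_d : counit (R := k) (d hξ) = 1 := lift_d hξ counit_relations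

/-- The antipode of `𝒦`, as a linear map. -/
def antipodeMap : KAlg hξ →ₗ[k] KAlg hξ :=
  (MulOpposite.opLinearEquiv k).symm.toLinearMap ∘ₗ (antipodeHom hξ).toLinearMap

lemma antipodeMap_a : antipodeMap hξ (a hξ) = d hξ := by simp [antipodeMap, antipodeHom]
lemma antipodeMap_b : antipodeMap hξ (b hξ) = ξ • b hξ := by simp [antipodeMap, antipodeHom]
lemma antipodeMap_c : antipodeMap hξ (c hξ) = -ξ • c hξ := by simp [antipodeMap, antipodeHom]
lemma antipodeMap_d : antipodeMap hξ (d hξ) = a hξ := by simp [antipodeMap, antipodeHom]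
lemma antipodeMap_one : antipodeMap hξ 1 = 1 := by simp [antipodeMap]
lemma antipodeMap_mul (x y : KAlg hξ) :
    antipodeMap hξ (x * y) = antipodeMap hξ y * antipodeMap hξ x := by simp [antipodeMap]

lemma antipode_left_step {X Y : KAlg hξ ⊗[k] KAlg hξ} {r : k}
    (hX : LinearMap.mul' k (KAlg hξ) ((antipodeMap hξ).rTensor _ X) = algebraMap k _ r) :
    LinearMap.mul' k (KAlg hξ) ((antipodeMap hξ).rTensor _ (X * Y)) =
      r • LinearMap.mul' k (KAlg hξ) ((antipodeMap hξ).rTensor _ Y) := by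
  induction Y using TensorProduct.induction_on with
  | zero => simp
  | add y z hy hz => rw [mul_add, map_add, map_add, hy, hz, map_add, map_add, smul_add]
  | tmul y z =>
    have : ∀ X : KAlg hξ ⊗[k] KAlg hξ,
        LinearMap.mul' k (KAlg hξ) ((antipodeMap hξ).rTensor _ (X * y ⊗ₜ z)) =
        antipodeMap hξ y * LinearMap.mul' k (KAlg hξ) ((antipodeMap hξ).rTensor _ X) * z := by
      intro X
      induction X using TensorProduct.induction_on with
      | zero => simp
      | add u v hu hv =>
        rw [add_mul, map_add, map_add, hu, hv, map_add, map_add, mul_add, add_mul]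
      | tmul u v => simp [antipodeMap_mul, mul_assoc]
    rw [this, hX]
    simp [Algebra.algebraMap_eq_smul_one]

lemma antipode_right_step {X Y : KAlg hξ ⊗[k] KAlg hξ} {r : k}
    (hY : LinearMap.mul' k (KAlg hξ) ((antipodeMap hξ).lTensor _ Y) = algebraMap k _ r) :
    LinearMap.mul' k (KAlg hξ) ((antipodeMap hξ).lTensor _ (X * Y)) =
      r • LinearMap.mul' k (KAlg hξ) ((antipodeMap hξ).lTensor _ X) := by
  induction X using TensorProduct.induction_on with
  | zero => simp
  | add y z hy hz => rw [add_mul, map_add, map_add, hy, hz, map_add, map_add, smul_add]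
  | tmul y z =>
    have : ∀ Y : KAlg hξ ⊗[k] KAlg hξ,
        LinearMap.mul' k (KAlg hξ) ((antipodeMap hξ).lTensor _ (y ⊗ₜ z * Y)) =
        y * LinearMap.mul' k (KAlg hξ) ((antipodeMap hξ).lTensor _ Y) * antipodeMap hξ z := by
      intro Y
      induction Y using TensorProduct.induction_on with
      | zero => simp
      | add u v hu hv =>
        rw [mul_add, map_add, map_add, hu, hv, map_add, map_add, mul_add, add_mul]
      | tmul u v => simp [antipodeMap_mul, mul_assoc]
    rw [this, hY]
    simp [Algebra.algebraMap_eq_smul_one]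

lemma antipode_left (x : KAlg hξ) :
    LinearMap.mul' k (KAlg hξ) ((antipodeMap hξ).rTensor _ (comul x)) =
      algebraMap k _ (counit (R := k) x) := by
  have h2 := xi_sq hξ
  have one : LinearMap.mul' k (KAlg hξ) ((antipodeMap hξ).rTensor _ (comul 1)) =
      algebraMap k _ (counit (R := k) (1 : KAlg hξ)) := by
    simp [Algebra.TensorProduct.one_def, antipodeMap_one]
  have step : ∀ g y : KAlg hξ,
      LinearMap.mul' k (KAlg hξ) ((antipodeMap hξ).rTensor _ (comul g)) =
        algebraMap k _ (counit (R := k) g) →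
      LinearMap.mul' k (KAlg hξ) ((antipodeMap hξ).rTensor _ (comul y)) =
        algebraMap k _ (counit (R := k) y) →
      LinearMap.mul' k (KAlg hξ) ((antipodeMap hξ).rTensor _ (comul (g * y))) =
        algebraMap k _ (counit (R := k) (g * y)) := by
    intro g y hg hy
    rw [Bialgebra.comul_mul, antipode_left_step hξ hg, hy, Bialgebra.counit_mul, map_mul,
      Algebra.smul_def]
  induction x using HopfK.induction with
  | h1 => exact one
  | hadd x y hx hy => simp only [map_add, hx, hy]
  | hsmul r x hx =>
    rw [map_smul, map_smul, map_smul, hx, map_smul, smul_eq_mul, map_mul, Algebra.smul_def]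
  | ha x hx =>
    refine step _ _ ?_ hx
    simp only [comul_a, counit_a, map_add, LinearMap.rTensor_tmul, LinearMap.mul'_apply,
      antipodeMap_a, antipodeMap_b, map_one, smul_mul_assoc, (relations hξ).bc]
    rw [← (relations hξ).ad, (relations hξ).ad_one]; simp
  | hb x hx =>
    refine step _ _ ?_ hx
    simp only [comul_b, counit_b, map_add, LinearMap.rTensor_tmul, LinearMap.mul'_apply,
      antipodeMap_a, antipodeMap_b, map_zero, smul_mul_assoc, (relations hξ).bd, smul_smul]
    rw [← pow_two, h2]; simp
  | hc x hx =>
    refine step _ _ ?_ hx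
    simp only [comul_c, counit_c, map_add, LinearMap.rTensor_tmul, LinearMap.mul'_apply,
      antipodeMap_c, antipodeMap_d, map_zero, smul_mul_assoc, (relations hξ).ac]
    rw [← add_smul]; simp
  | hd x hx =>
    refine step _ _ ?_ hx
    simp only [comul_d, counit_d, map_add, LinearMap.rTensor_tmul, LinearMap.mul'_apply,
      antipodeMap_c, antipodeMap_d, map_one, smul_mul_assoc, (relations hξ).cb,
      (relations hξ).ad_one]
    simp

lemma antipode_right (x : KAlg hξ) :
    LinearMap.mul' k (KAlg hξ) ((antipodeMap hξ).lTensor _ (comul x)) =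
      algebraMap k _ (counit (R := k) x) := by
  have h2 := xi_sq hξ
  have one : LinearMap.mul' k (KAlg hξ) ((antipodeMap hξ).lTensor _ (comul 1)) =
      algebraMap k _ (counit (R := k) (1 : KAlg hξ)) := by
    simp [Algebra.TensorProduct.one_def, antipodeMap_one]
  have step : ∀ g y : KAlg hξ,
      LinearMap.mul' k (KAlg hξ) ((antipodeMap hξ).lTensor _ (comul g)) =
        algebraMap k _ (counit (R := k) g) →
      LinearMap.mul' k (KAlg hξ) ((antipodeMap hξ).lTensor _ (comul y)) =
        algebraMap k _ (counit (R := k) y) →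
      LinearMap.mul' k (KAlg hξ) ((antipodeMap hξ).lTensor _ (comul (g * y))) =
        algebraMap k _ (counit (R := k) (g * y)) := by
    intro g y hg hy
    rw [Bialgebra.comul_mul, antipode_right_step hξ hy, hg, Bialgebra.counit_mul, mul_comm,
      map_mul, Algebra.smul_def]
  induction x using HopfK.induction with
  | h1 => exact one
  | hadd x y hx hy => simp only [map_add, hx, hy]
  | hsmul r x hx =>
    rw [map_smul, map_smul, map_smul, hx, map_smul, smul_eq_mul, map_mul, Algebra.smul_def]
  | ha x hx =>
    refine step _ _ ?_ hx
    simp only [comul_a, counit_a, map_add, LinearMap.lTensor_tmul, LinearMap.mul'_apply,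
      antipodeMap_a, antipodeMap_c, map_one, mul_smul_comm, (relations hξ).bc,
      (relations hξ).ad_one]
    simp
  | hb x hx =>
    refine step _ _ ?_ hx
    simp only [comul_b, counit_b, map_add, LinearMap.lTensor_tmul, LinearMap.mul'_apply,
      antipodeMap_b, antipodeMap_d, map_zero, mul_smul_comm, (relations hξ).ab, smul_smul]
    rw [← pow_two, h2]; simp
  | hc x hx =>
    refine step _ _ ?_ hx
    simp only [comul_c, counit_c, map_add, LinearMap.lTensor_tmul, LinearMap.mul'_apply,
      antipodeMap_c, antipodeMap_a, map_zero, mul_smul_comm, (relations hξ).cd]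
    rw [← add_smul]; simp
  | hd x hx =>
    refine step _ _ ?_ hx
    simp only [comul_d, counit_d, map_add, LinearMap.lTensor_tmul, LinearMap.mul'_apply,
      antipodeMap_b, antipodeMap_d, map_one, mul_smul_comm, (relations hξ).cb]
    rw [← (relations hξ).ad, (relations hξ).ad_one]; simp

/-- The Hopf algebra structure of `𝒦`; the antipode is given by `S(a) = d`, `S(b) = ξ b`,
`S(c) = -ξ c`, `S(d) = a`. -/
instance : HopfAlgebra k (KAlg hξ) where
  antipode := antipodeMap hξ
  mul_antipode_rTensor_comul := LinearMap.ext (antipode_left hξ)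
  mul_antipode_lTensor_comul := LinearMap.ext (antipode_right hξ)

/-- `𝒦` is spanned by `1, a, b, c, d, a², ab, ac`. -/
lemma span_eq_top : Submodule.span k {1, a hξ, b hξ, c hξ, d hξ, a hξ ^ 2, a hξ * b hξ,
    a hξ * c hξ} = ⊤ := by
  set S := Submodule.span k {1, a hξ, b hξ, c hξ, d hξ, a hξ ^ 2, a hξ * b hξ, a hξ * c hξ} with hS
  have m0 : (1 : KAlg hξ) ∈ S := Submodule.subset_span (by simp)
  have m1 : a hξ ∈ S := Submodule.subset_span (by simp)
  have m2 : a hξ * a hξ ∈ S := pow_two (a hξ) ▸ Submodule.subset_span (by simp)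
  have m3 : a hξ * (a hξ * a hξ) ∈ S := d_eq hξ ▸ Submodule.subset_span (by simp)
  have n0 : c hξ ∈ S := Submodule.subset_span (by simp)
  have n1 : a hξ * c hξ ∈ S := Submodule.subset_span (by simp)
  have n2 : a hξ * (a hξ * c hξ) ∈ S := b_eq hξ ▸ Submodule.subset_span (by simp)
  have n3 : a hξ * (a hξ * (a hξ * c hξ)) ∈ S := by
    rw [← b_eq]; exact Submodule.subset_span (by simp)
  have step : ∀ g : KAlg hξ, g = a hξ ∨ g = c hξ → ∀ y ∈ S, g * y ∈ S := by
    intro g hg y hy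
    rw [hS] at hy
    induction hy using Submodule.span_induction with
    | zero => rw [mul_zero]; exact S.zero_mem
    | add u v _ _ hu hv => rw [mul_add]; exact S.add_mem hu hv
    | smul r u _ hu => rw [mul_smul_comm]; exact S.smul_mem _ hu
    | mem u hu =>
      simp only [Set.mem_insert_iff, Set.mem_singleton_iff] at hu
      rcases hg with rfl | rfl <;> rcases hu with rfl | rfl | rfl | rfl | rfl | rfl | rfl | rfl <;>
      (try simp only [b_eq, d_eq, pow_two, mul_one, c_mul_a, c_mul_a_mul,
        (relations hξ).cc, a_four, a_four_mul, mul_smul_comm, smul_smul, mul_zero, smul_zero]) <;>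
      first
      | exact S.zero_mem
      | assumption
      | (refine S.smul_mem _ ?_; assumption)
  have sa := step _ (Or.inl rfl)
  have sc := step _ (Or.inr rfl)
  rw [eq_top_iff]
  intro x _
  induction x using HopfK.induction with
  | h1 => exact m0
  | hadd x y hx hy => exact S.add_mem (hx trivial) (hy trivial)
  | hsmul r x hx => exact S.smul_mem _ (hx trivial)
  | ha x hx => exact sa _ (hx trivial)
  | hb x hx =>
    rw [b_eq, mul_assoc, mul_assoc]
    exact sa _ (sa _ (sc _ (hx trivial)))
  | hc x hx => exact sc _ (hx trivial)
  | hd x hx =>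
    rw [d_eq, mul_assoc, mul_assoc]
    exact sa _ (sa _ (sa _ (hx trivial)))

instance : Module.Finite k (KAlg hξ) :=
  ⟨Submodule.fg_def.2 ⟨_, by simp, span_eq_top hξ⟩⟩

/-! ### The functionals `g` and `x` on `𝒦` -/

lemma gFun_relations {ξ : k} (hξ : IsPrimitiveRoot ξ 4) : Relations ξ (ξ ^ 3) 0 0 ξ := by
  have h2 := xi_sq hξ
  constructor <;> (try simp) <;> grind

/-- The functional `g ∈ 𝒦^*`: the algebra map with `a ↦ ξ⁻¹ = ξ³`, `b, c ↦ 0`, `d ↦ ξ`. -/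
def gFun : Module.Dual k (KAlg hξ) := (lift hξ (gFun_relations hξ)).toLinearMap

lemma xRep_relations {ξ : k} (hξ : IsPrimitiveRoot ξ 4) (r : k) :
    Relations ξ (R := Matrix (Fin 2) (Fin 2) k)
      !![1, 0; 0, ξ ^ 3] !![0, r * ξ; 0, 0] !![0, r * ξ; 0, 0] !![1, 0; 0, ξ] := by
  have h2 := xi_sq hξ
  constructor <;> ext i j <;> fin_cases i <;> fin_cases j <;>
    simp [pow_succ, Matrix.mul_apply, Fin.sum_univ_two] <;> grind

/-- The functional `x ∈ 𝒦^*`: the upper right coefficient of the representation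
`a ↦ diag(1, ξ⁻¹)`, `d ↦ diag(1, ξ)`, `b, c ↦ r ξ E₁₂`, where `r` is a square root of `2`.
In terms of the basis of `𝒦^*` dual to `1, a, b, c, d, a², ab, ac`, it is
`r ξ (b^* + c^* + (ab)^* + (ac)^*)`: see `xFun_values`. -/
def xFun (r : k) : Module.Dual k (KAlg hξ) :=
  Matrix.entryLinearMap k k 0 1 ∘ₗ (lift hξ (xRep_relations hξ r)).toLinearMap

lemma gFun_values : gFun hξ 1 = 1 ∧ gFun hξ (a hξ) = ξ⁻¹ ∧ gFun hξ (b hξ) = 0 ∧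
    gFun hξ (c hξ) = 0 ∧ gFun hξ (d hξ) = ξ ∧ gFun hξ (a hξ ^ 2) = -1 ∧
    gFun hξ (a hξ * b hξ) = 0 ∧ gFun hξ (a hξ * c hξ) = 0 := by
  have h2 := xi_sq hξ
  have hi : ξ⁻¹ = ξ ^ 3 :=
    inv_eq_of_mul_eq_one_right (by linear_combination (ξ ^ 2 - 1) * h2)
  simp [gFun, hi]
  linear_combination (ξ ^ 4 - ξ ^ 2 + 1) * h2

lemma xFun_values (r : k) : xFun hξ r 1 = 0 ∧ xFun hξ r (a hξ) = 0 ∧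
    xFun hξ r (b hξ) = r * ξ ∧ xFun hξ r (c hξ) = r * ξ ∧ xFun hξ r (d hξ) = 0 ∧
    xFun hξ r (a hξ ^ 2) = 0 ∧ xFun hξ r (a hξ * b hξ) = r * ξ ∧
    xFun hξ r (a hξ * c hξ) = r * ξ := by
  simp [xFun, pow_two]

end HopfK

/-! ## The Drinfeld double of `𝒦^cop` and its modules -/

namespace HopfK

variable {k : Type u} [Field k] {ξ : k}

/-- The Drinfeld double `D = D(𝒦^cop)`. -/
abbrev D (hξ : IsPrimitiveRoot ξ 4) : Type u := DoubleCop k (KAlg hξ)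

/-- The element of `D` given by an element of `𝒦`. -/
def D.ofK {hξ : IsPrimitiveRoot ξ 4} (h : KAlg hξ) : D hξ :=
  DoubleCop.bowtie (Coalgebra.counit (R := k)) h

/-- The element of `D` given by a functional on `𝒦`. -/
def D.ofDual {hξ : IsPrimitiveRoot ξ 4} (f : Module.Dual k (KAlg hξ)) : D hξ :=
  DoubleCop.bowtie f 1

/-- The power `ξ ^ i` of a fourth root of unity `ξ`, for `i ∈ ℤ/4`. -/
def rootPow (ξ : k) (i : ZMod 4) : k := ξ ^ i.val

/-- The index set `Λ = {(i, j) ∈ ℤ/4 × ℤ/4 | 2 i ≠ j}`. -/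
abbrev Lam : Type := {p : ZMod 4 × ZMod 4 // 2 * p.1 ≠ p.2}

/-- The values of a representation `ρ` of `D` on the generators `a, b, c, d, x, g`. -/
structure ActsBy (hξ : IsPrimitiveRoot ξ 4) (r : k) {R : Type w} [Ring R] [Algebra k R]
    (ρ : D hξ →ₐ[k] R) (ra rb rc rd rx rg : R) : Prop where
  map_a : ρ (D.ofK (a hξ)) = ra
  map_b : ρ (D.ofK (b hξ)) = rb
  map_c : ρ (D.ofK (c hξ)) = rc
  map_d : ρ (D.ofK (d hξ)) = rd
  map_x : ρ (D.ofDual (xFun hξ r)) = rx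
  map_g : ρ (D.ofDual (gFun hξ)) = rg

/-- The character `χ` of an algebra, as a representation on the one-dimensional space `k`. -/
def charRep {A : Type v} [Ring A] [Algebra k A] (χ : A →ₐ[k] k) : A →ₐ[k] Module.End k k :=
  (Algebra.lmul k k).comp χ

/-- The representations of `D` that occur in the description of the projective covers. Operators on
`k^n` are given by their matrices in the standard basis, acting on column vectors. -/
structure RepFamily (hξ : IsPrimitiveRoot ξ 4) (r : k) where
  /-- the characters `χ^ℓ` -/
  χ : ZMod 4 → (D hξ →ₐ[k] k)
  /-- the two-dimensional representations `V_{i,j}` -/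
  V : Lam → (D hξ →ₐ[k] Module.End k (Fin 2 → k))
  /-- the four-dimensional representation `P` -/
  P : D hξ →ₐ[k] Module.End k (Fin 4 → k)
  /-- the tensor products `P ⊗ k_{χ^ℓ}` -/
  PT : ZMod 4 → (D hξ →ₐ[k] Module.End k ((Fin 4 → k) ⊗[k] k))
  χ_acts : ∀ ℓ, ActsBy hξ r (χ ℓ)
    (rootPow ξ ℓ) 0 0 (rootPow ξ (-ℓ)) 0 ((-1) ^ ℓ.val)
  V_acts : ∀ i j (h : 2 * i ≠ j), ActsBy hξ r (V ⟨(i, j), h⟩)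
    (Matrix.toLin' !![rootPow ξ i, 0; 0, rootPow ξ (i + 3)])
    (Matrix.toLin' !![0, (-1) ^ i.val; 0, 0])
    (Matrix.toLin' !![0, 1; 0, 0])
    (Matrix.toLin' !![rootPow ξ (-i), 0; 0, rootPow ξ (-i + 1)])
    (Matrix.toLin' !![0, r / 2 * ξ * (rootPow ξ i + rootPow ξ (3 * i + j));
      r * ξ * (rootPow ξ (3 * i) - rootPow ξ (i + j)), 0])
    (Matrix.toLin' !![rootPow ξ j, 0; 0, rootPow ξ (j + 2)])
  P_acts : ActsBy hξ r P
    (Matrix.toLin' !![1, 0, 0, 0; 0, -ξ, 0, 0; 0, 0, ξ, 0; 0, 0, 0, 1])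
    (Matrix.toLin' !![0, 0, 0, 0; 0, 0, 0, 0; 1, 0, 0, 0; 0, ξ, 0, 0])
    (Matrix.toLin' !![0, 0, 0, 0; 0, 0, 0, 0; -1, 0, 0, 0; 0, ξ, 0, 0])
    (Matrix.toLin' !![1, 0, 0, 0; 0, ξ, 0, 0; 0, 0, -ξ, 0; 0, 0, 0, 1])
    (Matrix.toLin' !![0, 0, 0, 0; 1, 0, 0, 0; r, 0, 0, 0; 0, -r, 1, 0])
    (Matrix.toLin' !![1, 0, 0, 0; 0, -1, 0, 0; 0, 0, -1, 0; 0, 0, 0, 1])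
  PT_apply : ∀ ℓ X, PT ℓ X = DoubleCop.tensorAct P (charRep (χ ℓ)) X

end HopfK

/-- The module over a `k`-algebra `A` given by a representation `ρ` of `A` on `M`. -/
def RepModule {k : Type u} [Field k] {A : Type v} [Ring A] [Algebra k A] {M : Type w}
    [AddCommGroup M] [Module k M] (_ : A →ₐ[k] Module.End k M) : Type w := M

namespace RepModule

variable {k : Type u} [Field k] {A : Type v} [Ring A] [Algebra k A] {M : Type w}
    [AddCommGroup M] [Module k M] (ρ : A →ₐ[k] Module.End k M)

instance : AddCommGroup (RepModule ρ) := inferInstanceAs (AddCommGroup M)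

instance : Module A (RepModule ρ) := Module.compHom M ρ.toRingHom

/-- The identity map from `M` to the module given by `ρ`. -/
def of : M ≃+ RepModule ρ := AddEquiv.refl M

lemma smul_def (x : A) (m : M) : x • of ρ m = of ρ (ρ x m) := rfl

end RepModule

/-- `P` is a projective cover of `S`: it is projective, and it has a surjection onto `S` whose
kernel is superfluous. -/
def IsProjectiveCover (A : Type u) [Ring A] (P : Type v) (S : Type w) [AddCommGroup P] [Module A P]
    [AddCommGroup S] [Module A S] : Prop :=
  Module.Projective A P ∧ ∃ π : P →ₗ[A] S, Function.Surjective π ∧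
    ∀ N : Submodule A P, N ⊔ LinearMap.ker π = ⊤ → N = ⊤

end

/-! The heart of the matter is a dimension count. Since 𝒦 is spanned by eight elements, dim D ≤ 64,
while the direct sum of the four modules P ⊗ k_{χ^ℓ} and of two copies of each of the twelve V_{i,j}
has dimension 4·4 + 12·2·2 = 64. This sum is a cyclic D-module (`CoverSum.eq_top_of_gen_mem`): the
joint eigenspaces of a and g separate its summands up to one overlap, which c resolves. So acting on
a generator is a surjection from D between spaces of equal dimension, hence an isomorphism
(`bijective_smul_gen`), and every summand is projective.

Each V_{i,j} with 2i ≠ j is simple, and every proper submodule of P ⊗ k_{χ^ℓ} lies in the kernel of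
its map onto k_{χ^ℓ} (`FourDim.le_ker_π`), so these maps are projective covers. A simple module S
receives a nonzero map from the regular module, hence from some summand. Which summand it is can be
read off from S, namely from the (a, g)-weight of a vector killed by c: the weights (ℓ, 2ℓ) and (i,
j) with 2i ≠ j are the sixteen elements of ℤ/4 × ℤ/4, each occurring once.

That the modules exist requires a presentation of D. The functional g is an algebra map and x is
skew-primitive, so multiplication by them in 𝒦^* is computed from the values at a and c; they
generate 𝒦^* (`dual_induction`), and a, c, g, x generate D. Conversely, elements A, C, G, X
satisfying `DoubleRelations` extend to D (`D.lift`): they define maps on 𝒦 and on 𝒦^*, and the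
straightening rule between the two factors need only be checked on generators (`pairLift_twist`).
Finally, χ^ℓ restricts on 𝒦^* to evaluation at the group-like element a^{2ℓ}, so tensoring with it
merely rescales the four generators (`tensorAct_lift`). -/

noncomputable section

/-! ### Generation of the dual of 𝒦 by g and x. -/

namespace HopfK

open Coalgebra DoubleCop

variable {k : Type u} [Field k] {ξ : k} (hξ : IsPrimitiveRoot ξ 4)

lemma xi_inv {ξ : k} (hξ : IsPrimitiveRoot ξ 4) : ξ⁻¹ = -ξ :=
  inv_eq_of_mul_eq_one_right (by linear_combination -xi_sq hξ)

variable {hξ} in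
lemma induction_left {P : KAlg hξ → Prop} (h1 : P 1) (hadd : ∀ x y, P x → P y → P (x + y))
    (hsmul : ∀ (r : k) x, P x → P (r • x))
    (ha : ∀ x, P x → P (a hξ * x)) (hc : ∀ x, P x → P (c hξ * x)) (x : KAlg hξ) : P x := by
  induction x using HopfK.induction with
  | h1 => exact h1
  | hadd x y hx hy => exact hadd x y hx hy
  | hsmul r x hx => exact hsmul r x hx
  | ha x hx => exact ha x hx
  | hb x hx => rw [b_eq, mul_assoc, mul_assoc]; exact ha _ (ha _ (hc _ hx))
  | hc x hx => exact hc x hx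
  | hd x hx => rw [d_eq, mul_assoc, mul_assoc]; exact ha _ (ha _ (ha _ hx))

-- This form suits `twist_mul`, where the rightmost factor is the first to be straightened. It
-- follows from left induction once the claim is strengthened to preservation of P under right
-- multiplication by x.
variable {hξ} in
lemma induction_right {P : KAlg hξ → Prop} (h1 : P 1) (hadd : ∀ x y, P x → P y → P (x + y))
    (hsmul : ∀ (r : k) x, P x → P (r • x))
    (ha : ∀ x, P x → P (x * a hξ)) (hc : ∀ x, P x → P (x * c hξ)) (x : KAlg hξ) : P x := by
  suffices ∀ y, P y → P (y * x) by simpa using this 1 h1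
  induction x using induction_left with
  | h1 => intro y hy; rwa [mul_one]
  | hadd u v hu hv => intro y hy; rw [mul_add]; exact hadd _ _ (hu y hy) (hv y hy)
  | hsmul r u hu => intro y hy; rw [mul_smul_comm]; exact hsmul r _ (hu y hy)
  | ha u hu => intro y hy; rw [← mul_assoc]; exact hu _ (ha y hy)
  | hc u hu => intro y hy; rw [← mul_assoc]; exact hu _ (hc y hy)

/-- Algebra maps out of `𝒦` are determined by their values on `a` and `c`. -/
lemma algHom_ext_ac {R : Type w} [Ring R] [Algebra k R] {f g : KAlg hξ →ₐ[k] R}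
    (ha : f (a hξ) = g (a hξ)) (hc : f (c hξ) = g (c hξ)) : f = g := by
  refine hom_ext ha ?_ hc ?_ <;> simp [b_eq, d_eq, ha, hc]

section slice

variable {H : Type v} [Ring H] [HopfAlgebra k H]

/-- The linear map `m ↦ ∑ f(m₍₂₎) m₍₁₎`. -/
def slice (f : Module.Dual k H) : H →ₗ[k] H :=
  (TensorProduct.rid k H).toLinearMap ∘ₗ f.lTensor H ∘ₗ comul

/-- Left multiplication by f on the dual is the transpose of `slice f`, so computations in the dual
become computations with operators on H. -/
lemma dualMul_eq_comp (f g : Module.Dual k H) : dualMul f g = g ∘ₗ slice f := by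
  ext m
  simp only [dualMul_apply, slice, LinearMap.comp_apply]
  induction comul (R := k) m using TensorProduct.induction_on with
  | zero => simp
  | tmul x y => simp
  | add x y hx hy => simp_all

lemma slice_counit (m : H) : slice (counit (R := k)) m = m := by
  simp [slice]

lemma slice_one (f : Module.Dual k H) : slice f 1 = f 1 • 1 := by
  simp [slice, Algebra.TensorProduct.one_def]

/-- Two terms suffice for both functionals of interest: g is multiplicative, and x is skew-primitive
with respect to ε and g. Thus `slice g` is multiplicative and `slice x` is a twisted derivation. -/
lemma slice_mul {f f₁ f₂ g₁ g₂ : Module.Dual k H}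
    (hf : ∀ u v, f (u * v) = f₁ u * f₂ v + g₁ u * g₂ v) (m n : H) :
    slice f (m * n) = slice f₁ m * slice f₂ n + slice g₁ m * slice g₂ n := by
  simp only [slice, LinearMap.comp_apply, Bialgebra.comul_mul]
  induction comul (R := k) m using TensorProduct.induction_on with
  | zero => simp
  | add x y hx hy => simp only [add_mul, map_add, hx, hy]; abel
  | tmul x y =>
    induction comul (R := k) n using TensorProduct.induction_on with
    | zero => simp
    | add x y hx hy => simp only [mul_add, map_add, hx, hy]; abel
    | tmul z w => simp [hf, add_smul, smul_smul, mul_comm]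

end slice

lemma gFun_mul (m n : KAlg hξ) : gFun hξ (m * n) = gFun hξ m * gFun hξ n := by
  simp [gFun]

lemma gFun_one : gFun hξ 1 = 1 := by simp [gFun]

/-- The functional x is the off-diagonal entry of an upper triangular representation whose diagonal
entries are ε and g; the formula is that entry of a matrix product. -/
lemma xFun_mul (r : k) (m n : KAlg hξ) :
    xFun hξ r (m * n) = counit (R := k) m * xFun hξ r n + xFun hξ r m * gFun hξ n := by
  have key : ∀ m : KAlg hξ, lift hξ (xRep_relations hξ r) m 0 0 = counit (R := k) m ∧
      lift hξ (xRep_relations hξ r) m 1 1 = gFun hξ m ∧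
      lift hξ (xRep_relations hξ r) m 1 0 = 0 := by
    intro m
    have hi := xi_inv hξ
    have h2 := xi_sq hξ
    induction m using induction_left with
    | h1 => simp [gFun_one]
    | hadd x y hx hy => simp [hx, hy]
    | hsmul r x hx => simp [hx]
    | ha x hx =>
      simp [Matrix.mul_apply, Fin.sum_univ_two, hx, Bialgebra.counit_mul, counit_a, gFun_mul,
        gFun_values]
      left; rw [hi]; linear_combination ξ * h2
    | hc x hx =>
      simp [Matrix.mul_apply, Fin.sum_univ_two, hx, Bialgebra.counit_mul, counit_c, gFun_mul,
        gFun_values]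
  simp only [xFun, LinearMap.comp_apply, AlgHom.toLinearMap_apply, Matrix.entryLinearMap_apply,
    map_mul, Matrix.mul_apply, Fin.sum_univ_two, key]

lemma slice_gFun_mul (m n : KAlg hξ) :
    slice (gFun hξ) (m * n) = slice (gFun hξ) m * slice (gFun hξ) n := by
  simpa [slice] using slice_mul (f := gFun hξ) (f₁ := gFun hξ) (f₂ := gFun hξ) (g₁ := 0) (g₂ := 0)
    (by simp [gFun_mul]) m n

lemma slice_xFun_mul (r : k) (m n : KAlg hξ) :
    slice (xFun hξ r) (m * n) =
      m * slice (xFun hξ r) n + slice (xFun hξ r) m * slice (gFun hξ) n := by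
  rw [slice_mul (xFun_mul hξ r), slice_counit]

lemma slice_gFun_a : slice (gFun hξ) (a hξ) = (-ξ) • a hξ := by
  simp [slice, comul_a, gFun_values, xi_inv hξ]

lemma slice_gFun_c : slice (gFun hξ) (c hξ) = (-ξ) • c hξ := by
  simp [slice, comul_c, gFun_values, xi_inv hξ]

lemma slice_xFun_a (r : k) : slice (xFun hξ r) (a hξ) = (r * ξ) • b hξ := by
  simp [slice, comul_a, xFun_values]

lemma slice_xFun_c (r : k) : slice (xFun hξ r) (c hξ) = (r * ξ) • d hξ := by
  simp [slice, comul_c, xFun_values]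

lemma slice_gFun_one : slice (gFun hξ) 1 = 1 := by
  simp [slice_one, gFun_one]

lemma slice_xFun_one (r : k) : slice (xFun hξ r) 1 = 0 := by
  simp [slice_one, xFun_values]

lemma slice_gFun_basis :
    slice (gFun hξ) (a hξ * a hξ) = (-1 : k) • (a hξ * a hξ) ∧
    slice (gFun hξ) (a hξ * (a hξ * a hξ)) = ξ • (a hξ * (a hξ * a hξ)) ∧
    slice (gFun hξ) (a hξ * c hξ) = (-1 : k) • (a hξ * c hξ) ∧
    slice (gFun hξ) (a hξ * (a hξ * c hξ)) = ξ • (a hξ * (a hξ * c hξ)) ∧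
    slice (gFun hξ) (a hξ * (a hξ * (a hξ * c hξ))) = a hξ * (a hξ * (a hξ * c hξ)) := by
  have h2 := xi_sq hξ
  simp only [slice_gFun_mul, slice_gFun_a, slice_gFun_c, mul_smul_comm, smul_mul_assoc, smul_smul]
  refine ⟨?_, ?_, ?_, ?_, ?_⟩ <;> match_scalars <;> grind

/-- While the monomials are eigenvectors of `slice g`, the operator `slice x` exchanges the span of
the aⁿ with the span of the aⁿc. -/
lemma slice_xFun_basis (r : k) :
    slice (xFun hξ r) (a hξ) = (r * ξ) • (a hξ * (a hξ * c hξ)) ∧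
    slice (xFun hξ r) (a hξ * a hξ) = 0 ∧
    slice (xFun hξ r) (a hξ * (a hξ * a hξ)) = (r * ξ) • c hξ ∧
    slice (xFun hξ r) (c hξ) = (r * ξ) • (a hξ * (a hξ * a hξ)) ∧
    slice (xFun hξ r) (a hξ * c hξ) = (r * ξ) • 1 ∧
    slice (xFun hξ r) (a hξ * (a hξ * c hξ)) = (r * ξ) • a hξ ∧
    slice (xFun hξ r) (a hξ * (a hξ * (a hξ * c hξ))) = (r * ξ) • (a hξ * a hξ) := by
  have h2 := xi_sq hξ
  simp only [slice_xFun_mul, slice_gFun_mul, slice_xFun_a, slice_xFun_c, slice_gFun_a,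
    slice_gFun_c, mul_smul_comm, smul_mul_assoc, smul_smul, b_eq, d_eq, mul_assoc, c_mul_a,
    c_mul_a_mul, a_four, a_four_mul, (relations hξ).cc, mul_zero, smul_zero, add_zero, mul_add, mul_one]
  refine ⟨?_, ?_, ?_, ?_, ?_, ?_, ?_⟩ <;> (try trivial) <;> (try match_scalars <;> grind)

/-- Every element of `𝒦` is a linear combination of `aⁿ` and `aⁿc`. -/
lemma exists_coords (h : KAlg hξ) : ∃ s₀ s₁ s₂ s₃ t₀ t₁ t₂ t₃ : k,
    h = s₀ • 1 + s₁ • a hξ + s₂ • (a hξ * a hξ) + s₃ • (a hξ * (a hξ * a hξ)) +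
      t₀ • c hξ + t₁ • (a hξ * c hξ) + t₂ • (a hξ * (a hξ * c hξ)) +
      t₃ • (a hξ * (a hξ * (a hξ * c hξ))) := by
  induction h using induction_left with
  | h1 => exact ⟨1, 0, 0, 0, 0, 0, 0, 0, by simp⟩
  | hadd x y hx hy =>
    obtain ⟨s₀, s₁, s₂, s₃, t₀, t₁, t₂, t₃, rfl⟩ := hx
    obtain ⟨s₀', s₁', s₂', s₃', t₀', t₁', t₂', t₃', rfl⟩ := hy
    exact ⟨s₀ + s₀', s₁ + s₁', s₂ + s₂', s₃ + s₃', t₀ + t₀', t₁ + t₁', t₂ + t₂', t₃ + t₃',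
      by module⟩
  | hsmul r x hx =>
    obtain ⟨s₀, s₁, s₂, s₃, t₀, t₁, t₂, t₃, rfl⟩ := hx
    exact ⟨r * s₀, r * s₁, r * s₂, r * s₃, r * t₀, r * t₁, r * t₂, r * t₃, by module⟩
  | ha x hx =>
    obtain ⟨s₀, s₁, s₂, s₃, t₀, t₁, t₂, t₃, rfl⟩ := hx
    refine ⟨s₃, s₀, s₁, s₂, t₃, t₀, t₁, t₂, ?_⟩
    simp only [mul_add, mul_smul_comm, mul_one, a_four, a_four_mul]
    module
  | hc x hx =>
    obtain ⟨s₀, s₁, s₂, s₃, t₀, t₁, t₂, t₃, rfl⟩ := hx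
    refine ⟨0, 0, 0, 0, s₀, -ξ * s₁, -ξ * -ξ * s₂, -ξ * -ξ * -ξ * s₃, ?_⟩
    simp only [mul_add, mul_smul_comm, mul_one, c_mul_a, c_mul_a_mul, (relations hξ).cc,
      mul_zero, smul_zero, smul_smul]
    module

/-- `𝒦^*` is generated by `g` and `x`. -/
lemma dual_induction [CharZero k] {r : k} (hr : r ^ 2 = 2)
    (W : Submodule k (Module.Dual k (KAlg hξ)))
    (h1 : counit ∈ W) (hg : ∀ f ∈ W, dualMul (gFun hξ) f ∈ W)
    (hx : ∀ f ∈ W, dualMul (xFun hξ r) f ∈ W) (f : Module.Dual k (KAlg hξ)) : f ∈ W := by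
  suffices W = ⊤ by rw [this]; trivial
  have hr0 : r ≠ 0 := by rintro rfl; norm_num at hr
  have h2 := xi_sq hξ
  have hξ0 : ξ ≠ 0 := by rintro rfl; norm_num at h2
  -- In finite dimension a subspace of the dual is determined by its common zeros, so it suffices
  -- that an element killed by all of W vanishes.
  suffices h : W.dualCoannihilator = ⊥ by
    rw [← Subspace.dualCoannihilator_dualAnnihilator_eq (W := W), h,
      Submodule.dualAnnihilator_bot]
  rw [eq_bot_iff]
  intro h hh
  rw [Submodule.mem_dualCoannihilator] at hh
  obtain ⟨s₀, s₁, s₂, s₃, t₀, t₁, t₂, t₃, rfl⟩ := exists_coords hξ h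
  -- The products gⁿ see only the coefficients sᵢ, and the products x·gⁿ only the tᵢ. Each group of
  -- four equations is a discrete Fourier transform over ℤ/4, whose inversion leaves the factor 4,
  -- and also rξ in the second group.
  have e0 := hh _ h1
  have e1 := hh _ (hg _ h1)
  have e2 := hh _ (hg _ (hg _ h1))
  have e3 := hh _ (hg _ (hg _ (hg _ h1)))
  have f0 := hh _ (hx _ h1)
  have f1 := hh _ (hx _ (hg _ h1))
  have f2 := hh _ (hx _ (hg _ (hg _ h1)))
  have f3 := hh _ (hx _ (hg _ (hg _ (hg _ h1))))
  simp only [dualMul_eq_comp, LinearMap.comp_apply, map_add, map_smul, slice_gFun_basis,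
    slice_xFun_basis, slice_gFun_one, slice_xFun_one, slice_gFun_a, slice_gFun_c,
    Bialgebra.counit_mul, counit_a, counit_c, Bialgebra.counit_one, smul_eq_mul, mul_one, mul_zero,
    map_zero, add_zero, zero_add] at e0 e1 e2 e3 f0 f1 f2 f3
  have q (t : k) (ht : 4 * t = 0) : t = 0 := by simpa using ht
  have q' (t : k) (ht : 4 * (t * (r * ξ)) = 0) : t = 0 := by simpa [hr0, hξ0] using ht
  obtain rfl : s₀ = 0 := q _ (by grind)
  obtain rfl : s₁ = 0 := q _ (by grind)
  obtain rfl : s₂ = 0 := q _ (by grind)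
  obtain rfl : s₃ = 0 := q _ (by grind)
  obtain rfl : t₀ = 0 := q' _ (by grind)
  obtain rfl : t₁ = 0 := q' _ (by grind)
  obtain rfl : t₂ = 0 := q' _ (by grind)
  obtain rfl : t₃ = 0 := q' _ (by grind)
  simp

end HopfK
end

/-! ### Relations of the double, and linear maps out of the dual. -/

noncomputable section

namespace HopfK

open Coalgebra DoubleCop

variable {k : Type u} [Field k] {ξ : k} (hξ : IsPrimitiveRoot ξ 4)

/-- Elements `a, c, g, x` of a `k`-algebra that satisfy the defining relations of `D(𝒦^cop)`. -/
structure DoubleRelations {R : Type w} [Ring R] [Algebra k R] (ξ r : k) (A C G X : R) : Prop where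
  aaaa : A * (A * (A * A)) = 1
  cc : C * C = 0
  ac : A * C = ξ • (C * A)
  gggg : G * (G * (G * G)) = 1
  xx : X * X = G * G - 1
  xg : X * G = -(G * X)
  ag : A * G = G * A
  cg : C * G = -(G * C)
  ax : A * X = -ξ • (X * A) + (r * ξ) • (A * (A * C)) + (r * ξ) • (G * C)
  cx : C * X = -ξ • (X * C) + (r * ξ) • (A * (A * A)) - (r * ξ) • (G * A)

section lift

variable {R : Type w} [Ring R] [Algebra k R] {r : k} {A C G X : R}

/-- The idempotent onto the eigenspace of `G` with eigenvalue `ξ⁻ⁿ`. -/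
def idem (ξ : k) (G : R) (n : ℕ) : R :=
  (4 : k)⁻¹ • (1 + ξ ^ n • G + ξ ^ (2 * n) • (G * G) + ξ ^ (3 * n) • (G * (G * G)))

/-- The linear map on `𝒦^*` with `gⁿ ↦ Gⁿ` and `gⁿx ↦ GⁿX`. -/
def dualLift (r : k) (G X : R) : Module.Dual k (KAlg hξ) →ₗ[k] R :=
  -- Fourier inversion of gⁿ(aᵐ) = ξ⁻ⁿᵐ sends the functional dual to aᵐ to `idem ξ G m`. The
  -- operator `slice g` scales aᵐc by ξ^{-(m+1)}, hence the index shift in the second group; the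
  -- factor there is the inverse of rξ when r² = 2, because then (rξ)² = -2.
  let ev := fun (v : KAlg hξ) (e : R) => (Module.Dual.eval k (KAlg hξ) v).smulRight e
  ev 1 (idem ξ G 0) + ev (a hξ) (idem ξ G 1) + ev (a hξ * a hξ) (idem ξ G 2) +
    ev (a hξ * (a hξ * a hξ)) (idem ξ G 3) +
  (-(r * ξ) / 2) • (ev (c hξ) (idem ξ G 1 * X) + ev (a hξ * c hξ) (idem ξ G 2 * X) +
    ev (a hξ * (a hξ * c hξ)) (idem ξ G 3 * X) +
    ev (a hξ * (a hξ * (a hξ * c hξ))) (idem ξ G 0 * X))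

lemma dualLift_apply (f : Module.Dual k (KAlg hξ)) : dualLift hξ r G X f =
    f 1 • idem ξ G 0 + f (a hξ) • idem ξ G 1 + f (a hξ * a hξ) • idem ξ G 2 +
    f (a hξ * (a hξ * a hξ)) • idem ξ G 3 +
    (-(r * ξ) / 2) • (f (c hξ) • (idem ξ G 1 * X) + f (a hξ * c hξ) • (idem ξ G 2 * X) +
    f (a hξ * (a hξ * c hξ)) • (idem ξ G 3 * X) +
    f (a hξ * (a hξ * (a hξ * c hξ))) • (idem ξ G 0 * X)) := rfl

variable [CharZero k]

include hξ in
lemma idem_sum : idem ξ G 0 + idem ξ G 1 + idem ξ G 2 + idem ξ G 3 = 1 := by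
  have h2 := xi_sq hξ
  simp only [idem]
  match_scalars <;> field_simp <;> grind

include hξ in
lemma mul_idem (hG : G * (G * (G * G)) = 1) :
    G * idem ξ G 0 = idem ξ G 0 ∧ G * idem ξ G 1 = -ξ • idem ξ G 1 ∧
    G * idem ξ G 2 = (-1 : k) • idem ξ G 2 ∧ G * idem ξ G 3 = ξ • idem ξ G 3 := by
  have h2 := xi_sq hξ
  simp only [idem, mul_add, mul_smul_comm, hG, mul_one]
  refine ⟨?_, ?_, ?_, ?_⟩ <;> match_scalars <;> field_simp <;> grind

-- As X anticommutes with G, it carries the λ-eigenspace of G to the (-λ)-eigenspace, which shifts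
-- the index by 2.
include hξ in
lemma comm_idem (hX : X * G = -(G * X)) :
    X * idem ξ G 0 = idem ξ G 2 * X ∧ X * idem ξ G 1 = idem ξ G 3 * X ∧
    X * idem ξ G 2 = idem ξ G 0 * X ∧ X * idem ξ G 3 = idem ξ G 1 * X := by
  have h2 := xi_sq hξ
  have hX' (Y : R) : X * (G * Y) = -(G * (X * Y)) := by rw [← mul_assoc, hX]; noncomm_ring
  simp only [idem, mul_add, add_mul, mul_smul_comm, smul_mul_assoc, hX, hX', mul_assoc, mul_one,
    one_mul, mul_neg]
  refine ⟨?_, ?_, ?_, ?_⟩ <;> match_scalars <;> field_simp <;> grind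

omit [CharZero k] in
lemma idem_comm (n : ℕ) : idem ξ G n * G = G * idem ξ G n := by
  simp only [idem, mul_add, add_mul, mul_smul_comm, smul_mul_assoc, mul_one, one_mul, mul_assoc]

-- On the λ-eigenspace of G the operator X² = G² - 1 is λ² - 1: zero for λ = ±1 and -2 for λ = ±ξ.
include hξ in
lemma idem_mul_sq (hG : G * (G * (G * G)) = 1) (hX : X * X = G * G - 1) :
    idem ξ G 0 * (X * X) = 0 ∧ idem ξ G 1 * (X * X) = (-2 : k) • idem ξ G 1 ∧
    idem ξ G 2 * (X * X) = 0 ∧ idem ξ G 3 * (X * X) = (-2 : k) • idem ξ G 3 := by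
  have h2 := xi_sq hξ
  obtain ⟨h0, h1, h2, h3⟩ := mul_idem hξ hG
  have key (n : ℕ) : idem ξ G n * (X * X) = G * (G * idem ξ G n) - idem ξ G n := by
    rw [hX, mul_sub, mul_one, ← mul_assoc, idem_comm, mul_assoc, idem_comm]
  simp only [key, h0, h1, h2, h3, mul_smul_comm, smul_smul]
  refine ⟨?_, ?_, ?_, ?_⟩ <;> match_scalars <;> grind

lemma dualLift_counit : dualLift hξ r G X counit = 1 := by
  simp [dualLift_apply, Bialgebra.counit_mul, counit_a, counit_c, idem_sum hξ]

lemma dualLift_gFun_mul (hG : G * (G * (G * G)) = 1) (f : Module.Dual k (KAlg hξ)) :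
    dualLift hξ r G X (dualMul (gFun hξ) f) = G * dualLift hξ r G X f := by
  obtain ⟨h0, h1, h2, h3⟩ := mul_idem hξ hG
  simp only [dualLift_apply, dualMul_eq_comp, LinearMap.comp_apply, slice_gFun_basis,
    slice_gFun_one, slice_gFun_a, slice_gFun_c, map_smul, mul_add, mul_smul_comm, ← mul_assoc G, h0,
    h1, h2, h3, smul_mul_assoc, smul_eq_mul]
  module

/-- The way `slice x` moves the monomials is matched, after transposition, by the way X permutes the
idempotents; the terms containing X² are evaluated by `idem_mul_sq`. -/
lemma dualLift_xFun_mul (hr : r ^ 2 = 2) (hG : G * (G * (G * G)) = 1) (hX : X * X = G * G - 1)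
    (hXG : X * G = -(G * X)) (f : Module.Dual k (KAlg hξ)) :
    dualLift hξ r G X (dualMul (xFun hξ r) f) = X * dualLift hξ r G X f := by
  obtain ⟨h0, h1, h2, h3⟩ := comm_idem hξ hXG
  obtain ⟨k0, k1, k2, k3⟩ := idem_mul_sq hξ hG hX
  have hsq := xi_sq hξ
  simp only [dualLift_apply, dualMul_eq_comp, LinearMap.comp_apply, slice_xFun_basis,
    slice_xFun_one, map_zero, map_smul, mul_add, mul_smul_comm, ← mul_assoc X, h0, h1, h2, h3,
    smul_eq_mul]
  simp only [mul_assoc _ X X, k0, k1, k2, k3]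
  match_scalars <;> field_simp <;> grind

/-- For fixed f' the good f form a subspace that contains ε and is stable under left multiplication
by g and x, so `dual_induction` applies. -/
lemma dualLift_mul (hr : r ^ 2 = 2) (hG : G * (G * (G * G)) = 1) (hX : X * X = G * G - 1)
    (hXG : X * G = -(G * X)) (f f' : Module.Dual k (KAlg hξ)) :
    dualLift hξ r G X (dualMul f f') = dualLift hξ r G X f * dualLift hξ r G X f' := by
  let W : Submodule k (Module.Dual k (KAlg hξ)) := LinearMap.eqLocus
    (dualLift hξ r G X ∘ₗ dualMul.flip f')
    (LinearMap.mulRight k (dualLift hξ r G X f') ∘ₗ dualLift hξ r G X)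
  refine dual_induction hξ hr W ?_ ?_ ?_ f
  · simp [W, LinearMap.mem_eqLocus, counit_dualMul, dualLift_counit]
  · intro f hf
    simp only [W, LinearMap.mem_eqLocus, LinearMap.comp_apply, LinearMap.flip_apply,
      LinearMap.mulRight_apply] at hf ⊢
    rw [dualMul_assoc, dualLift_gFun_mul hξ hG, hf, dualLift_gFun_mul hξ hG, mul_assoc]
  · intro f hf
    simp only [W, LinearMap.mem_eqLocus, LinearMap.comp_apply, LinearMap.flip_apply,
      LinearMap.mulRight_apply] at hf ⊢
    rw [dualMul_assoc, dualLift_xFun_mul hξ hr hG hX hXG, hf, dualLift_xFun_mul hξ hr hG hX hXG,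
      mul_assoc]

end lift

section cross

variable (r : k)

lemma comul₃_a : comul₃ (k := k) (a hξ) = a hξ ⊗ₜ[k] (a hξ ⊗ₜ[k] a hξ) +
    a hξ ⊗ₜ[k] (b hξ ⊗ₜ[k] c hξ) + b hξ ⊗ₜ[k] (c hξ ⊗ₜ[k] a hξ) +
    b hξ ⊗ₜ[k] (d hξ ⊗ₜ[k] c hξ) := by
  simp [comul₃, comul_a, comul_c, TensorProduct.tmul_add]; abel

lemma comul₃_c : comul₃ (k := k) (c hξ) = c hξ ⊗ₜ[k] (a hξ ⊗ₜ[k] a hξ) +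
    c hξ ⊗ₜ[k] (b hξ ⊗ₜ[k] c hξ) + d hξ ⊗ₜ[k] (c hξ ⊗ₜ[k] a hξ) +
    d hξ ⊗ₜ[k] (d hξ ⊗ₜ[k] c hξ) := by
  simp [comul₃, comul_a, comul_c, TensorProduct.tmul_add]; abel

lemma coad_gFun (u v : KAlg hξ) : coad u v (gFun hξ) =
    (gFun hξ (antipodeMap hξ u) * gFun hξ v) • gFun hξ := by
  ext m
  change gFun hξ (antipodeMap hξ u * (m * v)) = _
  simp only [gFun_mul, LinearMap.smul_apply, smul_eq_mul]; ring

/-- Skew-primitivity applied twice to x(S(u) m v) leaves only ε, x and g, so the span of these three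
functionals is stable under straightening. -/
lemma coad_xFun (u v : KAlg hξ) : coad u v (xFun hξ r) =
    (counit (R := k) u * xFun hξ r v) • counit + (counit (R := k) u * gFun hξ v) • xFun hξ r +
      (xFun hξ r (antipodeMap hξ u) * gFun hξ v) • gFun hξ := by
  ext m
  change xFun hξ r (antipodeMap hξ u * (m * v)) = _
  have : counit (R := k) (antipodeMap hξ u) = counit (R := k) u :=
    HopfAlgebra.counit_antipode (R := k) u
  simp only [xFun_mul, gFun_mul, this, LinearMap.add_apply, LinearMap.smul_apply, smul_eq_mul]; ring

/-- The straightening rules for a and c past g and x, here and in the next three lemmas, are the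
source of the fields `ag`, `cg`, `ax` and `cx` of `DoubleRelations`. -/
lemma twist_a_gFun : twist (a hξ) (gFun hξ) = gFun hξ ⊗ₜ[k] a hξ := by
  have h2 := xi_sq hξ
  simp [twist_apply, comul₃_a, coad_gFun, antipodeMap_a, antipodeMap_b, gFun_values, xi_inv hξ,
    ← pow_two, h2]

lemma twist_c_gFun : twist (c hξ) (gFun hξ) = (-1 : k) • (gFun hξ ⊗ₜ[k] c hξ) := by
  have h2 := xi_sq hξ
  simp [twist_apply, comul₃_c, coad_gFun, antipodeMap_c, antipodeMap_d, gFun_values, xi_inv hξ,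
    ← pow_two, h2, ← TensorProduct.smul_tmul']

lemma twist_a_xFun : twist (a hξ) (xFun hξ r) = -ξ • (xFun hξ r ⊗ₜ[k] a hξ) +
    (r * ξ) • (counit (R := k) ⊗ₜ[k] (a hξ * (a hξ * c hξ))) +
      (r * ξ) • (gFun hξ ⊗ₜ[k] c hξ) := by
  have h2 := xi_sq hξ
  simp only [twist_apply, comul₃_a, coad_xFun, antipodeMap_a, antipodeMap_b, map_add, map_smul,
    twistCore_tmul, gFun_values, xFun_values, counit_a, counit_b, xi_inv hξ, smul_eq_mul,
    mul_zero, zero_mul, zero_smul, add_zero, zero_add, TensorProduct.zero_tmul,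
    ← TensorProduct.smul_tmul', one_mul]
  simp only [b_eq]
  match_scalars <;> grind

lemma twist_c_xFun : twist (c hξ) (xFun hξ r) = -ξ • (xFun hξ r ⊗ₜ[k] c hξ) +
    (r * ξ) • (counit (R := k) ⊗ₜ[k] (a hξ * (a hξ * a hξ))) -
      (r * ξ) • (gFun hξ ⊗ₜ[k] a hξ) := by
  have h2 := xi_sq hξ
  simp only [twist_apply, comul₃_c, coad_xFun, antipodeMap_c, antipodeMap_d, map_add, map_smul,
    twistCore_tmul, gFun_values, xFun_values, counit_c, counit_d, xi_inv hξ, smul_eq_mul,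
    mul_zero, zero_mul, zero_smul, add_zero, zero_add, TensorProduct.zero_tmul,
    ← TensorProduct.smul_tmul', one_mul]
  simp only [d_eq]
  match_scalars <;> grind

end cross

end HopfK
end

/-! ### Universal property and generators of the double. -/

noncomputable section

namespace HopfK

open Coalgebra DoubleCop

variable {k : Type u} [Field k] {ξ : k} (hξ : IsPrimitiveRoot ξ 4)

section lift

variable {R : Type w} [Ring R] [Algebra k R] {r : k} {A C G X : R}

lemma DoubleRelations.relations (hξ : IsPrimitiveRoot ξ 4) (h : DoubleRelations ξ r A C G X) :
    Relations ξ A (A * (A * C)) C (A * (A * A)) := by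
  have h2 := xi_sq hξ
  have hca : C * A = -ξ • (A * C) := by
    rw [h.ac, smul_smul]; match_scalars; linear_combination h2
  have hca' (Y : R) : C * (A * Y) = -ξ • (A * (C * Y)) := by
    rw [← mul_assoc, hca, smul_mul_assoc, mul_assoc]
  have haaaa (Y : R) : A * (A * (A * (A * Y))) = Y := by
    have := congrArg (· * Y) h.aaaa
    simpa only [mul_assoc, one_mul] using this
  constructor
  all_goals
    simp only [pow_succ, pow_zero, one_mul, mul_assoc, hca, hca', h.cc, h.aaaa, haaaa,
      mul_smul_comm, smul_smul, mul_zero, smul_zero]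
  all_goals try (match_scalars; grind)

/-- The algebra map from `𝒦` defined by elements that satisfy the relations of the double. -/
def algLift (h : DoubleRelations ξ r A C G X) : KAlg hξ →ₐ[k] R := lift hξ (h.relations hξ)

/-- The linear map on the double with `f ⋈ h ↦ α(f) β(h)`, for maps `α` on `𝒦^*` and `β` on
`𝒦`. -/
def pairLift (α : Module.Dual k (KAlg hξ) →ₗ[k] R) (β : KAlg hξ →ₗ[k] R) :
    Module.Dual k (KAlg hξ) ⊗[k] KAlg hξ →ₗ[k] R :=
  TensorProduct.lift ((LinearMap.mul k R).compl₁₂ α β)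

@[simp] lemma pairLift_tmul (α : Module.Dual k (KAlg hξ) →ₗ[k] R) (β : KAlg hξ →ₗ[k] R)
    (f : Module.Dual k (KAlg hξ)) (h : KAlg hξ) : pairLift hξ α β (f ⊗ₜ h) = α f * β h := rfl

/-- The outer factors of `doubleMul` pass through as soon as α and β are multiplicative; only the
cross term from `twist` remains to be treated. -/
lemma pairLift_map {α : Module.Dual k (KAlg hξ) →ₗ[k] R} {β : KAlg hξ →ₐ[k] R}
    (hα : ∀ f f', α (dualMul f f') = α f * α f') (f : Module.Dual k (KAlg hξ)) (l : KAlg hξ)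
    (Y : Module.Dual k (KAlg hξ) ⊗[k] KAlg hξ) :
    pairLift hξ α β.toLinearMap (TensorProduct.map (dualMul f) (LinearMap.mulRight k l) Y) =
      α f * pairLift hξ α β.toLinearMap Y * β l := by
  induction Y using TensorProduct.induction_on with
  | zero => simp
  | add Y Z hY hZ => simp only [map_add, hY, hZ, mul_add, add_mul]
  | tmul f' h => simp [hα, mul_assoc]

variable [CharZero k]

/-- This compatibility of the two factors is what makes the combined map multiplicative. It
propagates along products in y by `twist_mul` and along products in f by `twist_dualMul`, so it
reduces to the four cross relations. -/
lemma pairLift_twist (hr : r ^ 2 = 2) (h : DoubleRelations ξ r A C G X) (y : KAlg hξ)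
    (f : Module.Dual k (KAlg hξ)) :
    pairLift hξ (dualLift hξ r G X) (algLift hξ h).toLinearMap (twist y f) =
      algLift hξ h y * dualLift hξ r G X f := by
  set α := dualLift hξ r G X with hαdef
  set β := algLift hξ h with hβdef
  have hα : ∀ f f', α (dualMul f f') = α f * α f' := dualLift_mul hξ hr h.gggg h.xx h.xg
  have α1 : α counit = 1 := dualLift_counit hξ
  have αg : α (gFun hξ) = G := by
    rw [← dualMul_counit (gFun hξ), hαdef, dualLift_gFun_mul hξ h.gggg, ← hαdef, α1, mul_one]
  have αx : α (xFun hξ r) = X := by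
    rw [← dualMul_counit (xFun hξ r), hαdef, dualLift_xFun_mul hξ hr h.gggg h.xx h.xg, ← hαdef, α1,
      mul_one]
  have βa : β (a hξ) = A := by simp [hβdef, algLift]
  have βc : β (c hξ) = C := by simp [hβdef, algLift]
  have Qone (y : KAlg hξ) : pairLift hξ α β.toLinearMap (twist y counit) = β y * α counit := by
    simp [twist_counit, α1]
  have step (y l : KAlg hξ) (f : Module.Dual k (KAlg hξ))
      (hy : pairLift hξ α β.toLinearMap (twist y f) = β y * α f) :
      pairLift hξ α β.toLinearMap (doubleMul (counit ⊗ₜ[k] y) (f ⊗ₜ[k] l)) =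
        β y * (α f * β l) := by
    rw [doubleMul_tmul, pairLift_map hξ hα, hy, α1, one_mul, mul_assoc]
  have Qg (y : KAlg hξ) :
      pairLift hξ α β.toLinearMap (twist y (gFun hξ)) = β y * α (gFun hξ) := by
    induction y using induction_right with
    | h1 => simp [twist_one_left]
    | hadd x y hx hy => simp only [map_add, LinearMap.add_apply, hx, hy, add_mul]
    | hsmul s x hx => simp only [map_smul, LinearMap.smul_apply, hx, smul_mul_assoc]
    | ha y hy =>
      rw [twist_mul, twist_a_gFun, step _ _ _ hy, map_mul, mul_assoc, βa, αg, h.ag]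
    | hc y hy =>
      rw [twist_mul, twist_c_gFun, map_smul, map_smul, step _ _ _ hy, map_mul, mul_assoc, βc, αg,
        h.cg, mul_neg, neg_smul, one_smul]
  -- Straightening a or c past x also produces terms with ε and g, so the cases `Qone` and `Qg`
  -- enter this induction.
  have Qx (y : KAlg hξ) :
      pairLift hξ α β.toLinearMap (twist y (xFun hξ r)) = β y * α (xFun hξ r) := by
    induction y using induction_right with
    | h1 => simp [twist_one_left]
    | hadd x y hx hy => simp only [map_add, LinearMap.add_apply, hx, hy, add_mul]
    | hsmul s x hx => simp only [map_smul, LinearMap.smul_apply, hx, smul_mul_assoc]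
    | ha y hy =>
      rw [twist_mul, twist_a_xFun]
      simp only [map_add, map_smul]
      rw [step _ _ _ hy, step _ _ _ (Qone y), step _ _ _ (Qg y), map_mul β y, mul_assoc, βa, αx,
        h.ax, αg, α1]
      simp only [map_mul, βa, βc, mul_add, mul_smul_comm, one_mul]
    | hc y hy =>
      rw [twist_mul, twist_c_xFun]
      simp only [map_add, map_sub, map_smul]
      rw [step _ _ _ hy, step _ _ _ (Qone y), step _ _ _ (Qg y), map_mul β y, mul_assoc, βc, αx,
        h.cx, αg, α1]
      simp only [map_mul, βa, mul_add, mul_sub, mul_smul_comm, one_mul]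
  have prod (u f : Module.Dual k (KAlg hξ))
      (hu : ∀ y, pairLift hξ α β.toLinearMap (twist y u) = β y * α u)
      (hf : ∀ y, pairLift hξ α β.toLinearMap (twist y f) = β y * α f) (y : KAlg hξ) :
      pairLift hξ α β.toLinearMap (twist y (dualMul u f)) = β y * α (dualMul u f) := by
    rw [twist_dualMul, hα, ← mul_assoc, ← hu]
    induction twist y u using TensorProduct.induction_on with
    | zero => simp
    | add Y Z hY hZ => simp only [map_add, LinearMap.add_apply, hY, hZ, add_mul]
    | tmul f' z =>
      rw [doubleMul_tmul, pairLift_map hξ hα, hf, map_one, mul_one, pairLift_tmul, mul_assoc]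
      rfl
  -- The identity is required for all y at once, because straightening past a product of functionals
  -- changes the element of 𝒦 that meets the second factor.
  let W : Submodule k (Module.Dual k (KAlg hξ)) := ⨅ y : KAlg hξ, LinearMap.eqLocus
    (pairLift hξ α β.toLinearMap ∘ₗ twist y) (LinearMap.mulLeft k (β y) ∘ₗ α)
  have mem (f) : f ∈ W ↔ ∀ y, pairLift hξ α β.toLinearMap (twist y f) = β y * α f := by
    simp [W, Submodule.mem_iInf, LinearMap.mem_eqLocus]
  refine (mem f).1 (dual_induction hξ hr W ((mem _).2 Qone) ?_ ?_ f) y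
  · exact fun f hf => (mem _).2 (prod _ _ Qg ((mem f).1 hf))
  · exact fun f hf => (mem _).2 (prod _ _ Qx ((mem f).1 hf))

/-- The algebra map from the double defined by elements that satisfy its relations. -/
def D.lift (hr : r ^ 2 = 2) (h : DoubleRelations ξ r A C G X) : D hξ →ₐ[k] R :=
  AlgHom.ofLinearMap
    (pairLift hξ (dualLift hξ r G X) (algLift hξ h).toLinearMap ∘ₗ ofTensor.symm.toLinearMap)
    (by
      change pairLift hξ _ _ (counit ⊗ₜ[k] 1) = 1
      simp [dualLift_counit])
    (by
      intro Y Z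
      change pairLift hξ _ _ (doubleMul (ofTensor.symm Y) (ofTensor.symm Z)) =
        pairLift hξ _ _ (ofTensor.symm Y) * pairLift hξ _ _ (ofTensor.symm Z)
      generalize (ofTensor.symm Y : Module.Dual k (KAlg hξ) ⊗[k] KAlg hξ) = Y
      generalize (ofTensor.symm Z : Module.Dual k (KAlg hξ) ⊗[k] KAlg hξ) = Z
      induction Y using TensorProduct.induction_on with
      | zero => simp
      | add Y Y' hY hY' => simp only [map_add, LinearMap.add_apply, hY, hY', add_mul]
      | tmul f y =>
      induction Z using TensorProduct.induction_on with
      | zero => simp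
      | add Y Y' hY hY' => simp only [map_add, hY, hY', mul_add]
      | tmul f' y' =>
        rw [doubleMul_tmul, pairLift_map hξ (dualLift_mul hξ hr h.gggg h.xx h.xg),
          pairLift_twist hξ hr h]
        simp [mul_assoc])

lemma D.lift_bowtie (hr : r ^ 2 = 2) (h : DoubleRelations ξ r A C G X)
    (f : Module.Dual k (KAlg hξ)) (y : KAlg hξ) :
    D.lift hξ hr h (bowtie f y) = dualLift hξ r G X f * algLift hξ h y := rfl

lemma D.lift_actsBy (hr : r ^ 2 = 2) (h : DoubleRelations ξ r A C G X) :
    ActsBy hξ r (D.lift hξ hr h) A (A * (A * C)) C (A * (A * A)) X G where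
  map_a := by simp [D.ofK, D.lift_bowtie, dualLift_counit, algLift]
  map_b := by simp [D.ofK, D.lift_bowtie, dualLift_counit, algLift]
  map_c := by simp [D.ofK, D.lift_bowtie, dualLift_counit, algLift]
  map_d := by simp [D.ofK, D.lift_bowtie, dualLift_counit, algLift]
  map_x := by
    rw [D.ofDual, D.lift_bowtie, map_one, mul_one, ← dualMul_counit (xFun hξ r),
      dualLift_xFun_mul hξ hr h.gggg h.xx h.xg, dualLift_counit, mul_one]
  map_g := by
    rw [D.ofDual, D.lift_bowtie, map_one, mul_one, ← dualMul_counit (gFun hξ),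
      dualLift_gFun_mul hξ h.gggg, dualLift_counit, mul_one]

end lift

section generators

lemma D.ofK_mul (y z : KAlg hξ) : D.ofK (y * z) = D.ofK y * D.ofK z := by
  change bowtie _ _ = ofTensor (doubleMul (counit ⊗ₜ[k] y) (counit ⊗ₜ[k] z))
  simp [twist_counit, counit_dualMul, bowtie]

lemma D.ofDual_mul (f f' : Module.Dual k (KAlg hξ)) :
    D.ofDual (dualMul f f') = D.ofDual f * D.ofDual f' := by
  change bowtie _ _ = ofTensor (doubleMul (f ⊗ₜ[k] 1) (f' ⊗ₜ[k] 1))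
  simp [twist_one_left, bowtie]

lemma D.ofDual_mul_ofK (f : Module.Dual k (KAlg hξ)) (y : KAlg hξ) :
    D.ofDual f * D.ofK y = bowtie f y := by
  change ofTensor (doubleMul (f ⊗ₜ[k] 1) (counit ⊗ₜ[k] y)) = _
  simp [twist_one_left, dualMul_counit, bowtie]

lemma D.ofK_add (y z : KAlg hξ) : D.ofK (y + z) = D.ofK y + D.ofK z := by
  simp [D.ofK, bowtie, TensorProduct.tmul_add]

lemma D.ofK_smul (s : k) (y : KAlg hξ) : D.ofK (s • y) = s • D.ofK y := by
  simp [D.ofK, bowtie]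

lemma D.ofDual_add (y z : Module.Dual k (KAlg hξ)) :
    D.ofDual (y + z) = D.ofDual y + D.ofDual z := by
  simp [D.ofDual, bowtie, TensorProduct.add_tmul]

lemma D.ofDual_smul (s : k) (y : Module.Dual k (KAlg hξ)) :
    D.ofDual (s • y) = s • D.ofDual y := by
  simp [D.ofDual, bowtie, ← TensorProduct.smul_tmul']

variable [CharZero k] {r : k}

/-- The double is generated by `a, c, g, x`. -/
lemma D.subalgebra_eq_top (hr : r ^ 2 = 2) {S : Subalgebra k (D hξ)}
    (ha : D.ofK (a hξ) ∈ S) (hc : D.ofK (c hξ) ∈ S) (hg : D.ofDual (gFun hξ) ∈ S)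
    (hx : D.ofDual (xFun hξ r) ∈ S) : S = ⊤ := by
  have hK (y : KAlg hξ) : D.ofK y ∈ S := by
    induction y using induction_left with
    | h1 => exact S.one_mem
    | hadd y z hy hz => rw [D.ofK_add]; exact S.add_mem hy hz
    | hsmul s y hy => rw [D.ofK_smul]; exact S.smul_mem hy s
    | ha y hy => rw [D.ofK_mul]; exact S.mul_mem ha hy
    | hc y hy => rw [D.ofK_mul]; exact S.mul_mem hc hy
  let W : Submodule k (Module.Dual k (KAlg hξ)) :=
    { carrier := {f | D.ofDual f ∈ S}
      add_mem' := fun hf hf' => by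
        simp only [Set.mem_ofPred_eq, D.ofDual_add]; exact S.add_mem hf hf'
      zero_mem' := by
        have := D.ofDual_smul hξ 0 0
        rw [zero_smul, zero_smul] at this
        simp only [Set.mem_ofPred_eq, this]; exact S.zero_mem
      smul_mem' := fun s f hf => by
        simp only [Set.mem_ofPred_eq, D.ofDual_smul]; exact S.smul_mem hf s }
  have hD (f : Module.Dual k (KAlg hξ)) : D.ofDual f ∈ S :=
    dual_induction hξ hr W S.one_mem
      (fun f hf => by
        change D.ofDual _ ∈ S; rw [D.ofDual_mul]; exact S.mul_mem hg hf)
      (fun f hf => by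
        change D.ofDual _ ∈ S; rw [D.ofDual_mul]; exact S.mul_mem hx hf) f
  rw [eq_top_iff]
  intro Y _
  obtain ⟨Y, rfl⟩ := (ofTensor (k := k) (H := KAlg hξ)).surjective Y
  induction Y using TensorProduct.induction_on with
  | zero => rw [map_zero]; exact S.zero_mem
  | add Y Z hY hZ => rw [map_add]; exact S.add_mem (hY trivial) (hZ trivial)
  | tmul f y =>
    change bowtie f y ∈ S
    rw [← D.ofDual_mul_ofK]; exact S.mul_mem (hD f) (hK y)

lemma D.algHom_ext (hr : r ^ 2 = 2) {R : Type w} [Ring R] [Algebra k R]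
    {ρ σ : D hξ →ₐ[k] R} {A B C E X G : R} (hρ : ActsBy hξ r ρ A B C E X G)
    (hσ : ActsBy hξ r σ A B C E X G) : ρ = σ := by
  have := D.subalgebra_eq_top hξ hr (S := AlgHom.equalizer ρ σ)
    (hρ.map_a.trans hσ.map_a.symm) (hρ.map_c.trans hσ.map_c.symm)
    (hρ.map_g.trans hσ.map_g.symm) (hρ.map_x.trans hσ.map_x.symm)
  ext Y
  have hY : Y ∈ AlgHom.equalizer ρ σ := by rw [this]; trivial
  exact hY

end generators

end HopfK
end

/-! ### Characters and tensor products with them. -/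

noncomputable section

namespace HopfK

open Coalgebra DoubleCop

variable {k : Type u} [Field k] {ξ : k} (hξ : IsPrimitiveRoot ξ 4)

lemma charRelations (ξ r : k) {s : k} (hs : s ^ 4 = 1) :
    DoubleRelations ξ r s 0 (s ^ 2) 0 := by
  constructor <;> (try simp only [smul_eq_mul]) <;> grind

/-- These are the operators on the tensor product with the character a ↦ s: it sends d to s³ = s⁻¹
and g to s², and kills b, c and x. -/
lemma DoubleRelations.twist {R : Type w} [Ring R] [Algebra k R] {r : k} {A C G X : R}
    (h : DoubleRelations ξ r A C G X) {s : k} (hs : s ^ 4 = 1) :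
    DoubleRelations ξ r (s • A) (s ^ 3 • C) (s ^ 2 • G) X := by
  constructor <;>
    simp only [smul_mul_assoc, mul_smul_comm, smul_smul, h.aaaa, h.cc, h.ac, h.gggg, h.xx, h.xg,
      h.ag, h.cg, h.ax, h.cx, smul_zero] <;>
    match_scalars <;> grind

section shift

variable {R : Type w} [Ring R] [Algebra k R] {r : k} {G X : R}

lemma slice_gFun_sq_pow (n : ℕ) :
    slice (gFun hξ) ((a hξ * a hξ) ^ n) = ((-1 : k) ^ n) • (a hξ * a hξ) ^ n := by
  induction n with
  | zero => simp [slice_gFun_one]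
  | succ n ih =>
    rw [pow_succ, slice_gFun_mul, ih, (slice_gFun_basis hξ).1, smul_mul_smul_comm, pow_succ]

lemma slice_xFun_sq_pow (r : k) (n : ℕ) : slice (xFun hξ r) ((a hξ * a hξ) ^ n) = 0 := by
  induction n with
  | zero => simp [slice_xFun_one]
  | succ n ih => rw [pow_succ, slice_xFun_mul, ih, (slice_xFun_basis hξ r).2.1]; simp

variable [CharZero k]

/-- Precomposition with left multiplication by a²ⁿ fixes ε and x and multiplies g by (-1)ⁿ,
reflecting that a² is group-like. Compatibility with left multiplication by g and x then extends
this to all functionals. -/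
lemma dualLift_shift (hr : r ^ 2 = 2) (hG : G * (G * (G * G)) = 1) (hX : X * X = G * G - 1)
    (hXG : X * G = -(G * X)) (n : ℕ) (f : Module.Dual k (KAlg hξ)) :
    dualLift hξ r ((-1 : k) ^ n • G) X f =
      dualLift hξ r G X (f ∘ₗ LinearMap.mulLeft k ((a hξ * a hξ) ^ n)) := by
  have e : (-1 : k) ^ n * (-1) ^ n = 1 := by rw [← mul_pow]; simp
  have hG' : ((-1 : k) ^ n • G) * (((-1 : k) ^ n • G) * (((-1 : k) ^ n • G) *
      ((-1 : k) ^ n • G))) = 1 := by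
    simp only [smul_mul_assoc, mul_smul_comm, smul_smul, hG, e, one_smul]
  have hX' : X * X = ((-1 : k) ^ n • G) * ((-1 : k) ^ n • G) - 1 := by
    simp only [smul_mul_assoc, mul_smul_comm, smul_smul, hX, e, one_smul]
  have hXG' : X * ((-1 : k) ^ n • G) = -(((-1 : k) ^ n • G) * X) := by
    simp only [smul_mul_assoc, mul_smul_comm, hXG, smul_neg]
  let τ : Module.Dual k (KAlg hξ) →ₗ[k] Module.Dual k (KAlg hξ) :=
    Module.Dual.transpose (LinearMap.mulLeft k ((a hξ * a hξ) ^ n))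
  change _ = dualLift hξ r G X (τ f)
  let W : Submodule k (Module.Dual k (KAlg hξ)) := LinearMap.eqLocus
    (dualLift hξ r ((-1 : k) ^ n • G) X) (dualLift hξ r G X ∘ₗ τ)
  have mem (f) : f ∈ W ↔ dualLift hξ r ((-1 : k) ^ n • G) X f = dualLift hξ r G X (τ f) := Iff.rfl
  refine (mem f).1 (dual_induction hξ hr W ?_ ?_ ?_ f)
  · rw [mem]
    have : τ counit = counit := by
      ext m
      change counit ((a hξ * a hξ) ^ n * m) = counit m
      simp [Bialgebra.counit_mul, Bialgebra.counit_pow, counit_a]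
    rw [this, dualLift_counit, dualLift_counit]
  · intro f hf
    rw [mem] at hf ⊢
    have : τ (dualMul (gFun hξ) f) = (-1 : k) ^ n • dualMul (gFun hξ) (τ f) := by
      ext m
      simp only [dualMul_eq_comp, LinearMap.smul_apply]
      change f (slice _ ((a hξ * a hξ) ^ n * m)) = _ • f ((a hξ * a hξ) ^ n * slice _ m)
      rw [slice_gFun_mul, slice_gFun_sq_pow, smul_mul_assoc, map_smul]
    rw [this, dualLift_gFun_mul hξ hG', hf, map_smul, dualLift_gFun_mul hξ hG, smul_mul_assoc]
  · intro f hf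
    rw [mem] at hf ⊢
    have : τ (dualMul (xFun hξ r) f) = dualMul (xFun hξ r) (τ f) := by
      ext m
      simp only [dualMul_eq_comp]
      change f (slice _ ((a hξ * a hξ) ^ n * m)) = f ((a hξ * a hξ) ^ n * slice _ m)
      rw [slice_xFun_mul, slice_xFun_sq_pow, zero_mul, add_zero]
    rw [this, dualLift_xFun_mul hξ hr hG' hX' hXG', hf, dualLift_xFun_mul hξ hr hG hX hXG]

lemma dualLift_char (hr : r ^ 2 = 2) (n : ℕ) (f : Module.Dual k (KAlg hξ)) :
    dualLift hξ r ((-1 : k) ^ n) 0 f = f ((a hξ * a hξ) ^ n) := by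
  have h2 := xi_sq hξ
  -- For G = 1 and X = 0 only the idempotent of index 0 survives. Shifting by (-1)ⁿ turns evaluation
  -- at 1 into evaluation at a²ⁿ.
  have key (f : Module.Dual k (KAlg hξ)) : dualLift hξ r (1 : k) 0 f = f 1 := by
    simp only [dualLift_apply, idem, smul_eq_mul, mul_zero, add_zero, mul_one]
    field_simp
    grind
  have := dualLift_shift hξ hr (G := (1 : k)) (X := 0) (by simp) (by simp) (by simp) n f
  rw [smul_eq_mul, mul_one] at this
  rw [this, key]
  simp

end shift

section tensor

variable [CharZero k] {M : Type w} [AddCommGroup M] [Module k M] {r : k}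
  {A C G X : Module.End k M}

omit [CharZero k] in
lemma lid_map_dualComul (f : Module.Dual k (KAlg hξ)) (t : KAlg hξ) :
    TensorProduct.lid k _ (TensorProduct.map (Module.Dual.eval k _ t) LinearMap.id
      (dualComul f)) = f ∘ₗ LinearMap.mulLeft k t := by
  ext m
  have h := dualComul_spec f t m
  rw [LinearMap.comp_apply, LinearMap.mulLeft_apply, ← h]
  induction dualComul f using TensorProduct.induction_on with
  | zero => simp
  | add Y Z hY hZ => simp_all
  | tmul f f' => simp

/-- By the order of factors in the coproduct, the character receives f₍₁₎ ⋈ h₍₁₎ and M receives f₍₂₎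
⋈ h₍₂₎. The dual part becomes f₍₁₎(a²ⁿ) f₍₂₎ = f(a²ⁿ ·), handled by `dualLift_shift`; the part in 𝒦
is an algebra map, determined at a and c. -/
lemma tensorAct_lift (hr : r ^ 2 = 2) (h : DoubleRelations ξ r A C G X) {s : k} (hs : s ^ 4 = 1)
    {n : ℕ} (hn : s ^ 2 = (-1) ^ n) (Y : D hξ) (v : M) :
    tensorAct (D.lift hξ hr h) (charRep (D.lift hξ hr (charRelations ξ r hs))) Y (v ⊗ₜ[k] 1) =
      D.lift hξ hr (h.twist hs) Y v ⊗ₜ[k] 1 := by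
  set χK := algLift hξ (charRelations ξ r hs) with hχK
  set β := algLift hξ h with hβ
  have hχ (f : Module.Dual k (KAlg hξ)) (y : KAlg hξ) :
      D.lift hξ hr (charRelations ξ r hs) (bowtie f y) = f ((a hξ * a hξ) ^ n) * χK y := by
    have e : dualLift hξ r (s ^ 2) 0 f = f ((a hξ * a hξ) ^ n) := by
      rw [hn, dualLift_char hξ hr]
    rw [D.lift_bowtie, e]
  -- Scalars commute with everything, so h ↦ ∑ χ(h₍₁₎) β(h₍₂₎) is an algebra map, and comparing it
  -- with the rescaled one at a and c is enough.
  let β' : KAlg hξ ⊗[k] KAlg hξ →ₐ[k] Module.End k M :=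
    Algebra.TensorProduct.lift ((Algebra.ofId k (Module.End k M)).comp χK) β
      (fun x y => by
      change Commute (algebraMap k _ (χK x)) _
      exact Algebra.commute_algebraMap_left _ _)
  have hβ' : β'.comp (Bialgebra.comulAlgHom k (KAlg hξ)) = algLift hξ (h.twist hs) := by
    refine algHom_ext_ac hξ ?_ ?_
    · simp [comul_a, β', hχK, hβ, algLift, Algebra.ofId_apply, Algebra.algebraMap_eq_smul_one]
    · simp [comul_c, β', hχK, hβ, algLift, Algebra.ofId_apply, Algebra.algebraMap_eq_smul_one,
        smul_smul, pow_succ, mul_assoc]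
  obtain ⟨Y, rfl⟩ := (ofTensor (k := k) (H := KAlg hξ)).surjective Y
  induction Y using TensorProduct.induction_on with
  | zero => simp
  | add Y Z hY hZ => simp only [map_add, LinearMap.add_apply, hY, hZ, TensorProduct.add_tmul]
  | tmul f y =>
    change _ = D.lift hξ hr (h.twist hs) (bowtie f y) v ⊗ₜ[k] 1
    have e : dualLift hξ r (s ^ 2 • G) X f =
        dualLift hξ r G X (f ∘ₗ LinearMap.mulLeft k ((a hξ * a hξ) ^ n)) := by
      rw [hn, dualLift_shift hξ hr h.gggg h.xx h.xg]
    rw [D.lift_bowtie, e, ← lid_map_dualComul, ← hβ']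
    change TensorProduct.homTensorHomMap (RingHom.id k) M k M k (TensorProduct.map
      (D.lift hξ hr h).toLinearMap (charRep (D.lift hξ hr (charRelations ξ r hs))).toLinearMap
      (TensorProduct.map ofTensor.toLinearMap ofTensor.toLinearMap
      (TensorProduct.tensorTensorTensorComm k _ _ _ _ (TensorProduct.comm k _ _ (dualComul f) ⊗ₜ[k]
        TensorProduct.comm k _ _ (comul y))))) (v ⊗ₜ[k] 1) =
      (dualLift hξ r G X _ * β' (comul y)) v ⊗ₜ[k] 1
    induction dualComul f using TensorProduct.induction_on with
    | zero => simp
    | add Y Z hY hZ =>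
      simp only [map_add, LinearMap.add_apply, TensorProduct.add_tmul, hY, hZ, add_mul]
    | tmul f f' =>
    induction comul (R := k) y using TensorProduct.induction_on with
    | zero => simp
    | add Y Z hY hZ =>
      simp only [map_add, LinearMap.add_apply, TensorProduct.add_tmul, TensorProduct.tmul_add,
        hY, hZ, mul_add]
    | tmul y y' =>
      simp only [TensorProduct.comm_tmul, TensorProduct.tensorTensorTensorComm_tmul,
        TensorProduct.map_tmul, LinearEquiv.coe_coe, TensorProduct.homTensorHomMap_apply]
      change (D.lift hξ hr h) (bowtie f' y') v ⊗ₜ[k]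
        (D.lift hξ hr (charRelations ξ r hs) (bowtie f y) * 1) = _
      rw [hχ, D.lift_bowtie]
      simp [β', Algebra.ofId_apply, Algebra.algebraMap_eq_smul_one, 
        ← TensorProduct.smul_tmul', smul_smul, hβ]
      rw [← TensorProduct.tmul_smul, smul_eq_mul, mul_one, mul_comm (χK y)]

end tensor

end HopfK
end

/-! ### Fourth roots of unity and matrix solutions of the relations. -/

noncomputable section

namespace HopfK

open Coalgebra DoubleCop

variable {k : Type u} [Field k] {ξ : k} (hξ : IsPrimitiveRoot ξ 4)

section rootPow

variable {hξ}

lemma rootPow_add (hξ : IsPrimitiveRoot ξ 4) (i j : ZMod 4) :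
    rootPow ξ (i + j) = rootPow ξ i * rootPow ξ j := by
  rw [rootPow, rootPow, rootPow, ZMod.val_add, ← pow_add, ← pow_mod_orderOf ξ (i.val + j.val),
    ← hξ.eq_orderOf]

lemma rootPow_pow_four (hξ : IsPrimitiveRoot ξ 4) (i : ZMod 4) : rootPow ξ i ^ 4 = 1 := by
  rw [rootPow, ← pow_mul, mul_comm, pow_mul, hξ.pow_eq_one, one_pow]

lemma rootPow_sq (hξ : IsPrimitiveRoot ξ 4) (i : ZMod 4) :
    rootPow ξ i ^ 2 = (-1) ^ i.val := by
  rw [rootPow, ← pow_mul, mul_comm, pow_mul, xi_sq hξ]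

lemma rootPow_zero : rootPow ξ 0 = 1 := by simp [rootPow]

lemma rootPow_one : rootPow ξ 1 = ξ := by
  have : (1 : ZMod 4).val = 1 := rfl
  simp [rootPow, this]

lemma rootPow_two (hξ : IsPrimitiveRoot ξ 4) : rootPow ξ 2 = -1 := by
  have : (2 : ZMod 4).val = 2 := rfl
  simp [rootPow, this, xi_sq hξ]

lemma rootPow_three (hξ : IsPrimitiveRoot ξ 4) : rootPow ξ 3 = -ξ := by
  have : (3 : ZMod 4).val = 3 := rfl
  rw [rootPow, this]
  linear_combination ξ * xi_sq hξ

lemma rootPow_neg (hξ : IsPrimitiveRoot ξ 4) (i : ZMod 4) :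
    rootPow ξ (-i) = rootPow ξ i ^ 3 := by
  have h1 := rootPow_add hξ i (-i)
  rw [add_neg_cancel, rootPow_zero] at h1
  have h4 := rootPow_pow_four hξ i
  linear_combination -rootPow ξ (-i) * h4 - rootPow ξ i ^ 3 * h1

lemma rootPow_mul_three (hξ : IsPrimitiveRoot ξ 4) (i : ZMod 4) :
    rootPow ξ (3 * i) = rootPow ξ i ^ 3 := by
  rw [show 3 * i = i + (i + i) by ring, rootPow_add hξ, rootPow_add hξ]; ring

lemma rootPow_injective (hξ : IsPrimitiveRoot ξ 4) : Function.Injective (rootPow ξ) := by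
  intro i j h
  exact ZMod.val_injective 4 (hξ.pow_inj (ZMod.val_lt i) (ZMod.val_lt j) h)

end rootPow

lemma DoubleRelations.map {R : Type v} {R' : Type w} [Ring R] [Algebra k R] [Ring R'] [Algebra k R']
    {r : k} {A C G X : R} (h : DoubleRelations ξ r A C G X) (φ : R →ₐ[k] R') :
    DoubleRelations ξ r (φ A) (φ C) (φ G) (φ X) := by
  constructor <;> simp only [← map_mul, ← map_smul, ← map_add, ← map_sub, ← map_neg, h.aaaa, h.cc,
    h.ac, h.gggg, h.xx, h.xg, h.ag, h.cg, h.ax, h.cx, map_one, map_zero]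
  rw [map_sub, map_one]

/-- Here s and t stand for ξⁱ and ξʲ. The off-diagonal entries of X have product t² - 1, as X² = G²
- 1 demands. The relations hold for every pair (i, j); the condition 2i ≠ j matters only for
simplicity. -/
lemma twoDimRelations [CharZero k] (hξ : IsPrimitiveRoot ξ 4) {r : k} (hr : r ^ 2 = 2) {s t : k}
    (hs : s ^ 4 = 1) (ht : t ^ 4 = 1) :
    DoubleRelations ξ r (R := Matrix (Fin 2) (Fin 2) k)
      !![s, 0; 0, -ξ * s] !![0, 1; 0, 0] !![t, 0; 0, -t]
      !![0, r / 2 * ξ * (s + s ^ 3 * t); r * ξ * (s ^ 3 - s * t), 0] := by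
  have h2 := xi_sq hξ
  constructor <;> ext i j <;> fin_cases i <;> fin_cases j <;>
    simp [Matrix.mul_apply, Fin.sum_univ_two] <;> field_simp <;> grind

set_option maxHeartbeats 2000000 in
lemma fourDimRelations (hξ : IsPrimitiveRoot ξ 4) (r : k) :
    DoubleRelations ξ r (R := Matrix (Fin 4) (Fin 4) k)
      !![1, 0, 0, 0; 0, -ξ, 0, 0; 0, 0, ξ, 0; 0, 0, 0, 1]
      !![0, 0, 0, 0; 0, 0, 0, 0; -1, 0, 0, 0; 0, ξ, 0, 0]
      !![1, 0, 0, 0; 0, -1, 0, 0; 0, 0, -1, 0; 0, 0, 0, 1]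
      !![0, 0, 0, 0; 1, 0, 0, 0; r, 0, 0, 0; 0, -r, 1, 0] := by
  have h2 := xi_sq hξ
  constructor <;> ext i j <;> fin_cases i <;> fin_cases j <;>
    simp [Matrix.mul_apply, Fin.sum_univ_four] <;> grind

end HopfK
end

/-! ### The family of representations and its uniqueness. -/

noncomputable section

namespace HopfK

open Coalgebra DoubleCop

variable {k : Type u} [Field k] [CharZero k] {ξ : k} (hξ : IsPrimitiveRoot ξ 4)
  {r : k} (hr : r ^ 2 = 2)

/-- The character `χ^ℓ` of the double. -/
def character (ℓ : ZMod 4) : D hξ →ₐ[k] k :=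
  D.lift hξ hr (charRelations ξ r (rootPow_pow_four hξ ℓ))

/-- The representation `V_{i,j}` of the double. -/
def twoDim (i j : ZMod 4) : D hξ →ₐ[k] Module.End k (Fin 2 → k) :=
  D.lift hξ hr ((twoDimRelations hξ hr (rootPow_pow_four hξ i) (rootPow_pow_four hξ j)).map
    (Matrix.toLinAlgEquiv' (R := k) (n := Fin 2)).toAlgHom)

/-- The representation `P` of the double. -/
def fourDim : D hξ →ₐ[k] Module.End k (Fin 4 → k) :=
  D.lift hξ hr ((fourDimRelations hξ r).map (Matrix.toLinAlgEquiv' (R := k) (n := Fin 4)).toAlgHom)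

/-- The representation `P ⊗ k_{χ^ℓ}` of the double, on the underlying space of `P`. -/
def fourDimTwist (ℓ : ZMod 4) : D hξ →ₐ[k] Module.End k (Fin 4 → k) :=
  D.lift hξ hr (((fourDimRelations hξ r).map
    (Matrix.toLinAlgEquiv' (R := k) (n := Fin 4)).toAlgHom).twist (rootPow_pow_four hξ ℓ))

omit [CharZero k] in
lemma toLinAlgEquiv'_toAlgHom {n : ℕ} (B : Matrix (Fin n) (Fin n) k) :
    (Matrix.toLinAlgEquiv' (R := k) (n := Fin n)).toAlgHom B = Matrix.toLin' B := rfl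

lemma character_actsBy (ℓ : ZMod 4) : ActsBy hξ r (character hξ hr ℓ)
    (rootPow ξ ℓ) 0 0 (rootPow ξ (-ℓ)) 0 ((-1) ^ ℓ.val) := by
  have h := D.lift_actsBy hξ hr (charRelations ξ r (rootPow_pow_four hξ ℓ))
  refine ⟨h.map_a, ?_, h.map_c, ?_, h.map_x, ?_⟩
  · rw [character, h.map_b]; simp
  · rw [character, h.map_d, rootPow_neg hξ]; ring
  · rw [character, h.map_g, rootPow_sq hξ]

lemma twoDim_actsBy (i j : ZMod 4) : ActsBy hξ r (twoDim hξ hr i j)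
    (Matrix.toLin' !![rootPow ξ i, 0; 0, rootPow ξ (i + 3)])
    (Matrix.toLin' !![0, (-1) ^ i.val; 0, 0])
    (Matrix.toLin' !![0, 1; 0, 0])
    (Matrix.toLin' !![rootPow ξ (-i), 0; 0, rootPow ξ (-i + 1)])
    (Matrix.toLin' !![0, r / 2 * ξ * (rootPow ξ i + rootPow ξ (3 * i + j));
      r * ξ * (rootPow ξ (3 * i) - rootPow ξ (i + j)), 0])
    (Matrix.toLin' !![rootPow ξ j, 0; 0, rootPow ξ (j + 2)]) := by
  have h := D.lift_actsBy hξ hr ((twoDimRelations hξ hr (rootPow_pow_four hξ i)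
    (rootPow_pow_four hξ j)).map (Matrix.toLinAlgEquiv' (R := k) (n := Fin 2)).toAlgHom)
  have h2 := xi_sq hξ
  rw [rootPow_add hξ i 3, rootPow_three hξ, rootPow_neg hξ, rootPow_add hξ (-i), rootPow_neg hξ,
    rootPow_one, rootPow_add hξ (3 * i), rootPow_mul_three hξ, rootPow_add hξ i j,
    rootPow_add hξ j 2, rootPow_two hξ, ← rootPow_sq hξ]
  simp only [← map_mul] at h
  simp only [toLinAlgEquiv'_toAlgHom] at h
  have hs := rootPow_pow_four hξ i
  refine ⟨?_, ?_, h.map_c, ?_, h.map_x, ?_⟩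
  · exact h.map_a.trans (congrArg _ (by rw [mul_comm]))
  · refine h.map_b.trans (congrArg _ ?_)
    simp [pow_two]
  · refine h.map_d.trans (congrArg _ ?_)
    ext i j; fin_cases i <;> fin_cases j <;> simp <;> grind
  · exact h.map_g.trans (congrArg _ (by rw [mul_neg_one]))

lemma fourDim_actsBy : ActsBy hξ r (fourDim hξ hr)
    (Matrix.toLin' !![1, 0, 0, 0; 0, -ξ, 0, 0; 0, 0, ξ, 0; 0, 0, 0, 1])
    (Matrix.toLin' !![0, 0, 0, 0; 0, 0, 0, 0; 1, 0, 0, 0; 0, ξ, 0, 0])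
    (Matrix.toLin' !![0, 0, 0, 0; 0, 0, 0, 0; -1, 0, 0, 0; 0, ξ, 0, 0])
    (Matrix.toLin' !![1, 0, 0, 0; 0, ξ, 0, 0; 0, 0, -ξ, 0; 0, 0, 0, 1])
    (Matrix.toLin' !![0, 0, 0, 0; 1, 0, 0, 0; r, 0, 0, 0; 0, -r, 1, 0])
    (Matrix.toLin' !![1, 0, 0, 0; 0, -1, 0, 0; 0, 0, -1, 0; 0, 0, 0, 1]) := by
  have h := D.lift_actsBy hξ hr ((fourDimRelations hξ r).map
    (Matrix.toLinAlgEquiv' (R := k) (n := Fin 4)).toAlgHom)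
  have h2 := xi_sq hξ
  simp only [← map_mul] at h
  simp only [toLinAlgEquiv'_toAlgHom] at h
  refine ⟨h.map_a, ?_, h.map_c, ?_, h.map_x, h.map_g⟩
  · refine h.map_b.trans (congrArg _ ?_)
    ext i j; fin_cases i <;> fin_cases j <;> simp <;> grind
  · refine h.map_d.trans (congrArg _ ?_)
    ext i j; fin_cases i <;> fin_cases j <;> simp <;> grind

/-- The family of representations of the double. -/
def repFamily : RepFamily hξ r where
  χ := character hξ hr
  V t := twoDim hξ hr t.1.1 t.1.2
  P := fourDim hξ hr
  PT ℓ := ((TensorProduct.rid k (Fin 4 → k)).symm.conjAlgEquiv k).toAlgHom.comp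
    (fourDimTwist hξ hr ℓ)
  χ_acts := character_actsBy hξ hr
  V_acts i j _ := twoDim_actsBy hξ hr i j
  P_acts := fourDim_actsBy hξ hr
  PT_apply ℓ Y := by
    refine TensorProduct.ext' fun v s => ?_
    have := tensorAct_lift hξ hr ((fourDimRelations hξ r).map
      (Matrix.toLinAlgEquiv' (R := k) (n := Fin 4)).toAlgHom) (rootPow_pow_four hξ ℓ)
      (rootPow_sq hξ ℓ) Y (s • v)
    -- The scalar is moved to the left factor, so that the right factor is 1 as in `tensorAct_lift`.
    rw [← mul_one s, ← smul_eq_mul, ← TensorProduct.smul_tmul]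
    refine Eq.trans ?_ this.symm
    simp [fourDimTwist, TensorProduct.smul_tmul']

/-- The representations χ, V and P are fixed by their values on generators of D, and the tensor
products are then fixed by `PT_apply`. -/
lemma repFamily_unique (M : RepFamily hξ r) : M = repFamily hξ hr := by
  have hχ : M.χ = (repFamily hξ hr).χ :=
    funext fun ℓ => D.algHom_ext hξ hr (M.χ_acts ℓ) ((repFamily hξ hr).χ_acts ℓ)
  have hV : M.V = (repFamily hξ hr).V := funext fun t =>
    D.algHom_ext hξ hr (M.V_acts t.1.1 t.1.2 t.2) ((repFamily hξ hr).V_acts t.1.1 t.1.2 t.2)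
  have hP : M.P = (repFamily hξ hr).P :=
    D.algHom_ext hξ hr M.P_acts (repFamily hξ hr).P_acts
  have hPT : M.PT = (repFamily hξ hr).PT := by
    funext ℓ
    ext1 Y
    rw [M.PT_apply, (repFamily hξ hr).PT_apply, hχ, hP]
  generalize repFamily hξ hr = M' at *
  cases M; cases M'
  simp only at hχ hV hP hPT
  subst hχ hV hP hPT
  rfl

section action

variable {hξ hr}

lemma twoDim_a (i j : ZMod 4) (v : Fin 2 → k) : twoDim hξ hr i j (D.ofK (a hξ)) v =
    ![rootPow ξ i * v 0, rootPow ξ (i + 3) * v 1] := by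
  rw [(twoDim_actsBy hξ hr i j).map_a]; ext n; fin_cases n <;> simp [Matrix.vecHead, Matrix.vecTail]

lemma twoDim_g (i j : ZMod 4) (v : Fin 2 → k) : twoDim hξ hr i j (D.ofDual (gFun hξ)) v =
    ![rootPow ξ j * v 0, rootPow ξ (j + 2) * v 1] := by
  rw [(twoDim_actsBy hξ hr i j).map_g]; ext n; fin_cases n <;> simp [Matrix.vecHead, Matrix.vecTail]

lemma twoDim_c (i j : ZMod 4) (v : Fin 2 → k) : twoDim hξ hr i j (D.ofK (c hξ)) v =
    ![v 1, 0] := by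
  rw [(twoDim_actsBy hξ hr i j).map_c]; ext n; fin_cases n <;> simp [Matrix.vecHead, Matrix.vecTail]

lemma twoDim_x (i j : ZMod 4) (v : Fin 2 → k) : twoDim hξ hr i j (D.ofDual (xFun hξ r)) v =
    ![r / 2 * ξ * (rootPow ξ i + rootPow ξ (3 * i + j)) * v 1,
      r * ξ * (rootPow ξ (3 * i) - rootPow ξ (i + j)) * v 0] := by
  rw [(twoDim_actsBy hξ hr i j).map_x]; ext n; fin_cases n <;> simp [Matrix.vecHead, Matrix.vecTail]

lemma fourDimTwist_a (ℓ : ZMod 4) (v : Fin 4 → k) : fourDimTwist hξ hr ℓ (D.ofK (a hξ)) v =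
    rootPow ξ ℓ • ![v 0, -ξ * v 1, ξ * v 2, v 3] := by
  rw [fourDimTwist, (D.lift_actsBy hξ hr _).map_a, toLinAlgEquiv'_toAlgHom]
  ext n; fin_cases n <;> simp [Matrix.vecHead, Matrix.vecTail]

lemma fourDimTwist_c (ℓ : ZMod 4) (v : Fin 4 → k) : fourDimTwist hξ hr ℓ (D.ofK (c hξ)) v =
    rootPow ξ ℓ ^ 3 • ![0, 0, -v 0, ξ * v 1] := by
  rw [fourDimTwist, (D.lift_actsBy hξ hr _).map_c, toLinAlgEquiv'_toAlgHom]
  ext n; fin_cases n <;> simp [Matrix.vecHead, Matrix.vecTail]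

lemma fourDimTwist_g (ℓ : ZMod 4) (v : Fin 4 → k) :
    fourDimTwist hξ hr ℓ (D.ofDual (gFun hξ)) v =
      rootPow ξ ℓ ^ 2 • ![v 0, -v 1, -v 2, v 3] := by
  rw [fourDimTwist, (D.lift_actsBy hξ hr _).map_g, toLinAlgEquiv'_toAlgHom]
  ext n; fin_cases n <;> simp [Matrix.vecHead, Matrix.vecTail]

lemma fourDimTwist_x (ℓ : ZMod 4) (v : Fin 4 → k) :
    fourDimTwist hξ hr ℓ (D.ofDual (xFun hξ r)) v =
      ![0, v 0, r * v 0, -r * v 1 + v 2] := by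
  rw [fourDimTwist, (D.lift_actsBy hξ hr _).map_x, toLinAlgEquiv'_toAlgHom]
  ext n; fin_cases n <;> simp [Matrix.vecHead, Matrix.vecTail]

end action

end HopfK
end

/-! ### Weights, simplicity of the small modules and locality of the four-dimensional ones. -/

noncomputable section

namespace HopfK

open Coalgebra DoubleCop

variable {k : Type u} [Field k] [CharZero k] {ξ : k} {hξ : IsPrimitiveRoot ξ 4}
  {r : k} {hr : r ^ 2 = 2}

section weight

omit [CharZero k] in
lemma map_idem {R : Type v} {R' : Type w} [Ring R] [Algebra k R] [Ring R'] [Algebra k R']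
    (φ : R →ₐ[k] R') (G : R) (n : ℕ) : φ (idem ξ G n) = idem ξ (φ G) n := by
  simp [idem]

variable {M : Type w} [AddCommGroup M] [Module k M]

/-- The scalar is a quarter of 1 + ζ + ζ² + ζ³ with ζ = ξ^{m-i}, a sum equal to 4 or 0. The sign in
the index reflects that `idem ξ B n` belongs to the eigenvalue ξ⁻ⁿ. -/
lemma idem_apply (hξ : IsPrimitiveRoot ξ 4) {B : Module.End k M} {v : M} {m : ZMod 4}
    (hv : B v = rootPow ξ m • v) (i : ZMod 4) :
    idem ξ B (-i).val v = if m = i then v else 0 := by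
  have e : idem ξ B (-i).val v = ((4 : k)⁻¹ * (1 + rootPow ξ (m - i) + rootPow ξ (m - i) ^ 2 +
      rootPow ξ (m - i) ^ 3)) • v := by
    have p : rootPow ξ (m - i) = ξ ^ (-i).val * rootPow ξ m := by
      rw [sub_eq_neg_add, rootPow_add hξ]; rfl
    simp only [idem, p, LinearMap.smul_apply, LinearMap.add_apply, Module.End.one_apply,
      Module.End.mul_apply, hv, map_smul]
    module
  rw [e]
  split_ifs with h
  · rw [h, sub_self, rootPow_zero]; norm_num
  · have h1 : rootPow ξ (m - i) ≠ 1 := by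
      rw [← rootPow_zero (ξ := ξ)]
      exact fun hh => h (sub_eq_zero.1 (rootPow_injective hξ hh))
    have h4 := rootPow_pow_four hξ (m - i)
    have : (rootPow ξ (m - i) - 1) * (1 + rootPow ξ (m - i) + rootPow ξ (m - i) ^ 2 +
      rootPow ξ (m - i) ^ 3) = 0 := by linear_combination h4
    rw [(mul_eq_zero.1 this).resolve_left (sub_ne_zero.2 h1), mul_zero, zero_smul]

variable (hξ) in
/-- The projection onto the vectors on which `a` acts by `ξⁱ` and `g` by `ξʲ`. -/
def weightProj (i j : ZMod 4) : D hξ :=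
  idem ξ (D.ofK (a hξ)) (-i).val * idem ξ (D.ofDual (gFun hξ)) (-j).val

lemma weightProj_apply {ρ : D hξ →ₐ[k] Module.End k M} {v : M} {m n : ZMod 4}
    (ha : ρ (D.ofK (a hξ)) v = rootPow ξ m • v)
    (hg : ρ (D.ofDual (gFun hξ)) v = rootPow ξ n • v) (i j : ZMod 4) :
    ρ (weightProj hξ i j) v = if m = i ∧ n = j then v else 0 := by
  rw [weightProj, map_mul, map_idem, map_idem, Module.End.mul_apply, idem_apply hξ hg]
  by_cases h : n = j
  · simp [h, idem_apply hξ ha]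
  · simp [h]

end weight

section repModule

omit [CharZero k] in
lemma repModule_algebraMap_smul {M : Type w} [AddCommGroup M] [Module k M]
    (ρ : D hξ →ₐ[k] Module.End k M) (s : k) (v : M) :
    algebraMap k (D hξ) s • RepModule.of ρ v = RepModule.of ρ (s • v) := by
  rw [RepModule.smul_def, AlgHom.commutes, Module.algebraMap_end_apply]

/-- An equivalence of representations, as an equivalence of modules. -/
def repEquiv {M : Type v} {N : Type w} [AddCommGroup M] [Module k M] [AddCommGroup N] [Module k N]
    (ρ : D hξ →ₐ[k] Module.End k M) (σ : D hξ →ₐ[k] Module.End k N) (e : M ≃ₗ[k] N)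
    (h : ∀ Y m, e (ρ Y m) = σ Y (e m)) : RepModule ρ ≃ₗ[D hξ] RepModule σ :=
  { (RepModule.of ρ).symm.trans (e.toAddEquiv.trans (RepModule.of σ)) with
    map_smul' := fun Y m => h Y ((RepModule.of ρ).symm m) }

/-- A linear map that commutes with the action of the generators, as a map of modules. -/
def repHom (hr : r ^ 2 = 2) {M : Type v} {N : Type w} [AddCommGroup M] [Module k M]
    [AddCommGroup N] [Module k N]
    (ρ : D hξ →ₐ[k] Module.End k M) (σ : D hξ →ₐ[k] Module.End k N) (f : M →ₗ[k] N)
    (ha : ∀ m, f (ρ (D.ofK (a hξ)) m) = σ (D.ofK (a hξ)) (f m))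
    (hc : ∀ m, f (ρ (D.ofK (c hξ)) m) = σ (D.ofK (c hξ)) (f m))
    (hg : ∀ m, f (ρ (D.ofDual (gFun hξ)) m) = σ (D.ofDual (gFun hξ)) (f m))
    (hx : ∀ m, f (ρ (D.ofDual (xFun hξ r)) m) = σ (D.ofDual (xFun hξ r)) (f m)) :
    RepModule ρ →ₗ[D hξ] RepModule σ :=
  { (RepModule.of σ).toAddMonoidHom.comp
      (f.toAddMonoidHom.comp (RepModule.of ρ).symm.toAddMonoidHom) with
    map_smul' := fun Y m => by
      let S : Subalgebra k (D hξ) :=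
        { carrier := {Y | ∀ m, f (ρ Y m) = σ Y (f m)}
          mul_mem' := fun {Y Z} hY hZ m => by
            simp only [Set.mem_ofPred_eq] at hY hZ
            rw [map_mul, map_mul, Module.End.mul_apply, Module.End.mul_apply, hY, hZ]
          add_mem' := fun {Y Z} hY hZ m => by
            simp only [Set.mem_ofPred_eq] at hY hZ
            rw [map_add, map_add, LinearMap.add_apply, LinearMap.add_apply, map_add, hY, hZ]
          algebraMap_mem' := fun s m => by simp [AlgHom.commutes, Module.algebraMap_end_apply] }
      have hS : S = ⊤ := D.subalgebra_eq_top hξ hr ha hc hg hx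
      have hY : Y ∈ S := by rw [hS]; trivial
      exact hY ((RepModule.of ρ).symm m) }

end repModule

section modules

lemma sqrt_two_ne_zero (hr : r ^ 2 = 2) : r ≠ 0 := by
  rintro rfl; norm_num at hr

variable (hξ hr)

/-- The module `V_{i,j}`. -/
abbrev TwoDim (i j : ZMod 4) : Type u := RepModule (twoDim hξ hr i j)

/-- The module `P ⊗ k_{χ^ℓ}`, on the underlying space of `P`. -/
abbrev FourDim (ℓ : ZMod 4) : Type u := RepModule (fourDimTwist hξ hr ℓ)

/-- The module `k_{χ^ℓ}`. -/
abbrev OneDim (ℓ : ZMod 4) : Type u := RepModule (charRep (character hξ hr ℓ))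

/-- The first basis vector of `V_{i,j}`. -/
def TwoDim.e₁ (i j : ZMod 4) : TwoDim hξ hr i j := RepModule.of _ ![1, 0]

/-- The second basis vector of `V_{i,j}`. -/
def TwoDim.e₂ (i j : ZMod 4) : TwoDim hξ hr i j := RepModule.of _ ![0, 1]

/-- The first basis vector of `P ⊗ k_{χ^ℓ}`. -/
def FourDim.p₁ (ℓ : ZMod 4) : FourDim hξ hr ℓ := RepModule.of _ ![1, 0, 0, 0]

variable {hξ hr}

/-- The lower left entry of x is nonzero exactly when 3i ≠ i + j, which is the condition defining Λ;
then x carries e₁ to a nonzero multiple of e₂. -/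
lemma TwoDim.exists_smul {i j : ZMod 4} (h : 2 * i ≠ j) (y : TwoDim hξ hr i j) :
    ∃ Y : D hξ, Y • TwoDim.e₁ hξ hr i j = y := by
  obtain ⟨v, rfl⟩ := (RepModule.of (twoDim hξ hr i j)).surjective y
  have hκ : r * ξ * (rootPow ξ (3 * i) - rootPow ξ (i + j)) ≠ 0 := by
    refine mul_ne_zero (mul_ne_zero (sqrt_two_ne_zero hr) (hξ.ne_zero (by norm_num)))
      (sub_ne_zero.2 fun e => h ?_)
    have := rootPow_injective hξ e
    linear_combination this
  set κ := r * ξ * (rootPow ξ (3 * i) - rootPow ξ (i + j)) with hκ'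
  refine ⟨algebraMap k _ (v 0) + (v 1 / κ) • D.ofDual (xFun hξ r), ?_⟩
  rw [TwoDim.e₁, RepModule.smul_def]
  congr 1
  rw [map_add, map_smul, AlgHom.commutes, LinearMap.add_apply, LinearMap.smul_apply, twoDim_x,
    ← hκ']
  ext n
  fin_cases n
  · simp
  · simp [hκ]

lemma TwoDim.weightProj_e₁ (i j m n : ZMod 4) : weightProj hξ m n • TwoDim.e₁ hξ hr i j =
    if i = m ∧ j = n then TwoDim.e₁ hξ hr i j else 0 := by
  have := weightProj_apply (ρ := twoDim hξ hr i j) (v := ![1, 0]) (m := i) (n := j)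
    (by rw [twoDim_a]; ext n; fin_cases n <;> simp)
    (by rw [twoDim_g]; ext n; fin_cases n <;> simp) m n
  rw [TwoDim.e₁, RepModule.smul_def, this]
  split_ifs <;> rfl

lemma TwoDim.weightProj_e₂ (i j m n : ZMod 4) : weightProj hξ m n • TwoDim.e₂ hξ hr i j =
    if i + 3 = m ∧ j + 2 = n then TwoDim.e₂ hξ hr i j else 0 := by
  have := weightProj_apply (ρ := twoDim hξ hr i j) (v := ![0, 1]) (m := i + 3) (n := j + 2)
    (by rw [twoDim_a]; ext n; fin_cases n <;> simp)
    (by rw [twoDim_g]; ext n; fin_cases n <;> simp) m n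
  rw [TwoDim.e₂, RepModule.smul_def, this]
  split_ifs <;> rfl

lemma TwoDim.c_smul (i j : ZMod 4) (v : Fin 2 → k) :
    D.ofK (c hξ) • RepModule.of (twoDim hξ hr i j) v =
      algebraMap k (D hξ) (v 1) • TwoDim.e₁ hξ hr i j := by
  rw [TwoDim.e₁, repModule_algebraMap_smul, RepModule.smul_def, twoDim_c]
  congr 1
  ext n; fin_cases n <;> simp

lemma TwoDim.c_smul_e₁ (i j : ZMod 4) : D.ofK (c hξ) • TwoDim.e₁ hξ hr i j = 0 := by
  rw [TwoDim.e₁, TwoDim.c_smul]; simp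

lemma TwoDim.c_smul_e₂ (i j : ZMod 4) :
    D.ofK (c hξ) • TwoDim.e₂ hξ hr i j = TwoDim.e₁ hξ hr i j := by
  rw [TwoDim.e₂, TwoDim.c_smul]; simp

lemma TwoDim.e₁_ne_zero (i j : ZMod 4) : TwoDim.e₁ hξ hr i j ≠ 0 := fun h => by
  have h' : (![1, 0] : Fin 2 → k) = 0 := h
  simpa using congrFun h' 0

/-- A vector of `V_{i,j}` that is killed by `c` is a multiple of the first basis vector. -/
lemma TwoDim.eq_smul_of_c_smul_eq_zero {i j : ZMod 4} {y : TwoDim hξ hr i j}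
    (hy : D.ofK (c hξ) • y = 0) : ∃ s : k, y = algebraMap k (D hξ) s • TwoDim.e₁ hξ hr i j := by
  obtain ⟨v, rfl⟩ := (RepModule.of (twoDim hξ hr i j)).surjective y
  rw [RepModule.smul_def, twoDim_c] at hy
  have h1 : ![v 1, 0] = 0 := hy
  have h0 : v 1 = 0 := by simpa using congrFun h1 0
  refine ⟨v 0, ?_⟩
  rw [TwoDim.e₁, repModule_algebraMap_smul]
  congr 1
  ext n; fin_cases n <;> simp [h0]

/-- Any nonzero vector leads to e₁: either c maps it to a nonzero multiple of e₁, or it already is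
one. And e₁ generates. -/
lemma TwoDim.isSimpleModule {i j : ZMod 4} (h : 2 * i ≠ j) :
    IsSimpleModule (D hξ) (TwoDim hξ hr i j) := by
  rw [isSimpleModule_iff_toSpanSingleton_surjective]
  refine ⟨⟨_, _, TwoDim.e₁_ne_zero i j⟩, fun y hy z => ?_⟩
  suffices ∃ Y : D hξ, Y • y = TwoDim.e₁ hξ hr i j by
    obtain ⟨Y, hY⟩ := this
    obtain ⟨Z, hZ⟩ := TwoDim.exists_smul h z
    exact ⟨Z * Y, by rw [LinearMap.toSpanSingleton_apply, mul_smul, hY, hZ]⟩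
  by_cases hc : D.ofK (c hξ) • y = 0
  · obtain ⟨s, rfl⟩ := TwoDim.eq_smul_of_c_smul_eq_zero hc
    have hs : s ≠ 0 := by rintro rfl; simp at hy
    exact ⟨algebraMap k _ s⁻¹, by rw [← mul_smul, ← map_mul, inv_mul_cancel₀ hs, map_one, one_smul]⟩
  · obtain ⟨v, rfl⟩ := (RepModule.of (twoDim hξ hr i j)).surjective y
    rw [TwoDim.c_smul] at hc
    have hs : v 1 ≠ 0 := by intro h; simp [h] at hc
    exact ⟨algebraMap k _ (v 1)⁻¹ * D.ofK (c hξ), by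
      rw [mul_smul, TwoDim.c_smul, ← mul_smul, ← map_mul, inv_mul_cancel₀ hs, map_one, one_smul]⟩

lemma OneDim.isSimpleModule (ℓ : ZMod 4) : IsSimpleModule (D hξ) (OneDim hξ hr ℓ) := by
  rw [isSimpleModule_iff_toSpanSingleton_surjective]
  refine ⟨inferInstanceAs (Nontrivial k), fun y hy z => ?_⟩
  obtain ⟨s, rfl⟩ := (RepModule.of (charRep (character hξ hr ℓ))).surjective y
  obtain ⟨t, rfl⟩ := (RepModule.of (charRep (character hξ hr ℓ))).surjective z
  have hs : s ≠ 0 := by rintro rfl; simp at hy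
  refine ⟨algebraMap k _ (t / s), ?_⟩
  rw [LinearMap.toSpanSingleton_apply, repModule_algebraMap_smul, smul_eq_mul,
    div_mul_cancel₀ _ hs]

lemma OneDim.c_smul (ℓ : ZMod 4) (y : OneDim hξ hr ℓ) : D.ofK (c hξ) • y = 0 := by
  change character hξ hr ℓ (D.ofK (c hξ)) * (RepModule.of _).symm y = 0
  rw [(character_actsBy hξ hr ℓ).map_c, zero_mul]

lemma OneDim.weightProj_smul (ℓ m n : ZMod 4) (y : OneDim hξ hr ℓ) : weightProj hξ m n • y =
    if ℓ = m ∧ 2 * ℓ = n then y else 0 := by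
  obtain ⟨s, rfl⟩ := (RepModule.of (charRep (character hξ hr ℓ))).surjective y
  have := weightProj_apply (ρ := charRep (character hξ hr ℓ)) (v := s) (m := ℓ) (n := 2 * ℓ)
    (by
      change character hξ hr ℓ _ * s = _
      rw [(character_actsBy hξ hr ℓ).map_a, smul_eq_mul])
    (by
      change character hξ hr ℓ _ * s = _
      rw [(character_actsBy hξ hr ℓ).map_g, smul_eq_mul, two_mul, rootPow_add hξ, ← pow_two,
        rootPow_sq hξ]) m n
  rw [RepModule.smul_def, this]
  split_ifs <;> rfl

lemma FourDim.exists_smul {ℓ : ZMod 4} (y : FourDim hξ hr ℓ) :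
    ∃ Y : D hξ, Y • FourDim.p₁ hξ hr ℓ = y := by
  obtain ⟨v, rfl⟩ := (RepModule.of (fourDimTwist hξ hr ℓ)).surjective y
  have h4 := rootPow_pow_four hξ ℓ
  -- With s = ξ^ℓ one has x p₁ = p₂ + r p₃, c p₁ = -s³ p₃ and x c p₁ = -s³ p₄; the coefficients
  -- solve for v using s⁴ = 1.
  refine ⟨algebraMap k _ (v 0) + v 1 • D.ofDual (xFun hξ r) +
    ((r * v 1 - v 2) * rootPow ξ ℓ) • D.ofK (c hξ) -
    (v 3 * rootPow ξ ℓ) • (D.ofDual (xFun hξ r) * D.ofK (c hξ)), ?_⟩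
  rw [FourDim.p₁, RepModule.smul_def]
  congr 1
  simp only [map_add, map_sub, map_smul, map_mul, AlgHom.commutes, LinearMap.add_apply,
    LinearMap.sub_apply, LinearMap.smul_apply, Module.End.mul_apply, fourDimTwist_x, fourDimTwist_c]
  ext n
  fin_cases n <;> simp <;> grind

lemma FourDim.weightProj_p₁ (ℓ m n : ZMod 4) : weightProj hξ m n • FourDim.p₁ hξ hr ℓ =
    if ℓ = m ∧ 2 * ℓ = n then FourDim.p₁ hξ hr ℓ else 0 := by
  have := weightProj_apply (ρ := fourDimTwist hξ hr ℓ) (v := ![1, 0, 0, 0]) (m := ℓ) (n := 2 * ℓ)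
    (by rw [fourDimTwist_a]; ext n; fin_cases n <;> simp)
    (by
      rw [fourDimTwist_g, two_mul, rootPow_add hξ, ← pow_two]
      ext n; fin_cases n <;> simp) m n
  rw [FourDim.p₁, RepModule.smul_def, this]
  split_ifs <;> rfl

/-- Both p₁ and p₄ have weight (ℓ, 2ℓ), whereas p₂ and p₃ have weights (ℓ+3, 2ℓ+2) and (ℓ+1, 2ℓ+2).
-/
lemma FourDim.weightProj_smul (ℓ : ZMod 4) (v : Fin 4 → k) :
    weightProj hξ ℓ (2 * ℓ) • RepModule.of (fourDimTwist hξ hr ℓ) v =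
      RepModule.of (fourDimTwist hξ hr ℓ) ![v 0, 0, 0, v 3] := by
  have hg2 : rootPow ξ (2 * ℓ) = rootPow ξ ℓ ^ 2 := by
    rw [two_mul, rootPow_add hξ, ← pow_two]
  have h0 := weightProj_apply (ρ := fourDimTwist hξ hr ℓ) (v := ![v 0, 0, 0, v 3]) (m := ℓ)
    (n := 2 * ℓ)
    (by rw [fourDimTwist_a]; ext n; fin_cases n <;> simp)
    (by rw [fourDimTwist_g, hg2]; ext n; fin_cases n <;> simp) ℓ (2 * ℓ)
  have h1 := weightProj_apply (ρ := fourDimTwist hξ hr ℓ) (v := ![0, v 1, 0, 0]) (m := ℓ + 3)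
    (n := 2 * ℓ + 2)
    (by
      rw [fourDimTwist_a, rootPow_add hξ, rootPow_three hξ]
      ext n; fin_cases n <;> simp [mul_assoc])
    (by
      rw [fourDimTwist_g, rootPow_add hξ, rootPow_two hξ, hg2]
      ext n; fin_cases n <;> simp) ℓ (2 * ℓ)
  have h2 := weightProj_apply (ρ := fourDimTwist hξ hr ℓ) (v := ![0, 0, v 2, 0]) (m := ℓ + 1)
    (n := 2 * ℓ + 2)
    (by
      rw [fourDimTwist_a, rootPow_add hξ, rootPow_one]
      ext n; fin_cases n <;> simp [mul_assoc])
    (by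
      rw [fourDimTwist_g, rootPow_add hξ, rootPow_two hξ, hg2]
      ext n; fin_cases n <;> simp) ℓ (2 * ℓ)
  rw [if_pos ⟨rfl, rfl⟩] at h0
  rw [if_neg fun h => absurd (add_eq_left.1 h.1) (by decide)] at h1 h2
  rw [RepModule.smul_def]
  congr 1
  have e : v = ![v 0, 0, 0, v 3] + ![0, v 1, 0, 0] + ![0, 0, v 2, 0] := by
    ext n; fin_cases n <;> simp
  conv_lhs => rw [e]
  rw [map_add, map_add, h0, h1, h2, add_zero, add_zero]

/-- This gives locality: the weight projection reduces v to its p₁ and p₄ components, and x c yields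
a nonzero multiple of p₄, with which the second component is cancelled. So N contains the generator
p₁. -/
lemma FourDim.eq_top_of_mem {ℓ : ZMod 4} {N : Submodule (D hξ) (FourDim hξ hr ℓ)} {v : Fin 4 → k}
    (hv : RepModule.of (fourDimTwist hξ hr ℓ) v ∈ N) (h0 : v 0 ≠ 0) : N = ⊤ := by
  have m1 := N.smul_mem (weightProj hξ ℓ (2 * ℓ)) hv
  rw [FourDim.weightProj_smul] at m1
  have m2 := N.smul_mem (D.ofDual (xFun hξ r)) (N.smul_mem (D.ofK (c hξ)) m1)
  -- After the weight projection, x c gives -v₀ s³ p₄ with s = ξ^ℓ; the second coefficient makes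
  -- this cancel (v₃/v₀) p₄, as s⁴ = 1.
  have m3 := N.add_mem (N.smul_mem (algebraMap k _ (v 0)⁻¹) m1)
    (N.smul_mem (algebraMap k _ (v 3 * (v 0)⁻¹ * (v 0)⁻¹ * rootPow ξ ℓ)) m2)
  have h4 := rootPow_pow_four hξ ℓ
  have e : FourDim.p₁ hξ hr ℓ ∈ N := by
    convert m3
    simp only [RepModule.smul_def, FourDim.p₁, ← map_add, AlgHom.commutes,
      Module.algebraMap_end_apply, fourDimTwist_c, fourDimTwist_x]
    congr 1
    ext n
    fin_cases n <;> simp [h0]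
    field_simp
    linear_combination v 3 * h4
  rw [eq_top_iff]
  intro y _
  obtain ⟨Y, rfl⟩ := FourDim.exists_smul y
  exact N.smul_mem Y e

variable (hξ hr) in
/-- The projection from `P ⊗ k_{χ^ℓ}` onto `k_{χ^ℓ}`. -/
def FourDim.π (ℓ : ZMod 4) : FourDim hξ hr ℓ →ₗ[D hξ] OneDim hξ hr ℓ :=
  repHom hr (fourDimTwist hξ hr ℓ) (charRep (character hξ hr ℓ)) (LinearMap.proj 0)
    (fun m => by
      change _ = character hξ hr ℓ _ * m 0
      rw [(character_actsBy hξ hr ℓ).map_a, fourDimTwist_a]; simp)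
    (fun m => by
      change _ = character hξ hr ℓ _ * m 0
      rw [(character_actsBy hξ hr ℓ).map_c, fourDimTwist_c]; simp)
    (fun m => by
      change _ = character hξ hr ℓ _ * m 0
      rw [(character_actsBy hξ hr ℓ).map_g, fourDimTwist_g, ← rootPow_sq hξ]; simp)
    (fun m => by
      change _ = character hξ hr ℓ _ * m 0
      rw [(character_actsBy hξ hr ℓ).map_x, fourDimTwist_x]; simp)

lemma FourDim.π_of (ℓ : ZMod 4) (v : Fin 4 → k) :
    FourDim.π hξ hr ℓ (RepModule.of _ v) = RepModule.of (charRep (character hξ hr ℓ)) (v 0) := rfl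

lemma FourDim.π_surjective (ℓ : ZMod 4) : Function.Surjective (FourDim.π hξ hr ℓ) :=
  fun y => ⟨RepModule.of _ ![(RepModule.of _).symm y, 0, 0, 0], rfl⟩

/-- Every proper submodule of `P ⊗ k_{χ^ℓ}` lies in the kernel of the projection onto
`k_{χ^ℓ}`. -/
lemma FourDim.le_ker_π {ℓ : ZMod 4} {N : Submodule (D hξ) (FourDim hξ hr ℓ)} (hN : N ≠ ⊤) :
    N ≤ LinearMap.ker (FourDim.π hξ hr ℓ) := by
  intro y hy
  obtain ⟨v, rfl⟩ := (RepModule.of (fourDimTwist hξ hr ℓ)).surjective y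
  by_contra h
  refine hN (FourDim.eq_top_of_mem hy fun h0 => h ?_)
  rw [LinearMap.mem_ker, FourDim.π_of, h0]; rfl

lemma FourDim.ker_π_ne_top (ℓ : ZMod 4) : LinearMap.ker (FourDim.π hξ hr ℓ) ≠ ⊤ := by
  intro h
  rw [LinearMap.ker_eq_top] at h
  obtain ⟨y, hy⟩ := FourDim.π_surjective (hξ := hξ) (hr := hr) ℓ (RepModule.of _ 1)
  rw [h] at hy
  exact zero_ne_one (α := k) hy

lemma FourDim.eq_top_of_sup_ker_π {ℓ : ZMod 4} {N : Submodule (D hξ) (FourDim hξ hr ℓ)}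
    (hN : N ⊔ LinearMap.ker (FourDim.π hξ hr ℓ) = ⊤) : N = ⊤ := by
  by_contra h
  rw [sup_eq_right.2 (FourDim.le_ker_π h)] at hN
  exact FourDim.ker_π_ne_top ℓ hN

end modules

end HopfK
end

/-! ### Decomposition of the regular module. -/

noncomputable section

namespace HopfK

open Coalgebra DoubleCop

variable {k : Type u} [Field k] [CharZero k] {ξ : k} {hξ : IsPrimitiveRoot ξ 4}
  {r : k} {hr : r ^ 2 = 2}

section regular

variable (hξ hr)

/-- The direct sum of the modules `P ⊗ k_{χ^ℓ}` and of two copies of each `V_{i,j}`. -/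
abbrev CoverSum : Type u :=
  (∀ ℓ : ZMod 4, FourDim hξ hr ℓ) × (∀ t : Lam, Fin 2 → TwoDim hξ hr t.1.1 t.1.2)

variable {hξ hr}

/-- The inclusion of `P ⊗ k_{χ^ℓ}` into the direct sum. -/
def CoverSum.inFour (ℓ : ZMod 4) : FourDim hξ hr ℓ →ₗ[D hξ] CoverSum hξ hr :=
  LinearMap.inl _ _ _ ∘ₗ LinearMap.single (D hξ) (fun ℓ => FourDim hξ hr ℓ) ℓ

/-- The inclusions of `V_{i,j}` into the direct sum. -/
def CoverSum.inTwo (t : Lam) (n : Fin 2) : TwoDim hξ hr t.1.1 t.1.2 →ₗ[D hξ] CoverSum hξ hr :=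
  LinearMap.inr _ _ _ ∘ₗ
    LinearMap.single (D hξ) (fun t : Lam => Fin 2 → TwoDim hξ hr t.1.1 t.1.2) t ∘ₗ
      LinearMap.single (D hξ) (fun _ => TwoDim hξ hr t.1.1 t.1.2) n

lemma CoverSum.hom_eq_zero {S : Type w} [AddCommGroup S] [Module (D hξ) S]
    {f : CoverSum hξ hr →ₗ[D hξ] S} (h₁ : ∀ ℓ, f ∘ₗ CoverSum.inFour ℓ = 0)
    (h₂ : ∀ t n, f ∘ₗ CoverSum.inTwo t n = 0) : f = 0 := by
  refine LinearMap.prod_ext ?_ ?_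
  · exact LinearMap.pi_ext' fun ℓ => h₁ ℓ
  · refine LinearMap.pi_ext' fun t => ?_
    exact LinearMap.pi_ext' fun n => h₂ t n

variable (hξ hr) in
/-- A generator of the direct sum. -/
def CoverSum.gen : CoverSum hξ hr :=
  (fun ℓ => FourDim.p₁ hξ hr ℓ, fun t => ![TwoDim.e₁ hξ hr t.1.1 t.1.2, TwoDim.e₂ hξ hr t.1.1 t.1.2])

lemma CoverSum.smul_gen (Y : D hξ) : Y • CoverSum.gen hξ hr =
    ((fun ℓ => Y • FourDim.p₁ hξ hr ℓ, fun t =>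
      ![Y • TwoDim.e₁ hξ hr t.1.1 t.1.2, Y • TwoDim.e₂ hξ hr t.1.1 t.1.2]) : CoverSum hξ hr) :=
  Prod.ext rfl (funext fun _ => funext (Fin.forall_fin_two.2 ⟨rfl, rfl⟩))

lemma CoverSum.weightProj_gen (m n : ZMod 4) : weightProj hξ m n • CoverSum.gen hξ hr =
    ((fun ℓ => if ℓ = m ∧ 2 * ℓ = n then FourDim.p₁ hξ hr ℓ else 0, fun t =>
      ![if t.1.1 = m ∧ t.1.2 = n then TwoDim.e₁ hξ hr t.1.1 t.1.2 else 0,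
        if t.1.1 + 3 = m ∧ t.1.2 + 2 = n then TwoDim.e₂ hξ hr t.1.1 t.1.2 else 0]) : CoverSum hξ hr) := by
  simp only [CoverSum.smul_gen, FourDim.weightProj_p₁, TwoDim.weightProj_e₁, TwoDim.weightProj_e₂]

/-- Choosing e₁ in copy 0 and e₂ in copy 1 gives the two copies of V_{i,j} different weights. Weight
projections then isolate the components up to one coincidence, between e₁ of V_{i,j} in copy 0 and
e₂ of V_{i+1,j+2} in copy 1. -/
lemma CoverSum.eq_top_of_gen_mem {N : Submodule (D hξ) (CoverSum hξ hr)}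
    (hN : CoverSum.gen hξ hr ∈ N) : N = ⊤ := by
  -- Neither basis vector of V_{i,j} has a weight of the form (ℓ, 2ℓ): passing from (i, j) to (i+3,
  -- j+2) changes 2i - j by 4 = 0.
  have four (ℓ) : CoverSum.inFour ℓ (FourDim.p₁ hξ hr ℓ) ∈ N := by
    convert N.smul_mem (weightProj hξ ℓ (2 * ℓ)) hN
    rw [CoverSum.weightProj_gen]
    refine Prod.ext ?_ ?_
    · funext m
      by_cases h : m = ℓ
      · subst h; simp [CoverSum.inFour]
      · simp [CoverSum.inFour, h]
    · funext t i
      have h1 : ¬(t.1.1 = ℓ ∧ t.1.2 = 2 * ℓ) := by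
        rintro ⟨h, h'⟩; exact t.2 (by rw [h, h'])
      have h2 : ¬(t.1.1 + 3 = ℓ ∧ t.1.2 + 2 = 2 * ℓ) := by
        rintro ⟨rfl, h'⟩
        refine t.2 ?_
        have h4 : (4 : ZMod 4) = 0 := by decide
        linear_combination -h' - h4
      fin_cases i <;> simp [CoverSum.inFour, h1, h2]
  -- The weight projection yields e₂ in copy 1 of t together with an e₁ in copy 0 of another V; c
  -- kills the latter and turns the former into e₁.
  have two₁ (t : Lam) : CoverSum.inTwo t 1 (TwoDim.e₁ hξ hr t.1.1 t.1.2) ∈ N := by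
    convert N.smul_mem (D.ofK (c hξ)) (N.smul_mem (weightProj hξ (t.1.1 + 3) (t.1.2 + 2)) hN)
    rw [CoverSum.weightProj_gen]
    refine Prod.ext ?_ ?_
    · funext ℓ
      have h1 : ¬(ℓ = t.1.1 + 3 ∧ 2 * ℓ = t.1.2 + 2) := by
        rintro ⟨rfl, h'⟩
        refine t.2 ?_
        have h4 : (4 : ZMod 4) = 0 := by decide
        linear_combination h' - h4
      simp [CoverSum.inTwo, h1]
    · funext s i
      fin_cases i
      · have : D.ofK (c hξ) • (if s.1.1 = t.1.1 + 3 ∧ s.1.2 = t.1.2 + 2 then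
            TwoDim.e₁ hξ hr s.1.1 s.1.2 else 0) = 0 := by
          split_ifs
          · exact TwoDim.c_smul_e₁ _ _
          · simp
        refine Eq.trans ?_ this.symm
        by_cases h : s = t
        · subst h; simp [CoverSum.inTwo]
        · simp [CoverSum.inTwo, h]
      · by_cases h : s = t
        · subst h
          simp [CoverSum.inTwo, TwoDim.c_smul_e₂]
        · have h1 : ¬(s.1.1 = t.1.1 ∧ s.1.2 = t.1.2) := fun hh =>
            h (Subtype.ext (Prod.ext hh.1 hh.2))
          simp [CoverSum.inTwo, h, h1]
  have all₁ (t : Lam) (y) : CoverSum.inTwo (hξ := hξ) (hr := hr) t 1 y ∈ N := by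
    obtain ⟨Y, rfl⟩ := TwoDim.exists_smul t.2 y
    rw [map_smul]; exact N.smul_mem Y (two₁ t)
  have two₀ (t : Lam) : CoverSum.inTwo t 0 (TwoDim.e₁ hξ hr t.1.1 t.1.2) ∈ N := by
    have h4 : (4 : ZMod 4) = 0 := by decide
    -- This is the index for which e₂ has the same weight as e₁ for t. Its copy 1 already lies in N,
    -- so its contribution can be subtracted.
    let t' : Lam := ⟨(t.1.1 + 1, t.1.2 + 2), fun h => t.2 (by
      simp only at h; linear_combination h)⟩
    have z₀ (s' : Lam) (y) (s : Lam) : (Pi.single s' (Pi.single 1 y) :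
        ∀ t : Lam, Fin 2 → TwoDim hξ hr t.1.1 t.1.2) s 0 = 0 := by
      by_cases h : s = s'
      · subst h; simp
      · simp [h]
    have z₁ (s' : Lam) (y) (s : Lam) : (Pi.single s' (Pi.single 0 y) :
        ∀ t : Lam, Fin 2 → TwoDim hξ hr t.1.1 t.1.2) s 1 = 0 := by
      by_cases h : s = s'
      · subst h; simp
      · simp [h]
    convert N.sub_mem (N.smul_mem (weightProj hξ t.1.1 t.1.2) hN)
      (all₁ t' (TwoDim.e₂ hξ hr t'.1.1 t'.1.2))
    rw [CoverSum.weightProj_gen]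
    refine Prod.ext ?_ ?_
    · funext ℓ
      have h1 : ¬(ℓ = t.1.1 ∧ 2 * ℓ = t.1.2) := by
        rintro ⟨rfl, h'⟩; exact t.2 h'
      simp [CoverSum.inTwo, h1]
    · funext s i
      fin_cases i
      · by_cases h : s = t
        · subst h; simp [CoverSum.inTwo, z₀]
        · have h1 : ¬(s.1.1 = t.1.1 ∧ s.1.2 = t.1.2) := fun hh =>
            h (Subtype.ext (Prod.ext hh.1 hh.2))
          simp [CoverSum.inTwo, h, h1, z₀]
      · by_cases h : s = t'
        · subst h
          have h1 : t'.1.1 + 3 = t.1.1 ∧ t'.1.2 + 2 = t.1.2 :=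
            ⟨by simp only [t']; linear_combination h4, by simp only [t']; linear_combination h4⟩
          simp [CoverSum.inTwo, h1, z₁]
        · have h1 : ¬(s.1.1 + 3 = t.1.1 ∧ s.1.2 + 2 = t.1.2) := by
            rintro ⟨h1, h2⟩
            refine h (Subtype.ext (Prod.ext ?_ ?_))
            · simp only [t']; linear_combination h1 - h4
            · simp only [t']; linear_combination h2 - h4
          simp [CoverSum.inTwo, h, h1, z₁]
  -- The quotient map by N kills a generator of every summand, hence every summand.
  have key : N.mkQ = 0 := by
    refine CoverSum.hom_eq_zero (fun ℓ => ?_) (fun t n => ?_)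
    · ext y
      obtain ⟨Y, rfl⟩ := FourDim.exists_smul y
      simp [(Submodule.Quotient.mk_eq_zero N).2 (four ℓ)]
    · ext y
      obtain ⟨Y, rfl⟩ := TwoDim.exists_smul t.2 y
      fin_cases n
      · simp [(Submodule.Quotient.mk_eq_zero N).2 (two₀ t)]
      · simp [(Submodule.Quotient.mk_eq_zero N).2 (two₁ t)]
  rw [← N.ker_mkQ, key, LinearMap.ker_zero]

omit [CharZero k] in
lemma finrank_le_eight (hξ : IsPrimitiveRoot ξ 4) : Module.finrank k (KAlg hξ) ≤ 8 := by
  have h := finrank_range_le_card (R := k) (![1, a hξ, b hξ, c hξ, d hξ, a hξ ^ 2, a hξ * b hξ,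
    a hξ * c hξ])
  have e : Set.range (![1, a hξ, b hξ, c hξ, d hξ, a hξ ^ 2, a hξ * b hξ, a hξ * c hξ]) =
      {1, a hξ, b hξ, c hξ, d hξ, a hξ ^ 2, a hξ * b hξ, a hξ * c hξ} := by
    simp [Matrix.range_cons]
    ext
    simp only [Set.mem_insert_iff, Set.mem_singleton_iff]
    tauto
  rw [e, Set.finrank, span_eq_top, finrank_top] at h
  simpa using h

instance : Module.Finite k (D hξ) :=
  inferInstanceAs (Module.Finite k (Module.Dual k (KAlg hξ) ⊗[k] KAlg hξ))

omit [CharZero k] in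
lemma finrank_double_le (hξ : IsPrimitiveRoot ξ 4) : Module.finrank k (D hξ) ≤ 64 := by
  change Module.finrank k (Module.Dual k (KAlg hξ) ⊗[k] KAlg hξ) ≤ 64
  rw [Module.finrank_tensorProduct, Subspace.dual_finrank_eq]
  exact Nat.mul_le_mul (finrank_le_eight hξ) (finrank_le_eight hξ)

-- Surjectivity is cyclicity of the sum; injectivity follows by rank-nullity, since the target has
-- dimension 64 and D at most 64.
variable (hξ hr) in
lemma bijective_smul_gen :
    Function.Bijective (LinearMap.toSpanSingleton (D hξ) _ (CoverSum.gen hξ hr)) := by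
  have hs : Function.Surjective (LinearMap.toSpanSingleton (D hξ) _ (CoverSum.gen hξ hr)) := by
    rw [← LinearMap.range_eq_top]
    exact CoverSum.eq_top_of_gen_mem ⟨1, one_smul _ _⟩
  refine ⟨?_, hs⟩
  -- The same map, regarded as k-linear between the underlying vector spaces so that dimensions can
  -- be compared.
  let φ : D hξ →ₗ[k] (ZMod 4 → Fin 4 → k) × (Lam → Fin 2 → Fin 2 → k) :=
    { toFun := fun Y => LinearMap.toSpanSingleton (D hξ) _ (CoverSum.gen hξ hr) Y
      map_add' := fun Y Z => map_add _ Y Z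
      map_smul' := fun s Y => by
        refine Prod.ext ?_ ?_
        · funext ℓ
          exact LinearMap.congr_fun (map_smul (fourDimTwist hξ hr ℓ) s Y) _
        · funext t n
          exact LinearMap.congr_fun (map_smul (twoDim hξ hr t.1.1 t.1.2) s Y) _ }
  have hφ : Function.Surjective φ := hs
  have h1 := LinearMap.finrank_range_add_finrank_ker φ
  rw [LinearMap.range_eq_top.2 hφ, finrank_top] at h1
  have h2 : Module.finrank k ((ZMod 4 → Fin 4 → k) × (Lam → Fin 2 → Fin 2 → k)) = 64 := by
    have e1 : Fintype.card Lam = 12 := by decide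
    simp [Module.finrank_pi_fintype, e1]
  have h3 := finrank_double_le hξ
  have h4 : Module.finrank k (LinearMap.ker φ) = 0 := by omega
  have h5 : Function.Injective φ := by
    rw [← LinearMap.ker_eq_bot]
    exact Submodule.finrank_eq_zero.1 h4
  exact h5

variable (hξ hr) in
/-- The decomposition of the left regular module. -/
def regularEquiv : D hξ ≃ₗ[D hξ] CoverSum hξ hr :=
  LinearEquiv.ofBijective _ (bijective_smul_gen hξ hr)

lemma CoverSum.projective : Module.Projective (D hξ) (CoverSum hξ hr) :=
  Module.Projective.of_equiv (regularEquiv hξ hr)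

lemma FourDim.projective (ℓ : ZMod 4) : Module.Projective (D hξ) (FourDim hξ hr ℓ) := by
  have := CoverSum.projective (hξ := hξ) (hr := hr)
  refine Module.Projective.of_split (CoverSum.inFour ℓ) (LinearMap.proj ℓ ∘ₗ LinearMap.fst _ _ _) ?_
  ext y
  simp [CoverSum.inFour]

lemma TwoDim.projective {i j : ZMod 4} (h : 2 * i ≠ j) :
    Module.Projective (D hξ) (TwoDim hξ hr i j) := by
  have := CoverSum.projective (hξ := hξ) (hr := hr)
  let t : Lam := ⟨(i, j), h⟩
  refine Module.Projective.of_split (CoverSum.inTwo t 0)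
    (LinearMap.proj (0 : Fin 2) ∘ₗ LinearMap.proj t ∘ₗ LinearMap.snd _ _ _) ?_
  ext y
  simp [CoverSum.inTwo, t]

end regular

/-! ### Projective covers and classification of the simple modules. -/

section covers

/-- The kernel is a proper submodule, so it lies in the superfluous submodule `ker π` and is itself
superfluous. -/
lemma FourDim.isProjectiveCover_of_surjective {ℓ : ZMod 4} {S : Type w} [AddCommGroup S]
    [Module (D hξ) S] [Nontrivial S] {f : FourDim hξ hr ℓ →ₗ[D hξ] S}
    (hf : Function.Surjective f) : IsProjectiveCover (D hξ) (FourDim hξ hr ℓ) S := by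
  refine ⟨FourDim.projective ℓ, f, hf, fun N hN => ?_⟩
  have hk : LinearMap.ker f ≠ ⊤ := by
    rw [Ne, LinearMap.ker_eq_top]
    rintro rfl
    obtain ⟨y, hy⟩ := exists_ne (0 : S)
    obtain ⟨z, rfl⟩ := hf y
    exact hy rfl
  exact FourDim.eq_top_of_sup_ker_π
    (top_le_iff.1 (hN.symm.le.trans (sup_le_sup_left (FourDim.le_ker_π hk) N)))

lemma TwoDim.isProjectiveCover_of_bijective {i j : ZMod 4} (h : 2 * i ≠ j) {S : Type w}
    [AddCommGroup S] [Module (D hξ) S] {f : TwoDim hξ hr i j →ₗ[D hξ] S}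
    (hf : Function.Bijective f) : IsProjectiveCover (D hξ) (TwoDim hξ hr i j) S := by
  refine ⟨TwoDim.projective h, f, hf.2, fun N hN => ?_⟩
  rwa [LinearMap.ker_eq_bot.2 hf.1, sup_bot_eq] at hN

variable (hξ) in
/-- The module `S` has a nonzero vector on which `a`, `g` act by `ξ^m`, `ξ^n` and `c` by zero. -/
def HasHighestWeight (S : Type w) [AddCommGroup S] [Module (D hξ) S] (m n : ZMod 4) : Prop :=
  ∃ y : S, y ≠ 0 ∧ D.ofK (c hξ) • y = 0 ∧ weightProj hξ m n • y = y

omit [CharZero k] in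
lemma HasHighestWeight.of_equiv {S : Type v} {S' : Type w} [AddCommGroup S] [Module (D hξ) S]
    [AddCommGroup S'] [Module (D hξ) S'] (e : S ≃ₗ[D hξ] S') {m n : ZMod 4}
    (h : HasHighestWeight hξ S m n) : HasHighestWeight hξ S' m n := by
  obtain ⟨y, h0, h1, h2⟩ := h
  exact ⟨e y, by simpa using h0, by rw [← map_smul, h1, map_zero], by rw [← map_smul, h2]⟩

lemma OneDim.hasHighestWeight_iff (ℓ m n : ZMod 4) :
    HasHighestWeight hξ (OneDim hξ hr ℓ) m n ↔ ℓ = m ∧ 2 * ℓ = n := by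
  constructor
  · rintro ⟨y, h0, -, h2⟩
    rw [OneDim.weightProj_smul] at h2
    by_contra h
    rw [if_neg h] at h2
    exact h0 h2.symm
  · intro h
    refine ⟨RepModule.of _ 1, one_ne_zero (α := k), OneDim.c_smul _ _, ?_⟩
    rw [OneDim.weightProj_smul, if_pos h]

/-- Up to scalars e₁ is the only vector killed by c, so its weight is the only one. -/
lemma TwoDim.hasHighestWeight_iff (i j m n : ZMod 4) :
    HasHighestWeight hξ (TwoDim hξ hr i j) m n ↔ i = m ∧ j = n := by
  constructor
  · rintro ⟨y, h0, h1, h2⟩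
    obtain ⟨s, rfl⟩ := TwoDim.eq_smul_of_c_smul_eq_zero h1
    rw [← mul_smul, ← Algebra.commutes, mul_smul, TwoDim.weightProj_e₁] at h2
    by_contra h
    rw [if_neg h, smul_zero] at h2
    exact h0 h2.symm
  · intro h
    refine ⟨TwoDim.e₁ hξ hr i j, TwoDim.e₁_ne_zero i j, TwoDim.c_smul_e₁ i j, ?_⟩
    rw [TwoDim.weightProj_e₁, if_pos h]

/-- The weight of the simple module with a given projective cover. -/
def coverWeight : ZMod 4 ⊕ Lam → ZMod 4 × ZMod 4 :=
  Sum.elim (fun ℓ => (ℓ, 2 * ℓ)) (fun t => t.1)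

/-- Mixed cases are excluded because Λ is the complement of the pairs (ℓ, 2ℓ). -/
lemma coverWeight_injective : Function.Injective coverWeight := by
  rintro (ℓ | t) (ℓ' | t') h
  · exact congrArg Sum.inl (congrArg Prod.fst h)
  · have h' : (ℓ, 2 * ℓ) = t'.1 := h
    exact absurd (by rw [← h']) t'.2
  · have h' : t.1 = (ℓ', 2 * ℓ') := h
    exact absurd (by rw [h']) t.2
  · exact congrArg Sum.inr (Subtype.ext h)

/-- The kernel of f is maximal and contained in the proper submodule `ker π`, so the two kernels
agree and so do the quotients. -/
lemma FourDim.nonempty_equiv_of_surjective {ℓ : ZMod 4} {S : Type w} [AddCommGroup S]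
    [Module (D hξ) S] [IsSimpleModule (D hξ) S] {f : FourDim hξ hr ℓ →ₗ[D hξ] S}
    (hf : Function.Surjective f) : Nonempty (OneDim hξ hr ℓ ≃ₗ[D hξ] S) := by
  have hc : IsCoatom (LinearMap.ker f) := LinearMap.isCoatom_ker_of_surjective hf
  have e : LinearMap.ker (FourDim.π hξ hr ℓ) = LinearMap.ker f :=
    ((hc.le_iff.1 (FourDim.le_ker_π hc.1)).resolve_left (FourDim.ker_π_ne_top ℓ))
  exact ⟨((FourDim.π hξ hr ℓ).quotKerEquivOfSurjective (FourDim.π_surjective ℓ)).symm.trans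
    ((Submodule.quotEquivOfEq _ _ e).trans (f.quotKerEquivOfSurjective hf))⟩

variable (hξ hr) in
/-- The modules `P ⊗ k_{χ^ℓ}` and `V_{i,j}` as candidates for the projective cover of `S`. -/
def IsCoveredBy (S : Type w) [AddCommGroup S] [Module (D hξ) S] : ZMod 4 ⊕ Lam → Prop :=
  Sum.elim (fun ℓ => IsProjectiveCover (D hξ) (FourDim hξ hr ℓ) S)
    (fun t => IsProjectiveCover (D hξ) (TwoDim hξ hr t.1.1 t.1.2) S)

/-- A cover determines S up to isomorphism, as k_{χ^ℓ} or V_{i,j}, and highest weights are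
isomorphism invariants. This is what makes the cover unique. -/
lemma IsCoveredBy.hasHighestWeight_iff {S : Type w} [AddCommGroup S] [Module (D hξ) S]
    [IsSimpleModule (D hξ) S] {s : ZMod 4 ⊕ Lam} (h : IsCoveredBy hξ hr S s) (m n : ZMod 4) :
    HasHighestWeight hξ S m n ↔ coverWeight s = (m, n) := by
  rcases s with ℓ | t
  · obtain ⟨-, f, hf, -⟩ := h
    obtain ⟨e⟩ := FourDim.nonempty_equiv_of_surjective hf
    rw [show coverWeight (.inl ℓ) = (ℓ, 2 * ℓ) from rfl, Prod.mk_inj,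
      ← OneDim.hasHighestWeight_iff (hξ := hξ) (hr := hr)]
    exact ⟨.of_equiv e.symm, .of_equiv e⟩
  · obtain ⟨-, f, hf, -⟩ := h
    have := TwoDim.isSimpleModule (hξ := hξ) (hr := hr) t.2
    have := IsSimpleModule.nontrivial (D hξ) S
    have hf0 : f ≠ 0 := by
      rintro rfl
      obtain ⟨y, hy⟩ := exists_ne (0 : S)
      obtain ⟨z, rfl⟩ := hf y
      exact hy rfl
    have e := LinearEquiv.ofBijective f (LinearMap.bijective_of_ne_zero hf0)
    rw [show coverWeight (.inr t) = (t.1.1, t.1.2) from rfl, Prod.mk_inj,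
      ← TwoDim.hasHighestWeight_iff (hξ := hξ) (hr := hr)]
    exact ⟨.of_equiv e.symm, .of_equiv e⟩

/-- A nonzero y in S gives a nonzero map from the regular module, which must be nonzero on some
summand; into a simple module it is then surjective there, and by Schur's lemma bijective if the
summand is a V. -/
lemma exists_isCoveredBy (S : Type w) [AddCommGroup S] [Module (D hξ) S]
    [IsSimpleModule (D hξ) S] : ∃ s, IsCoveredBy hξ hr S s := by
  have := IsSimpleModule.nontrivial (D hξ) S
  obtain ⟨y, hy⟩ := exists_ne (0 : S)
  let f : CoverSum hξ hr →ₗ[D hξ] S :=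
    LinearMap.toSpanSingleton (D hξ) S y ∘ₗ (regularEquiv hξ hr).symm.toLinearMap
  have hf : f ≠ 0 := by
    intro h
    have := LinearMap.congr_fun h (regularEquiv hξ hr 1)
    simp [f, hy] at this
  by_contra! hS
  refine hf (CoverSum.hom_eq_zero (fun ℓ => ?_) (fun t n => ?_))
  · by_contra h
    exact hS (.inl ℓ) (FourDim.isProjectiveCover_of_surjective (LinearMap.surjective_of_ne_zero h))
  · by_contra h
    have := TwoDim.isSimpleModule (hξ := hξ) (hr := hr) t.2
    exact hS (.inr t)
      (TwoDim.isProjectiveCover_of_bijective t.2 (LinearMap.bijective_of_ne_zero h))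

lemma existsUnique_isCoveredBy (S : Type w) [AddCommGroup S] [Module (D hξ) S]
    [IsSimpleModule (D hξ) S] : ∃! s, IsCoveredBy hξ hr S s := by
  obtain ⟨s, hs⟩ := exists_isCoveredBy (hξ := hξ) (hr := hr) S
  refine ⟨s, hs, fun s' hs' => coverWeight_injective ?_⟩
  exact (hs'.hasHighestWeight_iff _ _).1 ((hs.hasHighestWeight_iff _ _).2 rfl)

lemma isProjectiveCover_congr {A : Type u} [Ring A] {P : Type v} {P' : Type v} {S : Type w}
    [AddCommGroup P] [Module A P] [AddCommGroup P'] [Module A P'] [AddCommGroup S] [Module A S]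
    (e : P ≃ₗ[A] P') (h : IsProjectiveCover A P S) : IsProjectiveCover A P' S := by
  obtain ⟨hP, π, hπ, hN⟩ := h
  refine ⟨Module.Projective.of_equiv e, π ∘ₗ e.symm.toLinearMap, hπ.comp e.symm.surjective,
    fun N h => ?_⟩
  -- Superfluity is transported by pulling N back along e: a decomposition of e y maps under the
  -- inverse of e to one of y.
  have h' : N.comap e.toLinearMap = ⊤ := by
    refine hN _ (eq_top_iff.2 fun y _ => ?_)
    have hy : e y ∈ N ⊔ LinearMap.ker (π ∘ₗ e.symm.toLinearMap) := by rw [h]; trivial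
    obtain ⟨n, hn, z, hz, hnz⟩ := Submodule.mem_sup.1 hy
    refine Submodule.mem_sup.2 ⟨e.symm n, by simpa using hn, e.symm z, hz, ?_⟩
    rw [← map_add, hnz, e.symm_apply_apply]
  refine eq_top_iff.2 fun z _ => ?_
  have hz : e.symm z ∈ N.comap e.toLinearMap := by rw [h']; trivial
  simpa using hz

variable (hξ hr) in
/-- The tensor product `P ⊗ k_{χ^ℓ}` on the underlying space of `P`. -/
def tensorEquiv (ℓ : ZMod 4) : FourDim hξ hr ℓ ≃ₗ[D hξ] RepModule ((repFamily hξ hr).PT ℓ) :=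
  repEquiv _ _ (TensorProduct.rid k (Fin 4 → k)).symm fun Y m => by
    simp [repFamily]

end covers

end HopfK
end

theorem mainTheorem4 {k : Type u} [Field k] [IsAlgClosed k] [CharZero k] (ξ r : k)
    (hξ : IsPrimitiveRoot ξ 4) (hr : r ^ 2 = 2) :
    ∃ M : HopfK.RepFamily hξ r, (∀ M' : HopfK.RepFamily hξ r, M' = M) ∧
      -- `P ⊗ k_{χ^ℓ}` is the projective cover of the simple module `k_{χ^ℓ}`
      (∀ ℓ : ZMod 4,
        IsSimpleModule (HopfK.D hξ) (RepModule (HopfK.charRep (M.χ ℓ))) ∧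
        IsProjectiveCover (HopfK.D hξ) (RepModule (M.PT ℓ))
          (RepModule (HopfK.charRep (M.χ ℓ)))) ∧
      -- `V_{i,j}` is simple and is its own projective cover
      (∀ t : HopfK.Lam,
        IsSimpleModule (HopfK.D hξ) (RepModule (M.V t)) ∧
        IsProjectiveCover (HopfK.D hξ) (RepModule (M.V t)) (RepModule (M.V t))) ∧
      -- every simple module has exactly one of these modules as its projective cover
      (∀ (S : Type w) [AddCommGroup S] [Module (HopfK.D hξ) S],
        IsSimpleModule (HopfK.D hξ) S →
          ∃! s : ZMod 4 ⊕ HopfK.Lam, Sum.elim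
            (fun ℓ => IsProjectiveCover (HopfK.D hξ) (RepModule (M.PT ℓ)) S)
            (fun t => IsProjectiveCover (HopfK.D hξ) (RepModule (M.V t)) S) s) ∧
      -- the decomposition of the left regular module
      Nonempty (HopfK.D hξ ≃ₗ[HopfK.D hξ]
        ((∀ ℓ : ZMod 4, RepModule (M.PT ℓ)) ×
          (∀ t : HopfK.Lam, Fin 2 → RepModule (M.V t)))) := by
  -- The preceding results concern the model on the space of P; covers are transferred to the actual
  -- tensor product along `tensorEquiv`.
  have hcov {S : Type w} [AddCommGroup S] [Module (HopfK.D hξ) S] (ℓ : ZMod 4) :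
      IsProjectiveCover (HopfK.D hξ) (RepModule ((HopfK.repFamily hξ hr).PT ℓ)) S ↔
        IsProjectiveCover (HopfK.D hξ) (HopfK.FourDim hξ hr ℓ) S :=
    ⟨HopfK.isProjectiveCover_congr (HopfK.tensorEquiv hξ hr ℓ).symm,
      HopfK.isProjectiveCover_congr (HopfK.tensorEquiv hξ hr ℓ)⟩
  refine ⟨HopfK.repFamily hξ hr, HopfK.repFamily_unique hξ hr, fun ℓ => ?_, fun t => ?_, ?_, ?_⟩
  · have hs := HopfK.OneDim.isSimpleModule (hξ := hξ) (hr := hr) ℓ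
    have := IsSimpleModule.nontrivial (HopfK.D hξ) (HopfK.OneDim hξ hr ℓ)
    exact ⟨hs, HopfK.isProjectiveCover_congr (HopfK.tensorEquiv hξ hr ℓ)
      (HopfK.FourDim.isProjectiveCover_of_surjective (S := HopfK.OneDim hξ hr ℓ)
        (HopfK.FourDim.π_surjective ℓ))⟩
  · exact ⟨HopfK.TwoDim.isSimpleModule (hr := hr) t.2,
      HopfK.TwoDim.isProjectiveCover_of_bijective (hr := hr) (S := HopfK.TwoDim hξ hr t.1.1 t.1.2)
        t.2 (f := LinearMap.id) Function.bijective_id⟩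
  · intro S _ _ _
    refine (existsUnique_congr fun s => ?_).1
      (HopfK.existsUnique_isCoveredBy (hξ := hξ) (hr := hr) S)
    rcases s with ℓ | t
    · exact (hcov ℓ).symm
    · exact Iff.rfl
  · exact ⟨(HopfK.regularEquiv hξ hr).trans (LinearEquiv.prodCongr
      (LinearEquiv.piCongrRight (HopfK.tensorEquiv hξ hr)) (LinearEquiv.refl _ _))⟩
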